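/- **Conventions.** An alphabet for a group $G$ is a finite set $A$ with an involution $a\mapsto a^{-1}$ and a map $a\mapsto\bar a$ to $G$ with $\overline{a^{-1}}=\bar a^{-1}$ whose extension $A^*\to G$, $w\mapsto\bar w$, is onto; $d$ denotes its word metric. A word $w$ is also regarded as the path in the Cayley graph from $1$ labelled by $w$, constant after its end. An *asynchronous automatic structure* on $G$ is a regular language $L\subset A^*$ over such an alphabet that is finite-to-one over $G$, satisfies $\overline L=G$, and has the asynchronous fellow traveller property: for some $K$, any $w,w'\in L$ with $d(\bar w,\bar w')\le1$ asynchronously $K$-fellow travel, i.e. $d(w(\phi(t)),w'(\psi(t)))\le K$ for all $t$, for some monotone reparametrizations $\phi,\psi$ of the half-line of times onto itself. It is *asynchronously biautomatic* if moreover there is $K$ such that $w$ and the translated path $a w'$ asynchronously $K$-fellow travel whenever $w,w'\in L$, $a\in\overline A\cup\{1\}$ and $\bar w=a\bar w'$. It is *biautomatic* if both properties hold with $\phi=\psi=\mathrm{id}$. Two such languages (over possibly different alphabets) are equivalent, $L\sim L'$, if for some $K$ any $w\in L$ and $w'\in L'$ with $\bar w=\bar w'$ asynchronously $K$-fellow travel.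 Let $\mathfrak A(G)$ be the set of classes $[L]$ of asynchronous automatic structures, and $B\mathfrak A(G)$, $BS\mathfrak A(G)\subset\mathfrak A(G)$ the sets of the classes that contain an asynchronously biautomatic, respectively a biautomatic structure. A set $S\subset G$ is $[L]$-rational if $\{w\in L:\bar w\in S\}$ is regular. For $g\in G$, $g[L]$ is the class of the translate $gL$. Let $\mathcal Y$ be a graph of groups with finite connected underlying graph $Y$, vertex groups $G_V$, finite edge groups $F_E=F_{E^{-1}}$ and injections $\partial_0:F_E\to G_{\partial_0E}$, $\partial_1:F_E\to G_{\partial_1E}$, exchanged when $E$ is replaced by $E^{-1}$. Fix a maximal tree $T$ and a base vertex $V_0$, and let $G=\pi_1(\mathcal Y)$ be generated by the $G_V$ and elements $t_E$ for the oriented edges $E$, with relations $t_{E^{-1}}=t_E^{-1}$, $t_E=1$ for $E\in T$, and $\partial_0(f)\,t_E=t_E\,\partial_1(f)$ for $f\in F_E$. A *$\mathcal Y$-graph* $\mathcal X$ is a finite directed graph $X$ with a graph map $\pi$ to $Y$ (with its oriented edges) and a start vertex $v_0$ over $V_0$, from which every vertex is reached by a directed path, such that: * Each vertex $v$ is labelled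 by a class $[L_v]\in\mathfrak A(G_{\pi(v)})$. * Each edge $e$ out of $v$ is labelled by an $[L_v]$-rational set $S_e\subset G_{\pi(v)}$. For each $E$ out of $\pi(v)$, the labels of the $E$-edges (those over $E$) out of $v$ are disjoint. Their union is $G_{\pi(v)}$ if $v=v_0$ or if $v$ has an incoming edge that is not an $E^{-1}$-edge, and $G_{\pi(v)}\smallsetminus\partial_0F_E$ otherwise. * For each $v$ and each $E$ out of $\pi(v)$, $F_E$ acts on $X$ over $Y$, fixing all vertices except those reached by an $E$-edge from $v$. For $f\in F_E$: $[L_{fv'}]=\partial_1(f)[L_{v'}]$ for each $v'$ reached by an $E$-edge from $v$; $S_{fe}=S_e\,\partial_0(f)^{-1}$ for each $E$-edge $e$ out of $v$; and $S_{fe}=\partial_1(f)S_e$ for each edge $e$ out of a vertex reached by an $E$-edge from $v$. A *convenient alphabet* $A$ for $G$ consists of letters evaluating into vertex groups and one letter $t_E$ for each $E\notin T$ (with $t_{E^{-1}}=t_E^{-1}$), such that the set $A_V$ of the letters evaluating into $G_V$ is an alphabet for $G_V$ for each $V$, and each element of each $\partial_1F_E$, as well as $1$, is the value of exactly one letter.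 Given $A$ and structures $L_v\subset A_{\pi(v)}^*$ in the classes labelling the vertices of $\mathcal X$, the language $L_{\mathcal X}$ consists of all words $u_0t_{\pi(e_1)}u_1\cdots t_{\pi(e_m)}u_m$, $m\ge0$, where $t_E$ is the empty word for $E\in T$, $e_1\cdots e_m$ is a directed path in $X$ from $v_0$ with vertices $v_0,v_1,\dots,v_m$, $u_k\in L_{v_k}$ for $0\le k\le m$, $\bar u_k\in S_{e_{k+1}}$ for $0\le k<m$, and $\bar u_k\notin\partial_0F_{\pi(e_{k+1})}$ whenever $\pi(e_{k+1})=\pi(e_k)^{-1}$. An asynchronous automatic structure $L$ on $G$ *has the $\mathcal Y$-graph* $\mathcal X$ if $L\sim L_{\mathcal X}$ for some such choices. **Theorem 4.2.** Let $L$ be an asynchronous automatic structure on $G=\pi_1(\mathcal Y)$. 1. $L$ is asynchronously biautomatic if and only if $L$ has a $\mathcal Y$-graph for which $\pi$ is an isomorphism of $X$ onto $Y$ and every vertex $v$ is labelled by an element of $B\mathfrak A(G_{\pi(v)})$. 2. $L$ is equivalent to a biautomatic structure if and only if $L$ has a $\mathcal Y$-graph for which $\pi$ is an isomorphism of $X$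 onto $Y$ and every vertex $v$ is labelled by an element of $BS\mathfrak A(G_{\pi(v)})$. 3. There are bijections $B\mathfrak A(G)\to\prod_V B\mathfrak A(G_V)$ and $BS\mathfrak A(G)\to\prod_V BS\mathfrak A(G_V)$. Each sends $[L]$ to the labels of a $\mathcal Y$-graph of $L$ for which $\pi$ is an isomorphism, and its component at $V$ is the class induced by $[L]$ on $G_V$: for $M$ in this class and some $K$, any $w\in L$ and $u\in M$ with the same value asynchronously $K$-fellow travel in $G$. -/

import Mathlib

universe u v w x

section Alphabets

/-- A finite alphabet for a group `G`: a finite set of letters with an involution `inv` and an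
evaluation map `ev` into `G` that respects inverses and whose extension to words is onto. -/
structure Alphabet (G : Type u) [Group G] where
  Letter : Type
  finite_letter : Finite Letter
  inv : Letter → Letter
  inv_inv : ∀ a, inv (inv a) = a
  ev : Letter → G
  ev_inv : ∀ a, ev (inv a) = (ev a)⁻¹
  onto : ∀ g : G, ∃ l : List Letter, (l.map ev).prod = g

namespace Alphabet

variable {G : Type u} [Group G]

/-- The value in `G` of a word. -/
def val (A : Alphabet G) (l : List A.Letter) : G := (l.map A.ev).prod

/-- The path in the Cayley graph labelled by a word and starting at `1`, at integer times;
after the end of the word it stays at the value of the word. -/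
def path (A : Alphabet G) (l : List A.Letter) (t : ℕ) : G := A.val (l.take t)

/-- `A.DistLE K g h`: the distance of `g` and `h` in the word metric of `A` is at most `K`. -/
def DistLE (A : Alphabet G) (K : ℕ) (g h : G) : Prop :=
  ∃ l : List A.Letter, l.length ≤ K ∧ g * A.val l = h

/-- Two paths synchronously `K`-fellow travel. -/
def SyncTravel (A : Alphabet G) (K : ℕ) (p q : ℕ → G) : Prop :=
  ∀ t, A.DistLE K (p t) (q t)

/-- Two paths asynchronously `K`-fellow travel: they do so after monotone reparametrizations of
the half-line of times onto itself. -/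
def AsyncTravel (A : Alphabet G) (K : ℕ) (p q : ℕ → G) : Prop :=
  ∃ φ ψ : ℕ → ℕ, Monotone φ ∧ Function.Surjective φ ∧ Monotone ψ ∧ Function.Surjective ψ ∧
    ∀ t, A.DistLE K (p (φ t)) (q (ψ t))

/-- The language maps onto the group. -/
def IsNormalForm (A : Alphabet G) (L : Language A.Letter) : Prop :=
  ∀ g : G, ∃ l ∈ L, A.val l = g

/-- Every group element is the value of only finitely many words of the language. -/
def IsFiniteToOne (A : Alphabet G) (L : Language A.Letter) : Prop :=
  ∀ g : G, {l : List A.Letter | l ∈ L ∧ A.val l = g}.Finite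

/-- The asynchronous fellow traveller property. -/
def HasAsyncFTP (A : Alphabet G) (L : Language A.Letter) : Prop :=
  ∃ K : ℕ, ∀ l ∈ L, ∀ l' ∈ L, A.DistLE 1 (A.val l) (A.val l') →
    A.AsyncTravel K (A.path l) (A.path l')

/-- The synchronous fellow traveller property. -/
def HasSyncFTP (A : Alphabet G) (L : Language A.Letter) : Prop :=
  ∃ K : ℕ, ∀ l ∈ L, ∀ l' ∈ L, A.DistLE 1 (A.val l) (A.val l') →
    A.SyncTravel K (A.path l) (A.path l')

/-- Two languages for the same group, over possibly different alphabets, are equivalent: there is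
a constant `K` such that a word of the first and a word of the second that represent the same
element asynchronously `K`-fellow travel. (Any two word metrics are bi-Lipschitz equivalent, so it
does not matter which of them is used here.) -/
def LangEquiv (A : Alphabet G) (L : Language A.Letter) (B : Alphabet G)
    (M : Language B.Letter) : Prop :=
  ∃ K : ℕ, ∀ l ∈ L, ∀ m ∈ M, A.val l = B.val m → A.AsyncTravel K (A.path l) (B.path m)

theorem val_append (A : Alphabet G) (l m : List A.Letter) :
    A.val (l ++ m) = A.val l * A.val m := by simp [val]

theorem val_inv (A : Alphabet G) (l : List A.Letter) :
    A.val (l.map A.inv).reverse = (A.val l)⁻¹ := by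
  induction l with
  | nil => simp [val]
  | cons a l ih =>
    rw [List.map_cons, List.reverse_cons, val_append, ih]
    simp [val, A.ev_inv]

theorem DistLE.symm {A : Alphabet G} {K : ℕ} {g h : G} (H : A.DistLE K g h) :
    A.DistLE K h g := by
  obtain ⟨l, hl, rfl⟩ := H
  exact ⟨(l.map A.inv).reverse, by simpa using hl, by rw [val_inv]; group⟩

theorem DistLE.trans {A : Alphabet G} {K M : ℕ} {g h k : G} (H : A.DistLE K g h)
    (H' : A.DistLE M h k) : A.DistLE (K + M) g k := by
  obtain ⟨l, hl, rfl⟩ := H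
  obtain ⟨m, hm, rfl⟩ := H'
  exact ⟨l ++ m, by simpa using add_le_add hl hm, by rw [val_append, mul_assoc]⟩

theorem exists_distLE_of_distLE (A B : Alphabet G) (K : ℕ) :
    ∃ K' : ℕ, ∀ g h : G, A.DistLE K g h → B.DistLE K' g h := by
  have := A.finite_letter
  choose f hf using fun a : A.Letter => B.onto (A.ev a)
  obtain ⟨M, hM⟩ := (Set.finite_range fun a => (f a).length).bddAbove
  refine ⟨K * M, ?_⟩
  have key : ∀ l : List A.Letter, ∃ m : List B.Letter,
      m.length ≤ l.length * M ∧ B.val m = A.val l := by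
    intro l
    induction l with
    | nil => exact ⟨[], by simp, by simp [val]⟩
    | cons a l ih =>
      obtain ⟨m, hm, hv⟩ := ih
      refine ⟨f a ++ m, ?_, ?_⟩
      · have h1 : (f a).length ≤ M := hM ⟨a, rfl⟩
        rw [List.length_append, List.length_cons, add_mul]
        omega
      · rw [val_append, hv]
        have h2 : B.val (f a) = A.ev a := hf a
        rw [h2]
        simp [val]
  rintro g h ⟨l, hl, rfl⟩
  obtain ⟨m, hm, hv⟩ := key l
  exact ⟨m, hm.trans (Nat.mul_le_mul_right M hl), by rw [hv]⟩

theorem surjective_of_steps {f : ℕ → ℕ} (h0 : f 0 = 0) (hs : ∀ t, f (t + 1) ≤ f t + 1)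
    (hu : ∀ n, ∃ t, n ≤ f t) : Function.Surjective f := by
  classical
  intro n
  refine ⟨Nat.find (hu n), le_antisymm ?_ (Nat.find_spec (hu n))⟩
  rcases hk : Nat.find (hu n) with _ | k
  · omega
  · have h1 : ¬ n ≤ f k := Nat.find_min (hu n) (by omega)
    have h2 := hs k
    omega

theorem exists_common_reparam {φ ψ : ℕ → ℕ} (hφ : Monotone φ) (sφ : Function.Surjective φ)
    (hψ : Monotone ψ) (sψ : Function.Surjective ψ) :
    ∃ α β : ℕ → ℕ, Monotone α ∧ Function.Surjective α ∧ Monotone β ∧ Function.Surjective β ∧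
      ∀ t, φ (α t) = ψ (β t) := by
  classical
  have zero : ∀ {χ : ℕ → ℕ}, Monotone χ → Function.Surjective χ → χ 0 = 0 := by
    intro χ hm hs
    obtain ⟨i, hi⟩ := hs 0
    have := hm (Nat.zero_le i)
    omega
  have jump : ∀ {χ : ℕ → ℕ}, Monotone χ → Function.Surjective χ → ∀ i, χ (i + 1) ≠ χ i →
      χ (i + 1) = χ i + 1 := by
    intro χ hm hs i hne
    obtain ⟨k, hk⟩ := hs (χ i + 1)
    have h1 : i < k := by
      by_contra h
      have := hm (not_lt.mp h)
      omega
    have h2 := hm (Nat.succ_le_of_lt h1)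
    have h3 := hm (Nat.le_succ i)
    simp only [Nat.succ_eq_add_one] at h2 h3
    omega
  let step : ℕ × ℕ → ℕ × ℕ := fun p =>
    if φ (p.1 + 1) = φ p.1 then (p.1 + 1, p.2)
    else if ψ (p.2 + 1) = ψ p.2 then (p.1, p.2 + 1) else (p.1 + 1, p.2 + 1)
  let s : ℕ → ℕ × ℕ := fun t => step^[t] (0, 0)
  have s_succ : ∀ t, s (t + 1) = step (s t) := fun t => Function.iterate_succ_apply' step t _
  have hstep : ∀ p : ℕ × ℕ, p.1 ≤ (step p).1 ∧ (step p).1 ≤ p.1 + 1 ∧ p.2 ≤ (step p).2 ∧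
      (step p).2 ≤ p.2 + 1 ∧ p.1 + p.2 + 1 ≤ (step p).1 + (step p).2 := by
    intro p
    simp only [step]
    split_ifs <;> refine ⟨?_, ?_, ?_, ?_, ?_⟩ <;> dsimp only <;> omega
  have heq : ∀ t, φ (s t).1 = ψ (s t).2 := by
    intro t
    induction t with
    | zero => exact (zero hφ sφ).trans (zero hψ sψ).symm
    | succ t ih =>
      rw [s_succ]
      simp only [step]
      split_ifs with h1 h2
      · exact h1.trans ih
      · exact ih.trans h2.symm
      · exact (jump hφ sφ _ h1).trans ((congrArg (· + 1) ih).trans (jump hψ sψ _ h2).symm)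
  have hsum : ∀ t, t ≤ (s t).1 + (s t).2 := by
    intro t
    induction t with
    | zero => exact Nat.zero_le _
    | succ t ih =>
      have := hstep (s t)
      rw [s_succ]
      omega
  have small : ∀ {χ : ℕ → ℕ}, Monotone χ → ∀ {i j}, χ i < χ j → i < j :=
    fun hm _ _ h => hm.reflect_lt h
  refine ⟨fun t => (s t).1, fun t => (s t).2, monotone_nat_of_le_succ ?_,
    surjective_of_steps rfl ?_ ?_, monotone_nat_of_le_succ ?_,
    surjective_of_steps rfl ?_ ?_, heq⟩
  · intro t; rw [s_succ]; exact (hstep _).1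
  · intro t; rw [s_succ]; exact (hstep _).2.1
  · intro n
    obtain ⟨j, hj⟩ := sψ (φ n + 1)
    refine ⟨n + j, ?_⟩
    by_contra h
    push Not at h
    have h1 := hφ h.le
    have h2 := heq (n + j)
    have h3 : (s (n + j)).2 < j := small hψ (by omega)
    have h4 := hsum (n + j)
    omega
  · intro t; rw [s_succ]; exact (hstep _).2.2.1
  · intro t; rw [s_succ]; exact (hstep _).2.2.2.1
  · intro n
    obtain ⟨j, hj⟩ := sφ (ψ n + 1)
    refine ⟨n + j, ?_⟩
    by_contra h
    push Not at h
    have h1 := hψ h.le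
    have h2 := heq (n + j)
    have h3 : (s (n + j)).1 < j := small hφ (by omega)
    have h4 := hsum (n + j)
    omega

theorem AsyncTravel.trans {A : Alphabet G} {K M : ℕ} {p q r : ℕ → G}
    (H : A.AsyncTravel K p q) (H' : A.AsyncTravel M q r) : A.AsyncTravel (K + M) p r := by
  obtain ⟨φ, ψ, hφ, sφ, hψ, sψ, h⟩ := H
  obtain ⟨φ', ψ', hφ', sφ', hψ', sψ', h'⟩ := H'
  obtain ⟨α, β, hα, sα, hβ, sβ, hαβ⟩ := exists_common_reparam hψ sψ hφ' sφ'
  refine ⟨φ ∘ α, ψ' ∘ β, hφ.comp hα, sφ.comp sα, hψ'.comp hβ, sψ'.comp sβ, fun t => ?_⟩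
  have h1 := h (α t)
  rw [hαβ t] at h1
  exact h1.trans (h' (β t))

theorem AsyncTravel.symm {A : Alphabet G} {K : ℕ} {p q : ℕ → G} (H : A.AsyncTravel K p q) :
    A.AsyncTravel K q p := by
  obtain ⟨φ, ψ, hφ, sφ, hψ, sψ, h⟩ := H
  exact ⟨ψ, φ, hψ, sψ, hφ, sφ, fun t => (h t).symm⟩

theorem exists_asyncTravel_of_asyncTravel (A B : Alphabet G) (K : ℕ) :
    ∃ K' : ℕ, ∀ p q : ℕ → G, A.AsyncTravel K p q → B.AsyncTravel K' p q := by
  obtain ⟨K', hK'⟩ := exists_distLE_of_distLE A B K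
  refine ⟨K', ?_⟩
  rintro p q ⟨φ, ψ, hφ, sφ, hψ, sψ, h⟩
  exact ⟨φ, ψ, hφ, sφ, hψ, sψ, fun t => hK' _ _ (h t)⟩

end Alphabet

/-- An asynchronous automatic structure on `G`: a regular, finite-to-one normal form with the
asynchronous fellow traveller property, over some finite alphabet for `G`. -/
structure AsyncAutStruct (G : Type u) [Group G] where
  alph : Alphabet G
  lang : Language alph.Letter
  isRegular : lang.IsRegular
  isNormalForm : alph.IsNormalForm lang
  isFiniteToOne : alph.IsFiniteToOne lang
  hasAsyncFTP : alph.HasAsyncFTP lang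

namespace AsyncAutStruct

variable {G : Type u} [Group G]

/-- The structure is asynchronously biautomatic: if `val l = g * val l'` where `g` is `1` or
the value of a letter, then the path of `l` and the translate by `g` of the path of `l'`
asynchronously `K`-fellow travel. -/
def IsAsyncBiautomatic (L : AsyncAutStruct G) : Prop :=
  ∃ K : ℕ, ∀ l ∈ L.lang, ∀ l' ∈ L.lang, ∀ g ∈ insert (1 : G) (Set.range L.alph.ev),
    L.alph.val l = g * L.alph.val l' →
      L.alph.AsyncTravel K (L.alph.path l) (fun t => g * L.alph.path l' t)

/-- The structure is (synchronously) biautomatic: it is a synchronous automatic structure, and if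
`val l = g * val l'` where `g` is `1` or the value of a letter, then the path of `l` and the
translate by `g` of the path of `l'` synchronously `K`-fellow travel. -/
def IsBiautomatic (L : AsyncAutStruct G) : Prop :=
  L.alph.HasSyncFTP L.lang ∧
  ∃ K : ℕ, ∀ l ∈ L.lang, ∀ l' ∈ L.lang, ∀ g ∈ insert (1 : G) (Set.range L.alph.ev),
    L.alph.val l = g * L.alph.val l' →
      L.alph.SyncTravel K (L.alph.path l) (fun t => g * L.alph.path l' t)

/-- Equivalence of asynchronous automatic structures. -/
instance setoid (G : Type u) [Group G] : Setoid (AsyncAutStruct G) where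
  r L M := Alphabet.LangEquiv L.alph L.lang M.alph M.lang
  iseqv :=
    { refl := by
        intro L
        obtain ⟨K, hK⟩ := L.hasAsyncFTP
        refine ⟨K, fun l hl m hm h => hK l hl m hm ⟨[], by simp, ?_⟩⟩
        rw [← h]
        simp [Alphabet.val]
      symm := by
        rintro L M ⟨K, hK⟩
        obtain ⟨K', hK'⟩ := Alphabet.exists_asyncTravel_of_asyncTravel L.alph M.alph K
        exact ⟨K', fun m hm l hl h => hK' _ _ (hK l hl m hm h.symm).symm⟩
      trans := by
        rintro L M N ⟨K, hK⟩ ⟨K', hK'⟩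
        obtain ⟨K'', hK''⟩ := Alphabet.exists_asyncTravel_of_asyncTravel M.alph L.alph K'
        refine ⟨K + K'', fun l hl n hn h => ?_⟩
        obtain ⟨m, hm, hv⟩ := M.isNormalForm (L.alph.val l)
        exact (hK l hl m hm hv.symm).trans (hK'' _ _ (hK' m hm n hn (hv.trans h))) }

end AsyncAutStruct

/-- The set `𝔄(G)` of asynchronous automatic structures on `G` up to equivalence. -/
def AsyncAut (G : Type u) [Group G] : Type (max 1 u) := Quotient (AsyncAutStruct.setoid G)

/-- The class `[L]`. -/
def AsyncAutStruct.cls {G : Type u} [Group G] (L : AsyncAutStruct G) : AsyncAut G :=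
  Quotient.mk _ L

/-- The set `B𝔄(G)` of asynchronously biautomatic structures up to equivalence. -/
def BiAsyncAut (G : Type u) [Group G] : Set (AsyncAut G) :=
  {c | ∃ L : AsyncAutStruct G, L.IsAsyncBiautomatic ∧ L.cls = c}

/-- The set `BS𝔄(G)` of biautomatic structures up to equivalence. -/
def BiSyncAut (G : Type u) [Group G] : Set (AsyncAut G) :=
  {c | ∃ L : AsyncAutStruct G, L.IsBiautomatic ∧ L.cls = c}

namespace AsyncAut

variable {G : Type u} [Group G]

/-- `S` is rational for the class `c`: the words with value in `S` form a regular sublanguage of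
any structure in the class. -/
def IsRational (c : AsyncAut G) (S : Set G) : Prop :=
  ∀ L : AsyncAutStruct G, L.cls = c →
    Language.IsRegular ({l | l ∈ L.lang ∧ L.alph.val l ∈ S} : Language L.alph.Letter)

/-- `d = g c`: the class `d` is the translate of the class `c` by `g`, that is, for
representatives `L` of `c` and `M` of `d`, the translate `g L` and `M` are equivalent. -/
def IsTranslate (g : G) (c d : AsyncAut G) : Prop :=
  ∃ L M : AsyncAutStruct G, L.cls = c ∧ M.cls = d ∧
    ∃ K : ℕ, ∀ l ∈ L.lang, ∀ m ∈ M.lang, g * L.alph.val l = M.alph.val m →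
      L.alph.AsyncTravel K (fun t => g * L.alph.path l t) (M.alph.path m)

/-- The class `c` of structures on `G` induces the class `d` of structures on `H`, where `H` is
seen as a subgroup of `G` by means of `i`: for representatives `L` of `c` and `M` of `d`, the
words of `L` with value in `H` are equivalent, in `G`, to the words of `M`. -/
def Induces {H : Type v} [Group H] (i : H →* G) (c : AsyncAut G) (d : AsyncAut H) : Prop :=
  ∃ (L : AsyncAutStruct G) (M : AsyncAutStruct H), L.cls = c ∧ M.cls = d ∧
    ∃ K : ℕ, ∀ l ∈ L.lang, ∀ m ∈ M.lang, L.alph.val l = i (M.alph.val m) →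
      L.alph.AsyncTravel K (L.alph.path l) (fun t => i (M.alph.path m t))

end AsyncAut

end Alphabets

section Graphs

/-- A graph of groups with vertices `V` and unoriented edges `D`. The unoriented edge `d` has two
ends `endpt d false` and `endpt d true`; its oriented edges are `(d, false)` and `(d, true)`. Both
have the edge group `F d`, and `emb d b` is the injection of `F d` at the end `b`. -/
structure GraphOfGroups (V : Type u) (D : Type v) where
  endpt : D → Bool → V
  G : V → Type w
  F : D → Type x
  groupG : ∀ V, Group (G V)
  groupF : ∀ d, Group (F d)
  emb : ∀ d b, F d →* G (endpt d b)
  emb_injective : ∀ d b, Function.Injective (emb d b)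

namespace GraphOfGroups

variable {V : Type u} {D : Type v} (𝒴 : GraphOfGroups.{u, v, w, x} V D)

instance (a : V) : Group (𝒴.G a) := 𝒴.groupG a

instance (d : D) : Group (𝒴.F d) := 𝒴.groupF d

/-- The initial vertex of the oriented edge `(d, b)` is the end `b` of `d`. -/
def src (E : D × Bool) : V := 𝒴.endpt E.1 E.2

/-- The terminal vertex of an oriented edge. -/
def tgt (E : D × Bool) : V := 𝒴.endpt E.1 (!E.2)

/-- The reversed oriented edge. -/
def rev (E : D × Bool) : D × Bool := (E.1, !E.2)

/-- The injection `∂₀` of the edge group at the initial vertex. -/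
def bdry₀ (E : D × Bool) : 𝒴.F E.1 →* 𝒴.G (𝒴.src E) := 𝒴.emb E.1 E.2

/-- The injection `∂₁` of the edge group at the terminal vertex. -/
def bdry₁ (E : D × Bool) : 𝒴.F E.1 →* 𝒴.G (𝒴.tgt E) := 𝒴.emb E.1 (!E.2)

/-- The list of oriented edges is an edge path from `a` to `b`. -/
def IsPath : V → V → List (D × Bool) → Prop
  | a, b, [] => a = b
  | a, b, E :: p => 𝒴.src E = a ∧ IsPath (𝒴.tgt E) b p

/-- `T` is a maximal tree of the underlying graph: any two vertices are joined by exactly one edge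
path in `T` without backtracking. (In particular the underlying graph is connected.) -/
def IsMaximalTree (T : Set D) : Prop :=
  ∀ a b : V, ∃! p : List (D × Bool), 𝒴.IsPath a b p ∧ (∀ E ∈ p, E.1 ∈ T) ∧
    p.IsChain (fun E E' => E' ≠ rev E)

/-- The free product of the vertex groups and of the free group on the oriented edges. -/
abbrev PrePi1 : Type (max u v w) :=
  Monoid.Coprod (Monoid.CoprodI 𝒴.G) (FreeGroup (D × Bool))

/-- The copy of a vertex group in `PrePi1`. -/
def preVert (a : V) : 𝒴.G a →* 𝒴.PrePi1 :=
  Monoid.Coprod.inl.comp Monoid.CoprodI.of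

/-- The letter of an oriented edge in `PrePi1`. -/
def preEdge (E : D × Bool) : 𝒴.PrePi1 := Monoid.Coprod.inr (FreeGroup.of E)

/-- The relators of the fundamental group with respect to the maximal tree `T`:
`t_E t_{E⁻¹}` for all `E`, `t_E` for `E` in `T`, and `∂₀(f) t_E ∂₁(f)⁻¹ t_E⁻¹` for `f ∈ F_E`. -/
def relators (T : Set D) : Set 𝒴.PrePi1 :=
  {r | (∃ E : D × Bool, r = 𝒴.preEdge E * 𝒴.preEdge (rev E)) ∨
    (∃ E : D × Bool, E.1 ∈ T ∧ r = 𝒴.preEdge E) ∨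
    ∃ (E : D × Bool) (f : 𝒴.F E.1), r = 𝒴.preVert _ (𝒴.bdry₀ E f) * 𝒴.preEdge E *
      (𝒴.preVert _ (𝒴.bdry₁ E f))⁻¹ * (𝒴.preEdge E)⁻¹}

/-- The fundamental group of the graph of groups. -/
abbrev Pi1 (T : Set D) : Type (max u v w) :=
  𝒴.PrePi1 ⧸ Subgroup.normalClosure (𝒴.relators T)

/-- The canonical homomorphism of a vertex group to the fundamental group. -/
def vert (T : Set D) (a : V) : 𝒴.G a →* 𝒴.Pi1 T :=
  (QuotientGroup.mk' _).comp (𝒴.preVert a)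

/-- The element `t_E` of the fundamental group. -/
def stable (T : Set D) (E : D × Bool) : 𝒴.Pi1 T := QuotientGroup.mk' _ (𝒴.preEdge E)

/-- A convenient alphabet for the fundamental group. Its letters are: letters that evaluate into
vertex groups, and one letter `t_E` for each oriented edge `E` not in `T`. For each vertex `a`, the
set `A_a` of all the letters that evaluate into the vertex group is an alphabet `vertAlph a` for
this group. Each element of the image of an edge group is represented by exactly one letter. -/
structure ConvenientAlphabet (T : Set D) extends Alphabet (𝒴.Pi1 T) where
  stableLetter : ∀ E : D × Bool, E.1 ∉ T → Letter
  ev_stableLetter : ∀ E h, ev (stableLetter E h) = 𝒴.stable T E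
  inv_stableLetter : ∀ E h, inv (stableLetter E h) = stableLetter (rev E) h
  vertAlph : ∀ a : V, Alphabet (𝒴.G a)
  incl : ∀ a : V, (vertAlph a).Letter → Letter
  incl_injective : ∀ a, Function.Injective (incl a)
  range_incl : ∀ a, Set.range (incl a) = {s : Letter | ev s ∈ (𝒴.vert T a).range}
  ev_incl : ∀ a s, ev (incl a s) = 𝒴.vert T a ((vertAlph a).ev s)
  inv_incl : ∀ a s, inv (incl a s) = incl a ((vertAlph a).inv s)
  letter_cases : ∀ s : Letter, (∃ a : V, s ∈ Set.range (incl a)) ∨ ∃ E h, s = stableLetter E h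
  edge_letter : ∀ (E : D × Bool) (f : 𝒴.F E.1),
    ∃! s : Letter, ev s = 𝒴.vert T (𝒴.tgt E) (𝒴.bdry₁ E f)
  one_letter : ∃! s : Letter, ev s = 1

open Classical in
/-- The word for `t_E`: a single letter if `E` is not in `T`, the empty word if `E` is in `T`. -/
noncomputable def ConvenientAlphabet.stableWord {𝒴 : GraphOfGroups.{u, v, w, x} V D} {T : Set D}
    (A : 𝒴.ConvenientAlphabet T) (E : D × Bool) : List A.Letter :=
  if h : E.1 ∈ T then [] else [A.stableLetter E h]

/-- A `𝒴`-graph with start vertex over `V₀`. The underlying directed graph and its map `π` to the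
underlying graph of `𝒴` are given by the fibres of `π`: `Vert a` is the set of vertices over the
vertex `a`, and `Edge E p` is the set of the edges over the oriented edge `E` that start at the
vertex `p`. -/
structure YGraph (V₀ : V) where
  Vert : V → Type
  Edge : ∀ E : D × Bool, Vert (𝒴.src E) → Type
  target : ∀ {E : D × Bool} {p : Vert (𝒴.src E)}, Edge E p → Vert (𝒴.tgt E)
  finite_vert : Finite (Σ a, Vert a)
  finite_edge : Finite (Σ E, Σ p, Edge E p)
  start : Vert V₀
  /-- Every vertex can be reached by a directed path from the start vertex. -/
  reachable : ∀ q : Σ a, Vert a, Relation.ReflTransGen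
    (fun q₁ q₂ : Σ a, Vert a => ∃ (E : D × Bool) (p : Vert (𝒴.src E)) (e : Edge E p),
      q₁ = ⟨𝒴.src E, p⟩ ∧ q₂ = ⟨𝒴.tgt E, target e⟩) ⟨V₀, start⟩ q
  /-- The labels of the vertices. -/
  label : ∀ {a : V}, Vert a → AsyncAut (𝒴.G a)
  /-- The labels of the edges. -/
  set : ∀ {E : D × Bool} {p : Vert (𝒴.src E)}, Edge E p → Set (𝒴.G (𝒴.src E))
  isRational : ∀ {E : D × Bool} {p : Vert (𝒴.src E)} (e : Edge E p),
    (label p).IsRational (set e)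
  disjoint : ∀ {E : D × Bool} {p : Vert (𝒴.src E)} (e e' : Edge E p), e ≠ e' →
    Disjoint (set e) (set e')
  union_eq_univ : ∀ (E : D × Bool) (p : Vert (𝒴.src E)),
    ((⟨𝒴.src E, p⟩ : Σ a, Vert a) = ⟨V₀, start⟩ ∨
      ∃ (E' : D × Bool) (q : Vert (𝒴.src E')) (e : Edge E' q),
        (⟨𝒴.tgt E', target e⟩ : Σ a, Vert a) = ⟨𝒴.src E, p⟩ ∧ E' ≠ rev E) →
    ⋃ e : Edge E p, set e = Set.univ
  union_eq_compl : ∀ (E : D × Bool) (p : Vert (𝒴.src E)),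
    ¬ ((⟨𝒴.src E, p⟩ : Σ a, Vert a) = ⟨V₀, start⟩ ∨
      ∃ (E' : D × Bool) (q : Vert (𝒴.src E')) (e : Edge E' q),
        (⟨𝒴.tgt E', target e⟩ : Σ a, Vert a) = ⟨𝒴.src E, p⟩ ∧ E' ≠ rev E) →
    ⋃ e : Edge E p, set e = ((𝒴.bdry₀ E).range : Set (𝒴.G (𝒴.src E)))ᶜ
  /-- For each oriented edge `E` and each vertex `p` over its initial vertex, the action of `F_E`
  on the vertices. -/
  actVert : ∀ (E : D × Bool) (_ : Vert (𝒴.src E)) (a : V), 𝒴.F E.1 →* Equiv.Perm (Vert a)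
  /-- The same action on the edges. -/
  actEdge : ∀ (E : D × Bool) (_ : Vert (𝒴.src E)) (E' : D × Bool),
    𝒴.F E.1 →* Equiv.Perm (Σ q : Vert (𝒴.src E'), Edge E' q)
  act_source : ∀ (E : D × Bool) (p : Vert (𝒴.src E)) (f : 𝒴.F E.1) (E' : D × Bool)
    (e : Σ q : Vert (𝒴.src E'), Edge E' q), (actEdge E p E' f e).1 = actVert E p _ f e.1
  act_target : ∀ (E : D × Bool) (p : Vert (𝒴.src E)) (f : 𝒴.F E.1) (E' : D × Bool)
    (e : Σ q : Vert (𝒴.src E'), Edge E' q),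
    target (actEdge E p E' f e).2 = actVert E p _ f (target e.2)
  act_fix : ∀ (E : D × Bool) (p : Vert (𝒴.src E)) (f : 𝒴.F E.1) (a : V) (q : Vert a),
    (¬ ∃ e : Edge E p, (⟨𝒴.tgt E, target e⟩ : Σ a, Vert a) = ⟨a, q⟩) → actVert E p a f q = q
  act_label : ∀ (E : D × Bool) (p : Vert (𝒴.src E)) (f : 𝒴.F E.1) (e : Edge E p),
    AsyncAut.IsTranslate (𝒴.bdry₁ E f) (label (target e)) (label (actVert E p _ f (target e)))
  /-- `S_{f e} = S_e f⁻¹` for the `E`-edges `e` out of `p`. -/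
  act_set : ∀ (E : D × Bool) (p : Vert (𝒴.src E)) (f : 𝒴.F E.1) (e : Edge E p),
    set (actEdge E p E f ⟨p, e⟩).2 = (fun g => g * (𝒴.bdry₀ E f)⁻¹) '' set e
  /-- `S_{f e'} = f S_{e'}` for the edges `e'` out of a vertex reached by an `E`-edge from `p`. -/
  act_set_next : ∀ (E : D × Bool) (p : Vert (𝒴.src E)) (f : 𝒴.F E.1) (e : Edge E p)
    (E' : D × Bool) (q : Vert (𝒴.src E')) (e' : Edge E' q) (h : 𝒴.tgt E = 𝒴.src E'),
    (⟨𝒴.tgt E, target e⟩ : Σ a, Vert a) = ⟨𝒴.src E', q⟩ →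
    set (actEdge E p E' f ⟨q, e'⟩).2 =
      (fun g => MulEquiv.cast (M := 𝒴.G) h (𝒴.bdry₁ E f) * g) '' set e'

namespace YGraph

variable {𝒴 : GraphOfGroups.{u, v, w, x} V D} {V₀ : V}

/-- The map `π` from the `𝒴`-graph to the underlying graph of `𝒴` is an isomorphism: it is
bijective on vertices and on oriented edges. -/
def IsIso (X : 𝒴.YGraph V₀) : Prop :=
  Function.Bijective (Sigma.fst : (Σ a, X.Vert a) → V) ∧
  Function.Bijective (Sigma.fst : (Σ E, Σ p, X.Edge E p) → D × Bool)

/-- A choice, for each vertex `p` over `a`, of an asynchronous automatic structure over the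
alphabet `A_a` in the class that labels `p`. -/
structure Choice (X : 𝒴.YGraph V₀) {T : Set D} (A : 𝒴.ConvenientAlphabet T) where
  lang : ∀ {a : V}, X.Vert a → Language (A.vertAlph a).Letter
  isRegular : ∀ {a : V} (p : X.Vert a), (lang p).IsRegular
  isNormalForm : ∀ {a : V} (p : X.Vert a), (A.vertAlph a).IsNormalForm (lang p)
  isFiniteToOne : ∀ {a : V} (p : X.Vert a), (A.vertAlph a).IsFiniteToOne (lang p)
  hasAsyncFTP : ∀ {a : V} (p : X.Vert a), (A.vertAlph a).HasAsyncFTP (lang p)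
  cls_eq : ∀ {a : V} (p : X.Vert a), (AsyncAutStruct.mk (A.vertAlph a) (lang p) (isRegular p)
    (isNormalForm p) (isFiniteToOne p) (hasAsyncFTP p)).cls = X.label p

/-- The words `u₀ t_{E₁} u₁ ⋯ t_{Eₘ} uₘ` that label paths starting at a given vertex `p`. The
argument of type `Option (D × Bool)` records the type of the edge by which `p` was reached: if the
next edge is of the reversed type, then `u₀` must not have its value in the edge group. -/
inductive IsPathWord (X : 𝒴.YGraph V₀) {T : Set D} {A : 𝒴.ConvenientAlphabet T}
    (C : X.Choice A) : Option (D × Bool) → ∀ {a : V}, X.Vert a → List A.Letter → Prop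
  | last (o : Option (D × Bool)) {a : V} (p : X.Vert a) (m : List (A.vertAlph a).Letter)
      (hm : m ∈ C.lang p) : IsPathWord X C o p (m.map (A.incl a))
  | step (o : Option (D × Bool)) {E : D × Bool} {p : X.Vert (𝒴.src E)} (e : X.Edge E p)
      (m : List (A.vertAlph (𝒴.src E)).Letter) (hm : m ∈ C.lang p)
      (hS : (A.vertAlph (𝒴.src E)).val m ∈ X.set e)
      (hred : o = some (rev E) → (A.vertAlph (𝒴.src E)).val m ∉ (𝒴.bdry₀ E).range)
      (l : List A.Letter) (hl : IsPathWord X C (some E) (X.target e) l) :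
      IsPathWord X C o p (m.map (A.incl _) ++ A.stableWord E ++ l)

/-- The language of a `𝒴`-graph: the words that label paths from the start vertex. -/
def pathLang (X : 𝒴.YGraph V₀) {T : Set D} {A : 𝒴.ConvenientAlphabet T} (C : X.Choice A) :
    Language A.Letter :=
  {l | X.IsPathWord C none X.start l}

/-- `X` is a `𝒴`-graph for the structure `L` on the fundamental group: `L` is equivalent to the
language determined by `X` and some choice of a convenient alphabet and of structures in the
classes that label the vertices. -/
def IsGraphFor (X : 𝒴.YGraph V₀) {T : Set D} (L : AsyncAutStruct (𝒴.Pi1 T)) : Prop :=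
  ∃ (A : 𝒴.ConvenientAlphabet T) (C : X.Choice A),
    Alphabet.LangEquiv L.alph L.lang A.toAlphabet (X.pathLang C)

end YGraph

end GraphOfGroups

end Graphs

/-! ### Closure properties of regular languages. -/

section RegularLanguages

/-! Both kinds of biautomaticity are expressed by one condition, `BiTr s`: for fixed `g` and `h`,
words `l`, `m` of the language with `g l h = m` in the group differ along the way only by elements
of a finite set. The flag `s` selects synchronous or asynchronous travel, so each construction is
carried out once for both. The geometry is that of the Bass-Serre tree, entering only through its
half-spaces (`Splitting`). As edge groups are finite, two given vertices are separated by finitely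
many edges of the tree, each with finite stabilizer; this is `Splitting.finite_crossing`, the
finiteness behind all bounds below.

Restriction (`exists_restriction`). A word with value in a vertex group that moves beyond an edge of
the tree must return through the same edge. The two crossing points differ by an element of a finite
set, and in a regular finite-to-one language the subword between them is then short
(`exists_bounded_return`). So such words stay near the vertex group and can be rewritten in it;
two-sided travel is inherited.

Combination (`exists_combination`). Given structures on the vertex groups, concatenate their words
along reduced paths in the graph of groups. Right multiplication leaves the path unchanged up to
edge group elements until the two paths diverge, after which only finitely many tails are possible.
Left multiplication by a generator affects only the start of the path. For synchronous travel,
errors must not add up over the common part of the paths. Therefore syllables are padded by letters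
of value 1 until their length depends only on the double coset with respect to the adjacent edge
groups (`exists_padded`).

Comparison (`Splitting.exists_syllableWord_travel`). If a two-sided structure `L` travels with words
of the vertex groups, it travels with all their concatenations along reduced paths: a word of `L` is
cut where it crosses the successive edges of the path. Hence `L` is equivalent to the language of
every `𝒴`-graph whose labels it induces, and the class of `L` is determined by the induced classes
(`GraphOfGroups.eq_of_induces`).

A `𝒴`-graph isomorphic to the underlying graph with prescribed two-sided labels exists
(`GraphOfGroups.isoGraph`), because two-sided classes are invariant under translation, so that all
edge groups may act trivially. The three constructions then give both equivalences and both
bijections. -/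

/-- `Run R s w t`: there is a path from `s` to `t` labelled by `w` in the labelled graph `R`. -/
def Run {α : Type u} {σ : Type v} (R : σ → α → σ → Prop) : σ → List α → σ → Prop
  | s, [], t => s = t
  | s, a :: w, t => ∃ s', R s a s' ∧ Run R s' w t

theorem run_append {α : Type u} {σ : Type v} {R : σ → α → σ → Prop} {l m : List α} {s t : σ} :
    Run R s (l ++ m) t ↔ ∃ r, Run R s l r ∧ Run R r m t := by
  induction l generalizing s with
  | nil => simp [Run]
  | cons a l ih =>
    simp only [List.cons_append, Run, ih]
    constructor
    · rintro ⟨s', h, r, h1, h2⟩; exact ⟨r, ⟨s', h, h1⟩, h2⟩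
    · rintro ⟨r, ⟨s', h, h1⟩, h2⟩; exact ⟨s', h, r, h1, h2⟩

theorem Language.IsRegular.of_iff {α : Type u} {L M : Language α} (h : M.IsRegular)
    (e : ∀ w, w ∈ L ↔ w ∈ M) : L.IsRegular := by
  rwa [show L = M from Set.ext e]

/-- The subset construction. The automata below guess data, such as a second word or the next edge,
and are therefore presented as nondeterministic labelled graphs. -/
theorem isRegular_setOf_run {α : Type u} {σ : Type v} [Finite σ] (R : σ → α → σ → Prop)
    (S A : Set σ) :
    Language.IsRegular ({w | ∃ s ∈ S, ∃ t ∈ A, Run R s w t} : Language α) := by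
  classical
  have := Fintype.ofFinite σ
  let M : NFA α σ := ⟨fun s a => {t | R s a t}, S, A⟩
  have key : ∀ (w : List α) (X : Set σ) (t : σ), t ∈ M.evalFrom X w ↔ ∃ s ∈ X, Run R s w t := by
    intro w
    induction w with
    | nil => intro X t; simp [Run]
    | cons a w ih =>
      intro X t
      rw [NFA.evalFrom_cons, ih]
      simp only [NFA.mem_stepSet, Run]
      constructor
      · rintro ⟨s, ⟨r, hr, h⟩, h'⟩; exact ⟨r, hr, s, h, h'⟩
      · rintro ⟨r, hr, s, h, h'⟩; exact ⟨s, ⟨r, hr, h⟩, h'⟩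
  refine Language.isRegular_iff.2 ⟨Set σ, inferInstance, M.toDFA, ?_⟩
  rw [NFA.toDFA_correct]
  ext w
  rw [NFA.mem_accepts]
  constructor
  · rintro ⟨t, ht, h⟩
    obtain ⟨s, hs, h⟩ := (key _ _ _).1 h
    exact ⟨s, hs, t, ht, h⟩
  · rintro ⟨s, hs, t, ht, h⟩
    exact ⟨t, ht, (key _ _ _).2 ⟨s, hs, h⟩⟩

theorem Language.IsRegular.exists_dfa {α : Type u} {L : Language α} (h : L.IsRegular) :
    ∃ (σ : Type) (_ : Finite σ) (M : DFA α σ), ∀ w, w ∈ L ↔ M.evalFrom M.start w ∈ M.accept := by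
  obtain ⟨σ, _, M, rfl⟩ := h
  exact ⟨σ, inferInstance, M, fun w => Iff.rfl⟩

/-- By Myhill-Nerode: a left quotient is a set of suffixes of words of the language, and there are
only finitely many such suffixes. -/
theorem Language.isRegular_of_finite {α : Type u} {L : Language α}
    (h : Set.Finite (L : Set (List α))) : L.IsRegular := by
  apply Language.IsRegular.of_finite_range_leftQuotient
  have h1 : Set.Finite {y : List α | ∃ x, x ++ y ∈ L} := by
    have : {y : List α | ∃ x, x ++ y ∈ L} ⊆ ⋃ l ∈ (L : Set (List α)), {y | y ∈ l.tails} := by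
      rintro y ⟨x, hx⟩
      simp only [Set.mem_iUnion, Set.mem_ofPred_eq, List.mem_tails]
      exact ⟨_, hx, List.suffix_append x y⟩
    exact (h.biUnion fun l _ => List.finite_toSet _).subset this
  refine h1.finite_subsets.subset ?_
  rintro _ ⟨x, rfl⟩ y hy
  exact ⟨x, hy⟩

theorem Language.IsRegular.diff {α : Type u} {L M : Language α} (hL : L.IsRegular)
    (hM : M.IsRegular) : Language.IsRegular ({w | w ∈ L ∧ w ∉ M} : Language α) :=
  hL.inf hM.compl

theorem Language.isRegular_iUnion {α : Type u} {ι : Type v} [Finite ι] {L : ι → Language α}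
    (h : ∀ i, (L i).IsRegular) : Language.IsRegular ({w | ∃ i, w ∈ L i} : Language α) := by
  classical
  have := Fintype.ofFinite ι
  have key : ∀ s : Finset ι, Language.IsRegular ({w | ∃ i ∈ s, w ∈ L i} : Language α) := by
    intro s
    induction s using Finset.induction_on with
    | empty =>
      apply Language.isRegular_of_finite
      convert Set.finite_empty (α := List α)
      ext w
      simp
    | insert i s _ ih =>
      refine ((h i).add ih).of_iff fun w => ?_
      change (∃ j ∈ insert i s, w ∈ L j) ↔ w ∈ L i ∨ ∃ j ∈ s, w ∈ L j
      simp only [Finset.mem_insert]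
      constructor
      · rintro ⟨j, rfl | hj, hw⟩
        · exact Or.inl hw
        · exact Or.inr ⟨j, hj, hw⟩
      · rintro (hw | ⟨j, hj, hw⟩)
        · exact ⟨i, Or.inl rfl, hw⟩
        · exact ⟨j, Or.inr hj, hw⟩
  refine (key Finset.univ).of_iff fun w => ?_
  constructor
  · rintro ⟨i, hi⟩; exact ⟨i, Finset.mem_univ i, hi⟩
  · rintro ⟨i, _, hi⟩; exact ⟨i, hi⟩

theorem Language.IsRegular.comap {α : Type u} {β : Type v} {L : Language β} (h : L.IsRegular)
    (f : α → β) : Language.IsRegular ({w | w.map f ∈ L} : Language α) := by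
  obtain ⟨σ, _, M, rfl⟩ := h
  refine Language.isRegular_iff.2 ⟨σ, inferInstance, M.comap f, ?_⟩
  rw [DFA.accepts_comap]
  rfl

theorem Language.IsRegular.image_map {α : Type u} {β : Type v} {L : Language α}
    (h : L.IsRegular) (f : α → β) :
    Language.IsRegular ({w | ∃ l ∈ L, l.map f = w} : Language β) := by
  obtain ⟨σ, _, M, hM⟩ := h.exists_dfa
  have key : ∀ (w : List β) (s t : σ), Run (fun s b t => ∃ a, f a = b ∧ M.step s a = t) s w t ↔
      ∃ l : List α, l.map f = w ∧ M.evalFrom s l = t := by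
    intro w
    induction w with
    | nil => intro s t; simp [Run]
    | cons b w ih =>
      intro s t
      simp only [Run, ih]
      constructor
      · rintro ⟨_, ⟨a, rfl, rfl⟩, l, rfl, h⟩
        exact ⟨a :: l, rfl, h⟩
      · rintro ⟨l, hl, h⟩
        rcases l with _ | ⟨a, l⟩
        · simp at hl
        · simp only [List.map_cons, List.cons.injEq] at hl
          exact ⟨_, ⟨a, hl.1, rfl⟩, l, hl.2, h⟩
  refine (isRegular_setOf_run (fun s b t => ∃ a, f a = b ∧ M.step s a = t) {M.start}
    M.accept).of_iff fun w => ?_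
  constructor
  · rintro ⟨l, hl, h⟩
    exact ⟨_, rfl, _, (hM l).1 hl, (key _ _ _).2 ⟨l, h, rfl⟩⟩
  · rintro ⟨_, rfl, t, ht, h⟩
    obtain ⟨l, hl, rfl⟩ := (key _ _ _).1 h
    exact ⟨l, (hM l).2 ht, hl⟩

theorem Language.IsRegular.concat {α : Type u} {L : Language α} (h : L.IsRegular) (a : α) :
    Language.IsRegular ({w | ∃ l ∈ L, l ++ [a] = w} : Language α) := by
  obtain ⟨σ, _, M, hM⟩ := h.exists_dfa
  -- The state `none` has no outgoing transition, so that it can only be reached by the last letter,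
  -- which must be `a`.
  let R : Option σ → α → Option σ → Prop := fun s b t =>
    (∃ q, s = some q ∧ t = some (M.step q b)) ∨ (∃ q ∈ M.accept, s = some q ∧ b = a ∧ t = none)
  have none_run : ∀ (w : List α) (t : Option σ), Run R none w t ↔ w = [] ∧ t = none := by
    intro w t
    cases w with
    | nil => simp [Run, eq_comm]
    | cons b w => simp [Run, R]
  have key : ∀ (w : List α) (q : σ), Run R (some q) w none ↔
      ∃ l : List α, l ++ [a] = w ∧ M.evalFrom q l ∈ M.accept := by
    intro w
    induction w with
    | nil => intro q; simp [Run]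
    | cons b w ih =>
      intro q
      constructor
      · rintro ⟨s, ⟨q', hq, rfl⟩ | ⟨q', hq', hq, rfl, rfl⟩, hr⟩
        · cases hq
          obtain ⟨l, rfl, hl⟩ := (ih _).1 hr
          exact ⟨b :: l, rfl, hl⟩
        · cases hq
          obtain ⟨rfl, -⟩ := (none_run _ _).1 hr
          exact ⟨[], rfl, hq'⟩
      · rintro ⟨l, hl, h⟩
        rcases l with _ | ⟨c, l⟩
        · simp only [List.nil_append, List.cons.injEq] at hl
          obtain ⟨rfl, rfl⟩ := hl
          exact ⟨none, Or.inr ⟨q, h, rfl, rfl, rfl⟩, rfl⟩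
        · simp only [List.cons_append, List.cons.injEq] at hl
          obtain ⟨rfl, rfl⟩ := hl
          exact ⟨_, Or.inl ⟨q, rfl, rfl⟩, (ih _).2 ⟨l, rfl, h⟩⟩
  refine (isRegular_setOf_run R {some M.start} {none}).of_iff fun w => ?_
  constructor
  · rintro ⟨l, hl, rfl⟩
    exact ⟨_, rfl, _, rfl, (key _ _).2 ⟨l, rfl, (hM l).1 hl⟩⟩
  · rintro ⟨_, rfl, _, rfl, h⟩
    obtain ⟨l, rfl, hl⟩ := (key _ _).1 h
    exact ⟨l, (hM l).2 hl, rfl⟩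

end RegularLanguages

/-! ### Fellow travelling of paths up to a finite set of differences. -/

section Travel

variable {G : Type u} [Group G]

/-- Asynchronous fellow travelling of the path `p` starting at `x` and the path `q` starting at
`y`, up to differences in `B`. -/
inductive ATrav (B : Set G) : G → List G → G → List G → Prop
  | nil {x y : G} (h : x⁻¹ * y ∈ B) : ATrav B x [] y []
  | left {x y a : G} {p q : List G} (h : x⁻¹ * y ∈ B) (H : ATrav B (x * a) p y q) :
      ATrav B x (a :: p) y q
  | right {x y b : G} {p q : List G} (h : x⁻¹ * y ∈ B) (H : ATrav B x p (y * b) q) :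
      ATrav B x p y (b :: q)
  | both {x y a b : G} {p q : List G} (h : x⁻¹ * y ∈ B) (H : ATrav B (x * a) p (y * b) q) :
      ATrav B x (a :: p) y (b :: q)

/-- Synchronous fellow travelling of the path `p` starting at `x` and the path `q` starting at
`y`, up to differences in `B`. -/
def STrav (B : Set G) (x : G) (p : List G) (y : G) (q : List G) : Prop :=
  ∀ t : ℕ, (x * (p.take t).prod)⁻¹ * (y * (q.take t).prod) ∈ B

/-- Synchronous (`s = true`) or asynchronous (`s = false`) fellow travelling. -/
def Tr (s : Bool) (B : Set G) (x : G) (p : List G) (y : G) (q : List G) : Prop :=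
  match s with
  | true => STrav B x p y q
  | false => ATrav B x p y q

/-- The products of at most `n` elements of `S`. -/
def prodBall (S : Set G) (n : ℕ) : Set G :=
  {g | ∃ l : List G, l.length ≤ n ∧ (∀ a ∈ l, a ∈ S) ∧ l.prod = g}

theorem finite_lists {α : Type u} {S : Set α} (hS : S.Finite) (n : ℕ) :
    {l : List α | l.length ≤ n ∧ ∀ a ∈ l, a ∈ S}.Finite := by
  have := hS.to_subtype
  have h := (List.finite_length_le S n).image (List.map ((↑) : S → α))
  refine h.subset ?_
  rintro l ⟨hl, hS⟩
  refine ⟨l.pmap (fun a h => ⟨a, h⟩) hS, by simpa using hl, ?_⟩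
  simp [List.map_pmap]

theorem prodBall_finite {S : Set G} (hS : S.Finite) (n : ℕ) : (prodBall S n).Finite := by
  refine ((finite_lists hS n).image List.prod).subset ?_
  rintro g ⟨l, h1, h2, rfl⟩
  exact ⟨l, ⟨h1, h2⟩, rfl⟩

theorem ATrav.mono {B B' : Set G} (hB : B ⊆ B') {x y : G} {p q : List G}
    (H : ATrav B x p y q) : ATrav B' x p y q := by
  induction H with
  | nil h => exact .nil (hB h)
  | left h _ ih => exact .left (hB h) ih
  | right h _ ih => exact .right (hB h) ih
  | both h _ ih => exact .both (hB h) ih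

theorem ATrav.translate {B : Set G} (g : G) {x y : G} {p q : List G}
    (H : ATrav B x p y q) : ATrav B (g * x) p (g * y) q := by
  have e : ∀ x y : G, (g * x)⁻¹ * (g * y) = x⁻¹ * y := fun x y => by group
  induction H with
  | nil h => exact .nil (by rwa [e])
  | left h _ ih => exact .left (by rwa [e]) (by rwa [mul_assoc])
  | right h _ ih => exact .right (by rwa [e]) (by rwa [mul_assoc])
  | both h _ ih => exact .both (by rwa [e]) (by rwa [mul_assoc, mul_assoc])

theorem ATrav.append {B : Set G} {x y : G} {p q p' q' : List G}
    (H : ATrav B x p y q) (H' : ATrav B (x * p.prod) p' (y * q.prod) q') :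
    ATrav B x (p ++ p') y (q ++ q') := by
  induction H with
  | nil h => simpa using H'
  | left h _ ih => exact .left h (ih (by simpa [mul_assoc] using H'))
  | right h _ ih => exact .right h (ih (by simpa [mul_assoc] using H'))
  | both h _ ih => exact .both h (ih (by simpa [mul_assoc] using H'))

theorem ATrav.exists_reparam {B : Set G} {x y : G} {p q : List G} (H : ATrav B x p y q) :
    ∃ φ ψ : ℕ → ℕ, Monotone φ ∧ Function.Surjective φ ∧ Monotone ψ ∧ Function.Surjective ψ ∧
      ∀ t, (x * (p.take (φ t)).prod)⁻¹ * (y * (q.take (ψ t)).prod) ∈ B := by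
  suffices h : ∃ φ ψ : ℕ → ℕ, Monotone φ ∧ Function.Surjective φ ∧ φ 0 = 0 ∧ Monotone ψ ∧
      Function.Surjective ψ ∧ ψ 0 = 0 ∧
      ∀ t, (x * (p.take (φ t)).prod)⁻¹ * (y * (q.take (ψ t)).prod) ∈ B by
    obtain ⟨φ, ψ, h1, h2, -, h3, h4, -, h5⟩ := h
    exact ⟨φ, ψ, h1, h2, h3, h4, h5⟩
  have up : ∀ φ : ℕ → ℕ, Monotone φ → Function.Surjective φ →
      ∃ φ' : ℕ → ℕ, Monotone φ' ∧ Function.Surjective φ' ∧ φ' 0 = 0 ∧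
        ∀ t, φ' (t + 1) = φ t + 1 := by
    intro φ hm hs
    refine ⟨fun t => Nat.casesOn t 0 fun t => φ t + 1, monotone_nat_of_le_succ ?_, ?_, rfl,
      fun t => rfl⟩
    · rintro (_ | t)
      · exact Nat.zero_le _
      · exact Nat.succ_le_succ (hm (Nat.le_succ t))
    · rintro (_ | n)
      · exact ⟨0, rfl⟩
      · obtain ⟨t, rfl⟩ := hs n
        exact ⟨t + 1, rfl⟩
  have stay : ∀ φ : ℕ → ℕ, Monotone φ → Function.Surjective φ → φ 0 = 0 →
      ∃ φ' : ℕ → ℕ, Monotone φ' ∧ Function.Surjective φ' ∧ φ' 0 = 0 ∧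
        ∀ t, φ' (t + 1) = φ t := by
    intro φ hm hs h0
    refine ⟨fun t => Nat.casesOn t 0 fun t => φ t, monotone_nat_of_le_succ ?_, ?_, rfl,
      fun t => rfl⟩
    · rintro (_ | t)
      · exact Nat.zero_le _
      · exact hm (Nat.le_succ t)
    · intro n
      obtain ⟨t, rfl⟩ := hs n
      exact ⟨t + 1, rfl⟩
  induction H with
  | nil h =>
    exact ⟨id, id, monotone_id, Function.surjective_id, rfl, monotone_id, Function.surjective_id,
      rfl, fun t => by simpa using h⟩
  | left h _ ih =>
    obtain ⟨φ, ψ, h1, h2, h3, h4, h5, h6, h7⟩ := ih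
    obtain ⟨φ', a1, a2, a3, a4⟩ := up φ h1 h2
    obtain ⟨ψ', b1, b2, b3, b4⟩ := stay ψ h4 h5 h6
    refine ⟨φ', ψ', a1, a2, a3, b1, b2, b3, ?_⟩
    rintro (_ | t)
    · simpa [a3, b3] using h
    · simpa [a4, b4, mul_assoc] using h7 t
  | right h _ ih =>
    obtain ⟨φ, ψ, h1, h2, h3, h4, h5, h6, h7⟩ := ih
    obtain ⟨φ', a1, a2, a3, a4⟩ := stay φ h1 h2 h3
    obtain ⟨ψ', b1, b2, b3, b4⟩ := up ψ h4 h5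
    refine ⟨φ', ψ', a1, a2, a3, b1, b2, b3, ?_⟩
    rintro (_ | t)
    · simpa [a3, b3] using h
    · simpa [a4, b4, mul_assoc] using h7 t
  | both h _ ih =>
    obtain ⟨φ, ψ, h1, h2, h3, h4, h5, h6, h7⟩ := ih
    obtain ⟨φ', a1, a2, a3, a4⟩ := up φ h1 h2
    obtain ⟨ψ', b1, b2, b3, b4⟩ := up ψ h4 h5
    refine ⟨φ', ψ', a1, a2, a3, b1, b2, b3, ?_⟩
    rintro (_ | t)
    · simpa [a3, b3] using h
    · simpa [a4, b4, mul_assoc] using h7 t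

theorem Monotone.succ_le_of_surjective {φ : ℕ → ℕ} (hm : Monotone φ)
    (hs : Function.Surjective φ) (t : ℕ) : φ (t + 1) ≤ φ t + 1 := by
  obtain ⟨k, hk⟩ := hs (φ t + 1)
  have h1 : t < k := by
    by_contra h
    have := hm (not_lt.mp h)
    omega
  have h2 := hm (Nat.succ_le_of_lt h1)
  simp only [Nat.succ_eq_add_one] at h2
  omega

theorem Monotone.zero_of_surjective {φ : ℕ → ℕ} (hm : Monotone φ)
    (hs : Function.Surjective φ) : φ 0 = 0 := by
  obtain ⟨i, hi⟩ := hs 0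
  have := hm (Nat.zero_le i)
  omega

/-- Each unit of time advances each index by zero or one letter. The four combinations are the three
recursive constructors and a pause. After one unit both time changes are shifted so as to start at 0
again. -/
theorem atrav_of_steps {B : Set G} (N : ℕ) : ∀ (x y : G) (p q : List G) (φ ψ : ℕ → ℕ),
    φ 0 = 0 → ψ 0 = 0 → (∀ t, φ t ≤ φ (t + 1) ∧ φ (t + 1) ≤ φ t + 1) →
    (∀ t, ψ t ≤ ψ (t + 1) ∧ ψ (t + 1) ≤ ψ t + 1) → p.length ≤ φ N → q.length ≤ ψ N →
    (∀ t, (x * (p.take (φ t)).prod)⁻¹ * (y * (q.take (ψ t)).prod) ∈ B) → ATrav B x p y q := by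
  induction N with
  | zero =>
    intro x y p q φ ψ h0 k0 _ _ hp hq h
    have hp' : p = [] := by simpa [h0] using hp
    have hq' : q = [] := by simpa [k0] using hq
    subst hp' hq'
    exact .nil (by simpa using h 0)
  | succ N ih =>
    intro x y p q φ ψ h0 k0 hφ hψ hp hq h
    have hst : x⁻¹ * y ∈ B := by simpa [h0, k0] using h 0
    have le : ∀ (χ : ℕ → ℕ), (∀ t, χ t ≤ χ (t + 1) ∧ χ (t + 1) ≤ χ t + 1) →
        ∀ t, χ 1 ≤ χ (t + 1) := by
      intro χ hχ t
      induction t with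
      | zero => exact le_rfl
      | succ t ih => exact ih.trans (hχ _).1
    have lφ := le φ hφ
    have lψ := le ψ hψ
    have sub : ∀ (χ : ℕ → ℕ), (∀ t, χ t ≤ χ (t + 1) ∧ χ (t + 1) ≤ χ t + 1) →
        (∀ t, χ 1 ≤ χ (t + 1)) → ∀ t, χ (t + 1) - χ 1 ≤ χ (t + 1 + 1) - χ 1 ∧
          χ (t + 1 + 1) - χ 1 ≤ χ (t + 1) - χ 1 + 1 := by
      intro χ h1 h2 t
      have := h1 (t + 1)
      have := h2 t
      omega
    have main : ∀ (x' y' : G) (p' q' : List G), p'.length ≤ φ (N + 1) - φ 1 →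
        q'.length ≤ ψ (N + 1) - ψ 1 →
        (∀ t, x' * (p'.take (φ (t + 1) - φ 1)).prod = x * (p.take (φ (t + 1))).prod) →
        (∀ t, y' * (q'.take (ψ (t + 1) - ψ 1)).prod = y * (q.take (ψ (t + 1))).prod) →
        ATrav B x' p' y' q' := fun x' y' p' q' e1 e2 e3 e4 =>
      ih x' y' p' q' (fun t => φ (t + 1) - φ 1) (fun t => ψ (t + 1) - ψ 1) (by simp) (by simp)
        (sub φ hφ lφ) (sub ψ hψ lψ) e1 e2 fun t => by rw [e3, e4]; exact h _
    have stepp : ∀ (χ : ℕ → ℕ), χ 0 = 0 → (∀ t, χ t ≤ χ (t + 1) ∧ χ (t + 1) ≤ χ t + 1) →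
        (∀ t, χ 1 ≤ χ (t + 1)) → ∀ (x : G) (p : List G), p.length ≤ χ (N + 1) →
        (p.length ≤ χ (N + 1) - χ 1 ∧
          ∀ t, x * (p.take (χ (t + 1) - χ 1)).prod = x * (p.take (χ (t + 1))).prod) ∨
        ∃ a p', p = a :: p' ∧ p'.length ≤ χ (N + 1) - χ 1 ∧
          ∀ t, x * a * (p'.take (χ (t + 1) - χ 1)).prod = x * (p.take (χ (t + 1))).prod := by
      intro χ c0 c1 c2 x p hp
      have := c1 0
      rcases p with _ | ⟨a, p⟩
      · left; simp
      · have h1 : χ 1 = 0 ∨ χ 1 = 1 := by simp at this; omega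
        rcases h1 with h1 | h1
        · left
          rw [h1]
          exact ⟨hp, fun t => rfl⟩
        · right
          refine ⟨a, p, rfl, ?_, fun t => ?_⟩
          · rw [h1]; simp at hp; omega
          · rw [h1]
            have h2 := c2 t
            obtain ⟨k, hk⟩ : ∃ k, χ (t + 1) = k + 1 := ⟨χ (t + 1) - 1, by omega⟩
            rw [hk]
            simp [mul_assoc]
    rcases stepp φ h0 hφ lφ x p hp with ⟨a1, a2⟩ | ⟨a, p', rfl, a1, a2⟩ <;>
    rcases stepp ψ k0 hψ lψ y q hq with ⟨b1, b2⟩ | ⟨b, q', rfl, b1, b2⟩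
    · exact main _ _ _ _ a1 b1 a2 b2
    · exact .right hst (main _ _ _ _ a1 b1 a2 b2)
    · exact .left hst (main _ _ _ _ a1 b1 a2 b2)
    · exact .both hst (main _ _ _ _ a1 b1 a2 b2)

/-- The inductive form makes concatenation immediate, the form with time changes makes symmetry and
transitivity immediate; both are needed. -/
theorem atrav_iff {B : Set G} {x y : G} {p q : List G} : ATrav B x p y q ↔
    ∃ φ ψ : ℕ → ℕ, Monotone φ ∧ Function.Surjective φ ∧ Monotone ψ ∧ Function.Surjective ψ ∧
      ∀ t, (x * (p.take (φ t)).prod)⁻¹ * (y * (q.take (ψ t)).prod) ∈ B := by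
  refine ⟨ATrav.exists_reparam, ?_⟩
  rintro ⟨φ, ψ, h1, h2, h3, h4, h⟩
  obtain ⟨i, hi⟩ := h2 p.length
  obtain ⟨j, hj⟩ := h4 q.length
  refine atrav_of_steps (max i j) x y p q φ ψ (h1.zero_of_surjective h2)
    (h3.zero_of_surjective h4) (fun t => ⟨h1 (Nat.le_succ t), h1.succ_le_of_surjective h2 t⟩)
    (fun t => ⟨h3 (Nat.le_succ t), h3.succ_le_of_surjective h4 t⟩) ?_ ?_ h
  · rw [← hi]; exact h1 (le_max_left i j)
  · rw [← hj]; exact h3 (le_max_right i j)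

theorem STrav.atrav {B : Set G} {x y : G} {p q : List G} (H : STrav B x p y q) :
    ATrav B x p y q :=
  atrav_iff.2 ⟨id, id, monotone_id, Function.surjective_id, monotone_id, Function.surjective_id, H⟩

open Pointwise

theorem ATrav.symm {B : Set G} {x y : G} {p q : List G} (H : ATrav B x p y q) :
    ATrav B⁻¹ y q x p := by
  obtain ⟨φ, ψ, h1, h2, h3, h4, h⟩ := atrav_iff.1 H
  exact atrav_iff.2 ⟨ψ, φ, h3, h4, h1, h2, fun t => by simpa using h t⟩

theorem ATrav.trans {B B' : Set G} {x y z : G} {p q r : List G} (H : ATrav B x p y q)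
    (H' : ATrav B' y q z r) : ATrav (B * B') x p z r := by
  obtain ⟨φ, ψ, h1, h2, h3, h4, h⟩ := atrav_iff.1 H
  obtain ⟨φ', ψ', h1', h2', h3', h4', h'⟩ := atrav_iff.1 H'
  obtain ⟨α, β, hα, sα, hβ, sβ, e⟩ := Alphabet.exists_common_reparam h3 h4 h1' h2'
  refine atrav_iff.2 ⟨φ ∘ α, ψ' ∘ β, h1.comp hα, h2.comp sα, h3'.comp hβ, h4'.comp sβ,
    fun t => ?_⟩
  have k1 := h (α t)
  have k2 := h' (β t)
  rw [e t] at k1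
  exact ⟨_, k1, _, k2, by simp only [Function.comp]; group⟩

namespace Tr

variable {s : Bool} {B B' : Set G} {x y z : G} {p q r : List G}

theorem mono (hB : B ⊆ B') (H : Tr s B x p y q) : Tr s B' x p y q := by
  cases s
  · exact ATrav.mono hB H
  · exact fun t => hB (H t)

theorem atrav (H : Tr s B x p y q) : ATrav B x p y q := by
  cases s
  · exact H
  · exact STrav.atrav H

theorem of_strav (H : STrav B x p y q) : Tr s B x p y q := by
  cases s
  · exact STrav.atrav H
  · exact H

theorem symm (H : Tr s B x p y q) : Tr s B⁻¹ y q x p := by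
  cases s
  · exact ATrav.symm H
  · exact fun t => by simpa using H t

theorem trans (H : Tr s B x p y q) (H' : Tr s B' y q z r) : Tr s (B * B') x p z r := by
  cases s
  · exact ATrav.trans H H'
  · exact fun t => ⟨_, H t, _, H' t, by group⟩

theorem translate (g : G) (H : Tr s B x p y q) : Tr s B (g * x) p (g * y) q := by
  cases s
  · exact ATrav.translate g H
  · intro t
    have := H t
    convert this using 1
    group

theorem refl (x : G) (p : List G) : Tr s {1} x p x p :=
  of_strav fun t => by simp

/-- In the synchronous case the second parts have to start simultaneously. With equal lengths `B`
does not grow, so this can be iterated over any number of syllables, unlike `exists_tr_append`. -/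
theorem append {p' q' : List G} (H : Tr s B x p y q)
    (H' : Tr s B (x * p.prod) p' (y * q.prod) q') (hl : s = true → p.length = q.length) :
    Tr s B x (p ++ p') y (q ++ q') := by
  cases s
  · exact ATrav.append H H'
  · intro t
    have hl := hl rfl
    rcases le_total t p.length with h | h
    · have := H t
      rwa [List.take_append_of_le_length h, List.take_append_of_le_length (hl ▸ h)]
    · have := H' (t - p.length)
      rw [List.take_append, List.take_append, List.take_of_length_le (l := p) h,
        List.take_of_length_le (l := q) (hl ▸ h), ← hl]
      simpa [mul_assoc] using this

theorem map {H : Type v} [Group H] (i : G →* H) (T : Tr s B x p y q) :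
    Tr s (i '' B) (i x) (p.map i) (i y) (q.map i) := by
  cases s
  · refine atrav_iff.2 ?_
    obtain ⟨φ, ψ, h1, h2, h3, h4, h⟩ := atrav_iff.1 T
    refine ⟨φ, ψ, h1, h2, h3, h4, fun t => ⟨_, h t, ?_⟩⟩
    simp [← List.map_take, map_list_prod]
  · refine fun t => ⟨_, T t, ?_⟩
    simp [← List.map_take, map_list_prod]

theorem of_map {H : Type v} [Group H] (i : G →* H) {C : Set H}
    (T : Tr s C (i x) (p.map i) (i y) (q.map i)) : Tr s (i ⁻¹' C) x p y q := by
  cases s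
  · refine atrav_iff.2 ?_
    obtain ⟨φ, ψ, h1, h2, h3, h4, h⟩ := atrav_iff.1 T
    refine ⟨φ, ψ, h1, h2, h3, h4, fun t => ?_⟩
    have := h t
    simpa [← List.map_take, ← map_list_prod] using this
  · intro t
    have := T t
    simpa [← List.map_take, ← map_list_prod] using this

end Tr

theorem strav_append_self_left (R : Set (List G)) {r : List G} (hr : r ∈ R) (x : G)
    (p : List G) : STrav {g | ∃ r ∈ R, ∃ l, l <+: r ∧ g = l.prod⁻¹} x (p ++ r) x p := by
  intro t
  refine ⟨r, hr, r.take (t - p.length), List.take_prefix _ _, ?_⟩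
  rw [List.take_append, List.prod_append]
  group

theorem finite_prefix_prods {R : Set (List G)} (hR : R.Finite) :
    {g : G | ∃ r ∈ R, ∃ l, l <+: r ∧ g = l.prod⁻¹}.Finite := by
  have : {g : G | ∃ r ∈ R, ∃ l, l <+: r ∧ g = l.prod⁻¹} ⊆
      ⋃ r ∈ R, (fun l => l.prod⁻¹) '' {l : List G | l ∈ r.inits} := by
    rintro g ⟨r, hr, l, hl, rfl⟩
    simp only [Set.mem_iUnion]
    exact ⟨r, hr, l, by simpa using hl, rfl⟩
  exact (hR.biUnion fun r _ => (List.finite_toSet _).image _).subset this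

theorem exists_tr_append_tails (s : Bool) {B : Set G} (hB : B.Finite) {R : Set (List G)}
    (hR : R.Finite) : ∃ B' : Set G, B'.Finite ∧ ∀ x p y q, Tr s B x p y q →
      ∀ r ∈ R, ∀ r' ∈ R, Tr s B' x (p ++ r) y (q ++ r') := by
  have hC := finite_prefix_prods hR
  refine ⟨_, (hC.mul hB).mul hC.inv, fun x p y q H r hr r' hr' => ?_⟩
  exact ((Tr.of_strav (strav_append_self_left R hr x p)).trans H).trans
    (Tr.of_strav (strav_append_self_left R hr' y q)).symm

theorem take_prod_inv_mul (l : List G) (a b : ℕ) :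
    (l.take a).prod⁻¹ * (l.take (a + b)).prod = ((l.drop a).take b).prod := by
  rw [List.take_add, List.prod_append]
  group

/-- Deleting the prefix `r` makes the path run ahead by `r.length` letters; the two points at one
time differ by the product of that many consecutive letters. -/
theorem exists_tr_prefix (s : Bool) {R : Set (List G)} (hR : R.Finite) {S : Set G}
    (hS : S.Finite) : ∃ B : Set G, B.Finite ∧ ∀ r ∈ R, ∀ (x : G) (p : List G),
      (∀ a ∈ p, a ∈ S) → Tr s B x (r ++ p) (x * r.prod) p := by
  obtain ⟨N, hN⟩ := (hR.image List.length).bddAbove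
  let S' : Set G := S ∪ ⋃ r ∈ R, {a | a ∈ r}
  have hS' : S'.Finite := hS.union (hR.biUnion fun r _ => List.finite_toSet r)
  refine ⟨prodBall S' N, prodBall_finite hS' N, fun r hr x p hp => Tr.of_strav fun t => ?_⟩
  refine ⟨((r ++ p).drop t).take r.length, ?_, ?_, ?_⟩
  · exact (List.length_take_le _ _).trans (hN ⟨r, hr, rfl⟩)
  · intro a ha
    have := List.mem_of_mem_drop (List.mem_of_mem_take ha)
    rcases List.mem_append.1 this with h | h
    · exact Or.inr (Set.mem_biUnion hr h)
    · exact Or.inl (hp a h)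
  · have e : (r ++ p).take (t + r.length) = r ++ p.take t := by
      rw [List.take_append, List.take_of_length_le (l := r) (by omega), Nat.add_sub_cancel]
    rw [← take_prod_inv_mul, e, List.prod_append]
    group

theorem strav_append_of_le {B B' S : Set G} {c : ℕ} {x y : G} {p q r r' : List G}
    (H : STrav B x p y q) (H' : STrav B' (x * p.prod) r (y * q.prod) r')
    (h1 : p.length ≤ q.length) (h2 : q.length ≤ p.length + c) (hq : ∀ a ∈ q, a ∈ S)
    (hr : ∀ a ∈ r', a ∈ S) :
    STrav (B ∪ B' * (prodBall S c)⁻¹) x (p ++ r) y (q ++ r') := by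
  intro t
  rcases le_total t p.length with h | h
  · left
    rw [List.take_append_of_le_length h, List.take_append_of_le_length (h.trans h1)]
    exact H t
  · right
    refine ⟨_, H' (t - p.length), (((q ++ r').drop t).take (q.length - p.length)).prod⁻¹, ?_, ?_⟩
    · refine Set.inv_mem_inv.2 ⟨_, (List.length_take_le _ _).trans (by omega), ?_, rfl⟩
      intro a ha
      rcases List.mem_append.1 (List.mem_of_mem_drop (List.mem_of_mem_take ha)) with h | h
      · exact hq a h
      · exact hr a h
    · rw [← take_prod_inv_mul, List.take_append (i := t + (q.length - p.length)),
        List.take_append (l₁ := p), List.take_of_length_le h,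
        List.take_of_length_le (show q.length ≤ t + (q.length - p.length) by omega),
        show t + (q.length - p.length) - q.length = t - p.length by omega]
      simp only [List.prod_append]
      group

/-- A difference of at most `c` in the lengths of the first parts shifts the second parts against
each other by at most `c` letters. The set of differences grows, so this may be applied only a
bounded number of times. -/
theorem exists_tr_append (s : Bool) {B B' S : Set G} (hB : B.Finite) (hB' : B'.Finite)
    (hS : S.Finite) (c : ℕ) : ∃ C : Set G, C.Finite ∧ ∀ (x y : G) (p q r r' : List G),
      Tr s B x p y q → Tr s B' (x * p.prod) r (y * q.prod) r' →
      (s = true → p.length ≤ q.length + c ∧ q.length ≤ p.length + c) →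
      (∀ a ∈ p ++ r, a ∈ S) → (∀ a ∈ q ++ r', a ∈ S) → Tr s C x (p ++ r) y (q ++ r') := by
  cases s
  · exact ⟨B ∪ B', hB.union hB', fun x y p q r r' H H' _ _ _ =>
      ATrav.append (ATrav.mono Set.subset_union_left H) (ATrav.mono Set.subset_union_right H')⟩
  · have hb := (prodBall_finite hS c).inv
    refine ⟨(B ∪ B' * (prodBall S c)⁻¹) ∪ (B⁻¹ ∪ B'⁻¹ * (prodBall S c)⁻¹)⁻¹,
      (hB.union (hB'.mul hb)).union (hB.inv.union (hB'.inv.mul hb)).inv, ?_⟩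
    intro x y p q r r' H H' hc hp hq
    obtain ⟨c1, c2⟩ := hc rfl
    rcases le_total p.length q.length with h | h
    · exact Tr.mono (s := true) Set.subset_union_left (strav_append_of_le H H' h c2
        (fun a ha => hq a (List.mem_append_left _ ha))
        (fun a ha => hq a (List.mem_append_right _ ha)))
    · refine Tr.mono (s := true) Set.subset_union_right (Tr.symm (s := true) ?_)
      exact strav_append_of_le (Tr.symm (s := true) H) (Tr.symm (s := true) H') h c1
        (fun a ha => hp a (List.mem_append_left _ ha))
        (fun a ha => hp a (List.mem_append_right _ ha))

end Travel

/-! ### Two-sided fellow travelling, and its relation to the given definitions. -/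

section Comparison

open Pointwise

/-- Acceptance of `x ++ y ++ z` depends on `x` only through the state it leads to, and on `z` only
through the state from which it is read. One word per state suffices on either side. -/
theorem Language.IsRegular.exists_completions {α : Type u} {L : Language α} (h : L.IsRegular) :
    ∃ R : Set (List α), R.Finite ∧ ∀ x y z, x ++ y ++ z ∈ L →
      ∃ x' ∈ R, ∃ z' ∈ R, x' ++ y ++ z' ∈ L := by
  classical
  obtain ⟨σ, _, M, hM⟩ := h.exists_dfa
  let X : σ → List α := fun q => if h : ∃ x, M.evalFrom M.start x = q then h.choose else []
  let Z : σ → List α := fun q => if h : ∃ z, M.evalFrom q z ∈ M.accept then h.choose else []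
  refine ⟨Set.range X ∪ Set.range Z, (Set.finite_range X).union (Set.finite_range Z), ?_⟩
  intro x y z hxyz
  rw [hM, DFA.evalFrom_of_append, DFA.evalFrom_of_append] at hxyz
  have h1 : ∃ x', M.evalFrom M.start x' = M.evalFrom M.start x := ⟨x, rfl⟩
  have h2 : ∃ z', M.evalFrom (M.evalFrom (M.evalFrom M.start x) y) z' ∈ M.accept := ⟨z, hxyz⟩
  refine ⟨X (M.evalFrom M.start x), Or.inl ⟨_, rfl⟩,
    Z (M.evalFrom (M.evalFrom M.start x) y), Or.inr ⟨_, rfl⟩, ?_⟩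
  · rw [hM, DFA.evalFrom_of_append, DFA.evalFrom_of_append]
    have e1 : M.evalFrom M.start (X (M.evalFrom M.start x)) = M.evalFrom M.start x := by
      simp only [X, dif_pos h1]
      exact h1.choose_spec
    rw [e1]
    simp only [Z, dif_pos h2]
    exact h2.choose_spec

theorem exists_finite_of_forall {G : Type u} {ι : Type v} {Q : Set ι} (hQ : Q.Finite)
    {P : ι → Set G → Prop} (mono : ∀ i B B', B ⊆ B' → P i B → P i B')
    (h : ∀ i ∈ Q, ∃ B : Set G, B.Finite ∧ P i B) : ∃ B : Set G, B.Finite ∧ ∀ i ∈ Q, P i B := by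
  choose! B h1 h2 using h
  exact ⟨⋃ i ∈ Q, B i, hQ.biUnion fun i hi => h1 i hi,
    fun i hi => mono i _ _ (Set.subset_biUnion_of_mem hi) (h2 i hi)⟩

theorem exists_finite_of_forall_finite {G : Type u} {ι : Type v} [Finite ι]
    {P : ι → Set G → Prop} (mono : ∀ i B B', B ⊆ B' → P i B → P i B')
    (h : ∀ i, ∃ B : Set G, B.Finite ∧ P i B) : ∃ B : Set G, B.Finite ∧ ∀ i, P i B := by
  obtain ⟨B, hB, h'⟩ := exists_finite_of_forall (Set.finite_univ (α := ι)) mono fun i _ => h i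
  exact ⟨B, hB, fun i => h' i trivial⟩

variable {G : Type u} [Group G]

/-- Every element is the value of finitely many words of the language. -/
def FinToOne {α : Type v} (ev : α → G) (L : Language α) : Prop :=
  ∀ g : G, {l : List α | l ∈ L ∧ (l.map ev).prod = g}.Finite

theorem FinToOne.finite {α : Type v} {ev : α → G} {L : Language α} (h : FinToOne ev L)
    {Q : Set G} (hQ : Q.Finite) : {l : List α | l ∈ L ∧ (l.map ev).prod ∈ Q}.Finite := by
  refine (hQ.biUnion fun g _ => h g).subset ?_
  rintro l ⟨h1, h2⟩
  exact Set.mem_biUnion h2 ⟨h1, rfl⟩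

/-- Completing `y` by a prefix and a suffix from a finite set gives a word of the language with
value in a finite set. By finiteness of the fibres there are finitely many such words. -/
theorem exists_bounded_return {α : Type v} {ev : α → G} {L : Language α} (hL : L.IsRegular)
    (hf : FinToOne ev L) {Q : Set G} (hQ : Q.Finite) :
    ∃ N : ℕ, ∀ x y z, x ++ y ++ z ∈ L → (y.map ev).prod ∈ Q → y.length ≤ N := by
  obtain ⟨R, hR, hc⟩ := hL.exists_completions
  let V : Set G := (fun l => (l.map ev).prod) '' R
  have hV : V.Finite := hR.image _
  have h1 := hf.finite ((hV.mul hQ).mul hV)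
  obtain ⟨N, hN⟩ := (h1.image List.length).bddAbove
  refine ⟨N, fun x y z hxyz hy => ?_⟩
  obtain ⟨x', hx', z', hz', h⟩ := hc x y z hxyz
  refine le_trans ?_ (hN ⟨x' ++ y ++ z', ⟨h, ?_⟩, rfl⟩)
  · simp only [List.length_append]
    omega
  · simp only [List.map_append, List.prod_append]
    exact ⟨_, ⟨_, ⟨x', hx', rfl⟩, _, hy, rfl⟩, _, ⟨z', hz', rfl⟩, rfl⟩

/-- For all `g` and `h`, a word `l` of the first language and a word `m` of the second with
`g l h = m` in the group fellow travel. -/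
def BiTr (s : Bool) {α : Type v} {β : Type w} (ev : α → G) (L : Language α) (ev' : β → G)
    (M : Language β) : Prop :=
  ∀ g h : G, ∃ B : Set G, B.Finite ∧ ∀ l ∈ L, ∀ m ∈ M,
    g * (l.map ev).prod * h = (m.map ev').prod → Tr s B g (l.map ev) 1 (m.map ev')

/-- Words of the two languages with the same value asynchronously fellow travel. -/
def EqTr {α : Type v} {β : Type w} (ev : α → G) (L : Language α) (ev' : β → G)
    (M : Language β) : Prop :=
  ∃ B : Set G, B.Finite ∧ ∀ l ∈ L, ∀ m ∈ M,
    (l.map ev).prod = (m.map ev').prod → ATrav B 1 (l.map ev) 1 (m.map ev')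

theorem BiTr.finite {s : Bool} {α : Type v} {β : Type w} {ev : α → G} {L : Language α}
    {ev' : β → G} {M : Language β} (H : BiTr s ev L ev' M) {Q Q' : Set G} (hQ : Q.Finite)
    (hQ' : Q'.Finite) : ∃ B : Set G, B.Finite ∧ ∀ g ∈ Q, ∀ h ∈ Q', ∀ l ∈ L, ∀ m ∈ M,
      g * (l.map ev).prod * h = (m.map ev').prod → Tr s B g (l.map ev) 1 (m.map ev') := by
  obtain ⟨B, hB, h⟩ := exists_finite_of_forall (hQ.prod hQ') (P := fun i B => ∀ l ∈ L, ∀ m ∈ M,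
    i.1 * (l.map ev).prod * i.2 = (m.map ev').prod → Tr s B i.1 (l.map ev) 1 (m.map ev'))
    (fun i B B' hBB h l hl m hm e => (h l hl m hm e).mono hBB) fun i _ => H i.1 i.2
  exact ⟨B, hB, fun g hg k hk => h (g, k) ⟨hg, hk⟩⟩

theorem EqTr.symm {α : Type v} {β : Type w} {ev : α → G} {L : Language α} {ev' : β → G}
    {M : Language β} (H : EqTr ev L ev' M) : EqTr ev' M ev L := by
  obtain ⟨B, hB, h⟩ := H
  exact ⟨B⁻¹, hB.inv, fun m hm l hl e => (h l hl m hm e.symm).symm⟩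

theorem EqTr.trans {α : Type v} {β : Type w} {γ : Type x} {ev : α → G} {L : Language α}
    {ev' : β → G} {M : Language β} {ev'' : γ → G} {N : Language γ} (H : EqTr ev L ev' M)
    (H' : EqTr ev' M ev'' N) (onto : ∀ g, ∃ m ∈ M, (m.map ev').prod = g) : EqTr ev L ev'' N := by
  obtain ⟨B, hB, h⟩ := H
  obtain ⟨B', hB', h'⟩ := H'
  refine ⟨B * B', hB.mul hB', fun l hl n hn e => ?_⟩
  obtain ⟨m, hm, hv⟩ := onto (l.map ev).prod
  exact (h l hl m hm hv.symm).trans (h' m hm n hn (hv.trans e))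

theorem BiTr.eqTr {s : Bool} {α : Type v} {β : Type w} {ev : α → G} {L : Language α}
    {ev' : β → G} {M : Language β} (H : BiTr s ev L ev' M) : EqTr ev L ev' M := by
  obtain ⟨B, hB, h⟩ := H 1 1
  exact ⟨B, hB, fun l hl m hm e => (h l hl m hm (by simpa using e)).atrav⟩

/-- Asynchronous biautomaticity is a property of the class. Equivalence is asynchronous, so this
argument gives nothing for synchronous travel; the biautomatic case has to speak of some
representative. -/
theorem BiTr.of_eqTr {α : Type v} {β : Type w} {ev : α → G} {L : Language α}
    {ev' : β → G} {M : Language β} (H : BiTr false ev L ev L) (E : EqTr ev L ev' M)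
    (onto : ∀ g, ∃ l ∈ L, (l.map ev).prod = g) : BiTr false ev' M ev' M := by
  intro g h
  obtain ⟨B, hB, hL⟩ := H g h
  obtain ⟨B', hB', hE⟩ := E
  refine ⟨B'⁻¹ * B * B', (hB'.inv.mul hB).mul hB', fun m hm m' hm' e => ?_⟩
  obtain ⟨l, hl, hv⟩ := onto (m.map ev').prod
  obtain ⟨l', hl', hv'⟩ := onto (m'.map ev').prod
  have h1 : ATrav _ (g * 1) _ (g * 1) _ := (hE l hl m hm hv).symm.translate g
  rw [mul_one] at h1
  exact (h1.trans (hL l hl l' hl' (by rw [hv, hv', e]))).trans (hE l' hl' m' hm' hv')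

/-- A subword of a word of `L` need not lie in `L`, but it does after completion on both sides by
words from a finite set. Their values are absorbed into `g` and `h`, and the completions are then
removed at bounded cost. -/
theorem exists_subword_travel {α : Type v} [Finite α] {ev : α → G} {L : Language α}
    (hL : L.IsRegular) {s : Bool} (H : BiTr s ev L ev L) {Q Q' : Set G} (hQ : Q.Finite)
    (hQ' : Q'.Finite) :
    ∃ B : Set G, B.Finite ∧ ∀ x y z, x ++ y ++ z ∈ L → ∀ m ∈ L, ∀ g ∈ Q, ∀ h ∈ Q',
      g * (m.map ev).prod * h = (y.map ev).prod → Tr s B g (m.map ev) 1 (y.map ev) := by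
  obtain ⟨R, hR, hc⟩ := hL.exists_completions
  let V : Set G := (fun l => (l.map ev).prod) '' R
  have hV : V.Finite := hR.image _
  let R' : Set (List G) := insert [] ((fun l => l.map ev) '' R)
  have hR' : R'.Finite := (hR.image _).insert _
  obtain ⟨B, hB, hT⟩ := H.finite (hV.mul hQ) (hQ'.mul hV)
  obtain ⟨B₁, hB₁, h₁⟩ := exists_tr_prefix s hR' (Set.finite_range ev)
  obtain ⟨B₂, hB₂, h₂⟩ := exists_tr_append_tails s (Set.finite_singleton (1 : G)) hR'
  refine ⟨B * B₁ * B₂, (hB.mul hB₁).mul hB₂, fun x y z hxyz m hm g hg k hk e => ?_⟩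
  obtain ⟨x', hx', z', hz', h⟩ := hc x y z hxyz
  have t1 := hT ((x'.map ev).prod * g) ⟨_, ⟨x', hx', rfl⟩, g, hg, rfl⟩ (k * (z'.map ev).prod)
    ⟨k, hk, _, ⟨z', hz', rfl⟩, rfl⟩ m hm _ h (by
      simp only [List.map_append, List.prod_append, ← e]
      group)
  have t2 := h₁ (x'.map ev) (Or.inr ⟨x', hx', rfl⟩) 1 ((y ++ z').map ev) (by
    intro a ha
    obtain ⟨b, -, rfl⟩ := List.mem_map.1 ha
    exact ⟨b, rfl⟩)
  have t3 := h₂ (x'.map ev).prod (y.map ev) _ _ (Tr.refl _ _) (z'.map ev)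
    (Or.inr ⟨z', hz', rfl⟩) [] (Or.inl rfl)
  rw [List.append_assoc, List.map_append] at t1
  rw [one_mul] at t2
  rw [← List.map_append, List.append_nil] at t3
  have t4 := ((t1.trans t2).trans t3).translate (x'.map ev).prod⁻¹
  simpa using t4

/-- At time `l.length` the first path has stopped, so the remaining part of `m` has its value in a
finite set, and `exists_bounded_return` bounds its length. -/
theorem exists_length_le {α : Type v} {β : Type w} {ev : α → G} {ev' : β → G} {M : Language β}
    (hM : M.IsRegular) (hf : FinToOne ev' M) {B Q : Set G} (hB : B.Finite) (hQ : Q.Finite) :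
    ∃ c : ℕ, ∀ (g h : G) (l : List α), ∀ m ∈ M, h ∈ Q → g * (l.map ev).prod * h = (m.map ev').prod →
      STrav B g (l.map ev) 1 (m.map ev') → m.length ≤ l.length + c := by
  obtain ⟨N, hN⟩ := exists_bounded_return hM hf (hB.inv.mul hQ)
  refine ⟨N, fun g h l m hm hh e T => ?_⟩
  have h1 := T l.length
  rw [List.take_of_length_le (by simp), one_mul, ← List.map_take] at h1
  have h2 := hN (m.take l.length) (m.drop l.length) [] (by simpa using hm) ⟨_, Set.inv_mem_inv.2 h1,
    h, hh, by
      have e2 : (m.map ev').prod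
          = ((m.take l.length).map ev').prod * ((m.drop l.length).map ev').prod := by
        rw [← List.prod_append, ← List.map_append, List.take_append_drop]
      rw [e2] at e
      have e3 : ((m.drop l.length).map ev').prod
          = ((m.take l.length).map ev').prod⁻¹ * (g * (l.map ev).prod * h) := by rw [e]; group
      rw [e3]
      group⟩
  rw [List.length_drop] at h2
  omega

namespace Alphabet

variable (A : Alphabet G)

instance : Finite A.Letter := A.finite_letter

theorem val_eq (l : List A.Letter) : A.val l = (l.map A.ev).prod := rfl

theorem path_eq (l : List A.Letter) (t : ℕ) : A.path l t = ((l.map A.ev).take t).prod := by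
  rw [← List.map_take]
  rfl

/-- The ball of radius `K` in the word metric. -/
def ball (K : ℕ) : Set G := {g | ∃ l : List A.Letter, l.length ≤ K ∧ A.val l = g}

theorem distLE_iff {K : ℕ} {g h : G} : A.DistLE K g h ↔ g⁻¹ * h ∈ A.ball K := by
  constructor
  · rintro ⟨l, hl, rfl⟩
    exact ⟨l, hl, by group⟩
  · rintro ⟨l, hl, e⟩
    exact ⟨l, hl, by rw [e]; group⟩

theorem ball_finite (K : ℕ) : (A.ball K).Finite := by
  refine ((List.finite_length_le A.Letter K).image A.val).subset ?_
  rintro g ⟨l, hl, rfl⟩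
  exact ⟨l, hl, rfl⟩

theorem exists_subset_ball {B : Set G} (hB : B.Finite) : ∃ K, B ⊆ A.ball K := by
  choose f hf using A.onto
  obtain ⟨K, hK⟩ := (hB.image fun g => (f g).length).bddAbove
  exact ⟨K, fun g hg => ⟨f g, hK ⟨g, hg, rfl⟩, hf g⟩⟩

theorem asyncTravel_iff {K : ℕ} {p q : ℕ → G} {x y : G} {l m : List G}
    (hp : ∀ t, p t = x * (l.take t).prod) (hq : ∀ t, q t = y * (m.take t).prod) :
    A.AsyncTravel K p q ↔ ATrav (A.ball K) x l y m := by
  rw [atrav_iff]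
  simp only [AsyncTravel, distLE_iff, hp, hq]

theorem syncTravel_iff {K : ℕ} {p q : ℕ → G} {x y : G} {l m : List G}
    (hp : ∀ t, p t = x * (l.take t).prod) (hq : ∀ t, q t = y * (m.take t).prod) :
    A.SyncTravel K p q ↔ STrav (A.ball K) x l y m := by
  simp only [SyncTravel, STrav, distLE_iff, hp, hq]

theorem langEquiv_iff {L : Language A.Letter} {C : Alphabet G} {M : Language C.Letter} :
    A.LangEquiv L C M ↔ EqTr A.ev L C.ev M := by
  have key : ∀ K l m, A.AsyncTravel K (A.path l) (C.path m) ↔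
      ATrav (A.ball K) 1 (l.map A.ev) 1 (m.map C.ev) := fun K l m =>
    A.asyncTravel_iff (fun t => by simp [path_eq]) (fun t => by simp [path_eq])
  constructor
  · rintro ⟨K, h⟩
    exact ⟨A.ball K, A.ball_finite K, fun l hl m hm e => (key _ _ _).1 (h l hl m hm e)⟩
  · rintro ⟨B, hB, h⟩
    obtain ⟨K, hK⟩ := A.exists_subset_ball hB
    exact ⟨K, fun l hl m hm e => (key _ _ _).2 ((h l hl m hm e).mono hK)⟩

/-- The fellow traveller property. -/
def RightTravel (s : Bool) (L : Language A.Letter) : Prop :=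
  ∃ B : Set G, B.Finite ∧ ∀ l ∈ L, ∀ m ∈ L, A.DistLE 1 (A.val l) (A.val m) →
    Tr s B 1 (l.map A.ev) 1 (m.map A.ev)

/-- The fellow traveller property for translates. -/
def LeftTravel (s : Bool) (L : Language A.Letter) : Prop :=
  ∃ B : Set G, B.Finite ∧ ∀ l ∈ L, ∀ m ∈ L, ∀ g ∈ insert (1 : G) (Set.range A.ev),
    A.val l = g * A.val m → Tr s B 1 (l.map A.ev) g (m.map A.ev)

theorem hasAsyncFTP_iff {L : Language A.Letter} : A.HasAsyncFTP L ↔ A.RightTravel false L := by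
  have key : ∀ K l m, A.AsyncTravel K (A.path l) (A.path m) ↔
      ATrav (A.ball K) 1 (l.map A.ev) 1 (m.map A.ev) := fun K l m =>
    A.asyncTravel_iff (fun t => by simp [path_eq]) (fun t => by simp [path_eq])
  constructor
  · rintro ⟨K, h⟩
    exact ⟨A.ball K, A.ball_finite K, fun l hl m hm e => (key _ _ _).1 (h l hl m hm e)⟩
  · rintro ⟨B, hB, h⟩
    obtain ⟨K, hK⟩ := A.exists_subset_ball hB
    exact ⟨K, fun l hl m hm e => (key _ _ _).2 (ATrav.mono hK (h l hl m hm e))⟩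

theorem hasSyncFTP_iff {L : Language A.Letter} : A.HasSyncFTP L ↔ A.RightTravel true L := by
  have key : ∀ K l m, A.SyncTravel K (A.path l) (A.path m) ↔
      STrav (A.ball K) 1 (l.map A.ev) 1 (m.map A.ev) := fun K l m =>
    A.syncTravel_iff (fun t => by simp [path_eq]) (fun t => by simp [path_eq])
  constructor
  · rintro ⟨K, h⟩
    exact ⟨A.ball K, A.ball_finite K, fun l hl m hm e => (key _ _ _).1 (h l hl m hm e)⟩
  · rintro ⟨B, hB, h⟩
    obtain ⟨K, hK⟩ := A.exists_subset_ball hB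
    exact ⟨K, fun l hl m hm e => (key _ _ _).2 (Tr.mono (s := true) hK (h l hl m hm e))⟩

/-- The pairs `(g, h)` for which travel holds are closed under composition, by inserting a word of
the language for the intermediate element. So it suffices to treat letters on either side. -/
theorem biTr_iff {s : Bool} {L : Language A.Letter} (onto : A.IsNormalForm L) :
    BiTr s A.ev L A.ev L ↔ A.RightTravel s L ∧ A.LeftTravel s L := by
  constructor
  · intro H
    constructor
    · obtain ⟨B, hB, h⟩ := H.finite (Set.finite_singleton (1 : G)) (A.ball_finite 1)
      refine ⟨B, hB, fun l hl m hm e => h 1 rfl _ ((A.distLE_iff).1 e) l hl m hm ?_⟩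
      rw [← val_eq, ← val_eq]
      group
    · obtain ⟨B, hB, h⟩ := H.finite ((Set.finite_range A.ev).insert 1)
        (Set.finite_singleton (1 : G))
      refine ⟨B⁻¹, hB.inv, fun l hl m hm g hg e => (h g hg 1 rfl m hm l hl ?_).symm⟩
      rw [← val_eq, ← val_eq, e, mul_one]
  · rintro ⟨⟨B, hB, hR⟩, B', hB', hL⟩
    let P : G → G → Prop := fun g h => ∃ B : Set G, B.Finite ∧ ∀ l ∈ L, ∀ m ∈ L,
      g * (l.map A.ev).prod * h = (m.map A.ev).prod → Tr s B g (l.map A.ev) 1 (m.map A.ev)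
    have comp : ∀ g h g' h', P g h → P g' h' → P (g' * g) (h * h') := by
      rintro g h g' h' ⟨C, hC, k⟩ ⟨C', hC', k'⟩
      refine ⟨C * C', hC.mul hC', fun l hl m hm e => ?_⟩
      obtain ⟨n, hn, hv⟩ := onto (g * (l.map A.ev).prod * h)
      rw [val_eq] at hv
      have t1 := (k l hl n hn hv.symm).translate g'
      have t2 := k' n hn m hm (by rw [hv, ← e]; group)
      rw [mul_one] at t1
      exact t1.trans t2
    have right : ∀ h : G, P 1 h := by
      intro h
      obtain ⟨w, rfl⟩ := A.onto h
      induction w with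
      | nil =>
        refine ⟨B, hB, fun l hl m hm e => hR l hl m hm ⟨[], by simp, ?_⟩⟩
        simpa [val] using e
      | cons a w ih =>
        have h1 : P 1 (A.ev a) := by
          refine ⟨B, hB, fun l hl m hm e => hR l hl m hm ⟨[a], by simp, ?_⟩⟩
          simpa [val] using e
        simpa using comp _ _ _ _ h1 ih
    have left : ∀ g : G, P g 1 := by
      intro g
      obtain ⟨w, rfl⟩ := A.onto g
      induction w with
      | nil => exact right 1
      | cons a w ih =>
        have h1 : P (A.ev a) 1 := by
          refine ⟨B'⁻¹, hB'.inv, fun l hl m hm e => (hL m hm l hl _ (Or.inr ⟨a, rfl⟩) ?_).symm⟩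
          simpa [val] using e.symm
        simpa using comp _ _ _ _ ih h1
    intro g h
    simpa using comp _ _ _ _ (right h) (left g)

end Alphabet

namespace AsyncAutStruct

theorem isAsyncBiautomatic_iff (L : AsyncAutStruct G) :
    L.IsAsyncBiautomatic ↔ BiTr false L.alph.ev L.lang L.alph.ev L.lang := by
  have key : ∀ K l m g, L.alph.AsyncTravel K (L.alph.path l) (fun t => g * L.alph.path m t) ↔
      ATrav (L.alph.ball K) 1 (l.map L.alph.ev) g (m.map L.alph.ev) := fun K l m g =>
    L.alph.asyncTravel_iff (fun t => by simp [Alphabet.path_eq])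
      (fun t => by simp [Alphabet.path_eq])
  rw [L.alph.biTr_iff L.isNormalForm, ← L.alph.hasAsyncFTP_iff]
  simp only [L.hasAsyncFTP, true_and]
  constructor
  · rintro ⟨K, h⟩
    exact ⟨L.alph.ball K, L.alph.ball_finite K, fun l hl m hm g hg e =>
      (key _ _ _ _).1 (h l hl m hm g hg e)⟩
  · rintro ⟨B, hB, h⟩
    obtain ⟨K, hK⟩ := L.alph.exists_subset_ball hB
    exact ⟨K, fun l hl m hm g hg e => (key _ _ _ _).2 (ATrav.mono hK (h l hl m hm g hg e))⟩

theorem isBiautomatic_iff (L : AsyncAutStruct G) :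
    L.IsBiautomatic ↔ BiTr true L.alph.ev L.lang L.alph.ev L.lang := by
  have key : ∀ K l m g, L.alph.SyncTravel K (L.alph.path l) (fun t => g * L.alph.path m t) ↔
      STrav (L.alph.ball K) 1 (l.map L.alph.ev) g (m.map L.alph.ev) := fun K l m g =>
    L.alph.syncTravel_iff (fun t => by simp [Alphabet.path_eq])
      (fun t => by simp [Alphabet.path_eq])
  rw [L.alph.biTr_iff L.isNormalForm, ← L.alph.hasSyncFTP_iff]
  refine and_congr_right fun _ => ?_
  constructor
  · rintro ⟨K, h⟩
    exact ⟨L.alph.ball K, L.alph.ball_finite K, fun l hl m hm g hg e =>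
      (key _ _ _ _).1 (h l hl m hm g hg e)⟩
  · rintro ⟨B, hB, h⟩
    obtain ⟨K, hK⟩ := L.alph.exists_subset_ball hB
    exact ⟨K, fun l hl m hm g hg e =>
      (key _ _ _ _).2 (Tr.mono (s := true) hK (h l hl m hm g hg e))⟩

/-- Two-sided fellow travelling of an asynchronous automatic structure. -/
def IsBi (s : Bool) (L : AsyncAutStruct G) : Prop := BiTr s L.alph.ev L.lang L.alph.ev L.lang

theorem IsBi.async {s : Bool} {L : AsyncAutStruct G} (h : L.IsBi s) : L.IsBi false := by
  intro g k
  obtain ⟨B, hB, h⟩ := h g k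
  exact ⟨B, hB, fun l hl m hm e => (h l hl m hm e).atrav⟩

theorem cls_eq_iff {L M : AsyncAutStruct G} :
    L.cls = M.cls ↔ EqTr L.alph.ev L.lang M.alph.ev M.lang := by
  rw [← Alphabet.langEquiv_iff]
  exact Quotient.eq (r := AsyncAutStruct.setoid G)

/-- The structure given by a regular, finite-to-one normal form with two-sided fellow
travelling. -/
def ofBiTr {s : Bool} (A : Alphabet G) (L : Language A.Letter) (hr : L.IsRegular)
    (hn : A.IsNormalForm L) (hf : A.IsFiniteToOne L) (hb : BiTr s A.ev L A.ev L) :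
    AsyncAutStruct G where
  alph := A
  lang := L
  isRegular := hr
  isNormalForm := hn
  isFiniteToOne := hf
  hasAsyncFTP := by
    obtain ⟨B, hB, h⟩ := ((A.biTr_iff hn).1 hb).1
    exact A.hasAsyncFTP_iff.2 ⟨B, hB, fun l hl m hm e => (h l hl m hm e).atrav⟩

end AsyncAutStruct

/-- The classes with a representative with two-sided fellow travelling. -/
def BiAut (s : Bool) (G : Type u) [Group G] : Set (AsyncAut G) :=
  {c | ∃ L : AsyncAutStruct G, L.IsBi s ∧ L.cls = c}

theorem biAsyncAut_eq : BiAsyncAut G = BiAut false G := by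
  simp only [BiAsyncAut, BiAut, AsyncAutStruct.IsBi, AsyncAutStruct.isAsyncBiautomatic_iff]

theorem biSyncAut_eq : BiSyncAut G = BiAut true G := by
  simp only [BiSyncAut, BiAut, AsyncAutStruct.IsBi, AsyncAutStruct.isBiautomatic_iff]

theorem BiAut.async {s : Bool} {c : AsyncAut G} (h : c ∈ BiAut s G) : c ∈ BiAut false G := by
  obtain ⟨L, hL, rfl⟩ := h
  exact ⟨L, hL.async, rfl⟩

theorem isBi_false_of_cls_mem {L : AsyncAutStruct G} (h : L.cls ∈ BiAut false G) :
    L.IsBi false := by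
  obtain ⟨M, hM, e⟩ := h
  exact BiTr.of_eqTr hM (AsyncAutStruct.cls_eq_iff.1 e) M.isNormalForm

/-- The definition of `Induces` asks for some representatives; composing with the equivalences of
representatives shows that any will do. -/
theorem AsyncAut.induces_iff {H : Type v} [Group H] {i : H →* G} {L : AsyncAutStruct G}
    {M : AsyncAutStruct H} :
    AsyncAut.Induces i L.cls M.cls ↔
      EqTr L.alph.ev L.lang (i ∘ M.alph.ev) M.lang := by
  have key : ∀ (L : AsyncAutStruct G) (M : AsyncAutStruct H),
      (∃ K : ℕ, ∀ l ∈ L.lang, ∀ m ∈ M.lang, L.alph.val l = i (M.alph.val m) →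
        L.alph.AsyncTravel K (L.alph.path l) (fun t => i (M.alph.path m t))) ↔
      EqTr L.alph.ev L.lang (i ∘ M.alph.ev) M.lang := by
    intro L M
    have k1 : ∀ K l m, L.alph.AsyncTravel K (L.alph.path l) (fun t => i (M.alph.path m t)) ↔
        ATrav (L.alph.ball K) 1 (l.map L.alph.ev) 1 (m.map (i ∘ M.alph.ev)) := fun K l m =>
      L.alph.asyncTravel_iff (fun t => by simp [Alphabet.path_eq])
        (fun t => by simp [Alphabet.path_eq, map_list_prod])
    have k2 : ∀ m, i (M.alph.val m) = (m.map (i ∘ M.alph.ev)).prod := fun m => by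
      simp [Alphabet.val_eq, map_list_prod]
    constructor
    · rintro ⟨K, h⟩
      refine ⟨L.alph.ball K, L.alph.ball_finite K, fun l hl m hm e =>
        (k1 _ _ _).1 (h l hl m hm ?_)⟩
      rw [k2]
      exact e
    · rintro ⟨B, hB, h⟩
      obtain ⟨K, hK⟩ := L.alph.exists_subset_ball hB
      refine ⟨K, fun l hl m hm e => (k1 _ _ _).2 (ATrav.mono hK (h l hl m hm ?_))⟩
      rw [← k2]
      exact e
  constructor
  · rintro ⟨L₁, M₁, e1, e2, h⟩
    have h := (key _ _).1 h
    have e1 := AsyncAutStruct.cls_eq_iff.1 e1.symm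
    obtain ⟨C, hC, e2⟩ := AsyncAutStruct.cls_eq_iff.1 e2.symm
    have e1 := e1.trans h L₁.isNormalForm
    obtain ⟨B, hB, hT⟩ := e1
    refine ⟨B * i '' C⁻¹, hB.mul (hC.inv.image i), fun l hl m hm e => ?_⟩
    obtain ⟨m', hm', hv⟩ := M₁.isNormalForm (M.alph.val m)
    have t1 := hT l hl m' hm' (by
      rw [e, ← List.map_map, ← List.map_map, ← map_list_prod, ← map_list_prod]
      exact congrArg i hv.symm)
    have t2 := Tr.map (s := false) i (ATrav.symm (e2 m hm m' hm' hv.symm))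
    rw [List.map_map, List.map_map, map_one] at t2
    exact ATrav.trans t1 t2
  · intro h
    exact ⟨L, M, rfl, rfl, (key _ _).2 h⟩

end Comparison

/-- A splitting of the group `Γ` as the fundamental group of a graph of groups with finite edge
groups. The half-space `H E b` consists of the elements `x` such that the translate by `x` of the
vertex `b` of the Bass-Serre tree lies beyond the edge `E`. -/
structure Splitting (Γ : Type u) [Group Γ] (V : Type v) (𝓔 : Type w) where
  src : 𝓔 → V
  tgt : 𝓔 → V
  rev : 𝓔 → 𝓔
  src_rev : ∀ E, src (rev E) = tgt E
  tgt_rev : ∀ E, tgt (rev E) = src E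
  rev_rev : ∀ E, rev (rev E) = E
  VG : V → Subgroup Γ
  EG : 𝓔 → Subgroup Γ
  EG_le : ∀ E, EG E ≤ VG (src E)
  EG_finite : ∀ E, (EG E : Set Γ).Finite
  t : 𝓔 → Γ
  t_rev : ∀ E, t (rev E) = (t E)⁻¹
  conj_mem : ∀ E, ∀ x ∈ EG E, (t E)⁻¹ * x * t E ∈ EG (rev E)
  H : 𝓔 → V → Set Γ
  -- In the tree: the half-spaces beyond `E` and beyond `g E'`, where both edges start at the same
  -- vertex, are disjoint unless `g E' = E`. Below, `t_mul_mem_H` says that `t E` carries `rev E` to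
  -- the reversal of `E`.
  H_disjoint : ∀ {E E' b g x}, src E' = src E → g ∈ VG (src E) → x ∈ H E b →
    g⁻¹ * x ∈ H E' b → E' = E ∧ g ∈ EG E
  mul_mem_H : ∀ {E b g x}, g ∈ EG E → x ∈ H E b → g * x ∈ H E b
  t_mul_mem_H : ∀ {E b x}, t E * x ∈ H E b ↔ x ∉ H (rev E) b
  notMem_H : ∀ {E a g}, src E = a → g ∈ VG a → g ∉ H E a
  /-- Any two vertices are joined by paths in the graph of groups with arbitrary value. -/
  connected : ∀ P : V → Γ → V → Prop, (∀ a, P a 1 a) →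
    (∀ a x b g, P a x b → g ∈ VG b → P a (x * g) b) →
    (∀ a x E, P a x (src E) → P a (x * t E) (tgt E)) → ∀ a x b, P a x b

/-! ### Reduced paths and half-spaces of the Bass-Serre tree. -/

namespace Splitting

open Pointwise

variable {Γ : Type u} [Group Γ] {V : Type v} {𝓔 : Type w} (S : Splitting Γ V 𝓔)

/-- Values of reduced paths in the graph of groups. -/
inductive Red : Option 𝓔 → V → V → Γ → Prop
  | last (o : Option 𝓔) {a : V} {g : Γ} (hg : g ∈ S.VG a) : Red o a a g
  | step (o : Option 𝓔) {a b : V} {E : 𝓔} {g x : Γ} (h : S.src E = a) (hg : g ∈ S.VG a)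
      (hred : o = some (S.rev E) → g ∉ S.EG E) (hx : Red (some E) (S.tgt E) b x) :
      Red o a b (g * S.t E * x)

variable {S}

/-- The normal form theorem in terms of half-spaces. A path with first step `g`, `E'` ends beyond `g
E'`. If it also ended beyond the reversed incoming edge, the two edges would coincide by
`H_disjoint`, which reducedness forbids. -/
theorem Red.notMem {o : Option 𝓔} {a b : V} {x : Γ} (h : S.Red o a b x) :
    ∀ E, o = some E → S.tgt E = a → x ∉ S.H (S.rev E) b := by
  induction h with
  | last o hg =>
    intro E _ ha
    exact S.notMem_H (by rw [S.src_rev, ha]) hg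
  | @step o a b E' g x h hg hred hx ih =>
    intro E hE ha hmem
    have h1 : S.t E' * x ∈ S.H E' b := S.t_mul_mem_H.2 (ih E' rfl rfl)
    obtain ⟨e, hg'⟩ := S.H_disjoint (E' := E') (g := g) (by rw [S.src_rev, h, ha])
      (by rwa [S.src_rev, ha]) hmem (by simpa [mul_assoc] using h1)
    refine hred ?_ (e ▸ hg')
    rw [hE, e, S.rev_rev]

theorem Red.mem_H {E : 𝓔} {b : V} {x : Γ} (h : S.Red (some E) (S.tgt E) b x) :
    S.t E * x ∈ S.H E b :=
  S.t_mul_mem_H.2 (h.notMem E rfl rfl)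

theorem Red.mul_right {o : Option 𝓔} {a b : V} {x k : Γ} (h : S.Red o a b x)
    (hk : k ∈ S.VG b) : S.Red o a b (x * k) := by
  induction h with
  | last o hg => exact .last _ (mul_mem hg hk)
  | step o h hg hred hx ih =>
    rw [mul_assoc]
    exact .step _ h hg hred (ih hk)

/-- Appending `E` either extends the path or cancels its last edge. The second alternative is a
cancellation against the incoming edge `o`; it is passed up to the preceding step of the path, where
it can be carried out. -/
theorem Red.mul_t {o : Option 𝓔} {a b : V} {x : Γ} (h : S.Red o a b x) :
    ∀ E, S.src E = b → S.Red o a (S.tgt E) (x * S.t E) ∨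
      (o = some (S.rev E) ∧ x ∈ S.EG E ∧ a = b) := by
  induction h with
  | @last o a g hg =>
    intro E hE
    by_cases hc : o = some (S.rev E) ∧ g ∈ S.EG E
    · exact Or.inr ⟨hc.1, hc.2, rfl⟩
    · left
      have := Red.step (S := S) o hE hg (fun h h' => hc ⟨h, h'⟩) (.last _ (one_mem _))
      simpa using this
  | @step o a b E' g x h hg hred hx ih =>
    intro E hE
    left
    rcases ih E hE with h1 | ⟨h1, h2, h3⟩
    · rw [mul_assoc]
      exact .step _ h hg hred h1
    · cases h1
      have h4 : S.t (S.rev E) * x * S.t E ∈ S.VG a := by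
        rw [← h, S.t_rev]
        exact S.EG_le _ (S.conj_mem E x h2)
      rw [mul_assoc, mul_assoc, ← mul_assoc (S.t _)]
      rw [S.src_rev] at h
      subst h
      exact .last _ (mul_mem hg h4)

theorem red_all (a : V) (x : Γ) (b : V) : S.Red none a b x := by
  refine S.connected (fun a x b => S.Red none a b x) (fun a => .last _ (one_mem _))
    (fun a x b g h hg => h.mul_right hg) (fun a x E h => ?_) a x b
  rcases h.mul_t E rfl with h | ⟨h, -⟩
  · exact h
  · simp at h

/-- If the translate by `x` of the edge `E'` crosses `E` backwards, it is the reversal of `E`. This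
determines `x` up to the finite edge groups on both sides of `t E`. -/
theorem finite_crossing_t (E E' : 𝓔) :
    {x : Γ | x ∈ S.H E (S.src E') ∧ x * S.t E' ∉ S.H E (S.tgt E')}.Finite := by
  refine (((S.EG_finite E).mul (Set.finite_singleton (S.t E))).mul
    (S.EG_finite (S.rev E))).subset ?_
  rintro x ⟨h1, h2⟩
  have hr := S.red_all (S.src E) x (S.src E')
  generalize ha : S.src E = a at hr
  generalize hb : S.src E' = b at hr h1
  cases hr with
  | last _ hg => exact absurd h1 (S.notMem_H ha hg)
  | @step _ _ _ E₁ g y h hg _ hy =>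
    subst ha
    obtain ⟨e, hgE⟩ := S.H_disjoint h hg h1 (by simpa [mul_assoc] using hy.mem_H)
    subst e
    rcases hy.mul_t E' hb with h3 | ⟨h3, h4, -⟩
    · refine absurd (S.mul_mem_H hgE h3.mem_H) ?_
      simpa [mul_assoc] using h2
    · cases h3
      rw [S.rev_rev]
      exact ⟨_, ⟨g, hgE, _, rfl, rfl⟩, y, h4, rfl⟩

variable (S) in
-- A path from `b` to the translate of `b'` by `s` has finitely many edges, and one of them must be
-- carried across `E` by `x`. Hence the induction along `connected`, in which only edge steps
-- contribute.
theorem finite_crossing (b : V) (s : Γ) (b' : V) (E : 𝓔) :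
    {x : Γ | x ∈ S.H E b ∧ x * s ∉ S.H E b'}.Finite ∧
    {x : Γ | x ∉ S.H E b ∧ x * s ∈ S.H E b'}.Finite := by
  have pre : ∀ (C : Set Γ) (s : Γ), C.Finite → {x | x * s ∈ C}.Finite := fun C s hC =>
    hC.preimage (mul_left_injective s).injOn
  refine S.connected (fun b s b' => ∀ E, {x : Γ | x ∈ S.H E b ∧ x * s ∉ S.H E b'}.Finite ∧
    {x : Γ | x ∉ S.H E b ∧ x * s ∈ S.H E b'}.Finite) ?_ ?_ ?_ b s b' E
  · intro a E
    constructor <;> refine Set.finite_empty.subset ?_ <;> rintro x ⟨h1, h2⟩ <;>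
      simp only [mul_one] at h2 <;> contradiction
  · intro a s b g ih hg E
    have key : ∀ x, x ∈ S.H E b ↔ x * g ∈ S.H E b := by
      have : ∀ x k, k ∈ S.VG b → x ∈ S.H E b → x * k ∈ S.H E b := by
        intro x k hk hx
        have hr := S.red_all (S.src E) x b
        generalize ha : S.src E = a at hr
        cases hr with
        | last _ hg => exact absurd hx (S.notMem_H ha hg)
        | @step _ _ _ E₁ g y h hg _ hy =>
          subst ha
          obtain ⟨e, hgE⟩ := S.H_disjoint h hg hx (by simpa [mul_assoc] using hy.mem_H)
          subst e
          have := S.mul_mem_H hgE (hy.mul_right hk).mem_H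
          simpa [mul_assoc] using this
      refine fun x => ⟨this x g hg, fun h => ?_⟩
      simpa using this _ _ (inv_mem hg) h
    simp only [← mul_assoc, ← key]
    exact ih E
  · intro a s E' ih E
    have h1 := finite_crossing_t (S := S) E E'
    have h2 := finite_crossing_t (S := S) E (S.rev E')
    rw [S.src_rev, S.tgt_rev, S.t_rev] at h2
    constructor
    · refine ((ih E).1.union (pre _ s h1)).subset ?_
      rintro x ⟨k1, k2⟩
      by_cases h : x * s ∈ S.H E (S.src E')
      · exact Or.inr ⟨h, by rwa [mul_assoc]⟩
      · exact Or.inl ⟨k1, h⟩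
    · refine ((ih E).2.union (pre _ (s * S.t E') h2)).subset ?_
      rintro x ⟨k1, k2⟩
      by_cases h : x * s ∈ S.H E (S.src E')
      · exact Or.inl ⟨k1, h⟩
      · exact Or.inr ⟨k2, by simpa [mul_assoc] using h⟩

end Splitting

universe y

/-! ### Equivariant bijections between free sets for the edge groups. -/

section EquivariantEquiv

theorem exists_coset_reps {F : Type u} {G : Type v} [Group F] [Group G] (i : F →* G)
    (hi : Function.Injective i) : ∃ (r : G → G) (c : G → F), (∀ g, i (c g) * r g = g) ∧
      (∀ f g, r (i f * g) = r g) ∧ ∀ f g, c (i f * g) = f * c g := by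
  let r : G → G := fun g => ((QuotientGroup.mk g⁻¹ : G ⧸ i.range).out)⁻¹
  have h1 : ∀ g, ∃ f, i f * r g = g := by
    intro g
    have h := QuotientGroup.mk_out_eq_mul i.range g⁻¹
    obtain ⟨⟨_, f, rfl⟩, h⟩ := h
    refine ⟨f, ?_⟩
    simp only [r]
    rw [h]
    group
  have h2 : ∀ f g, r (i f * g) = r g := by
    intro f g
    simp only [r]
    congr 2
    rw [QuotientGroup.eq]
    exact ⟨f, by group⟩
  choose c hc using h1
  refine ⟨r, c, hc, h2, fun f g => hi ?_⟩
  have h3 := hc (i f * g)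
  rw [h2] at h3
  have h4 : i (c (i f * g)) = i f * g * (r g)⁻¹ := eq_mul_inv_of_mul_eq h3
  have h5 : i (c g) = g * (r g)⁻¹ := eq_mul_inv_of_mul_eq (hc g)
  rw [h4, map_mul, h5, mul_assoc]

/-- A subset `X` of a product `G × S` on which the subgroup `F` of `G` acts by left
multiplication is in equivariant bijection with `F × Q` for a set `Q` of the cardinality of `Z`. -/
theorem exists_equivariant_model {F : Type u} {G : Type v} {S : Type w} {Z : Type y} [Group F]
    [Group G] (i : F →* G) (hi : Function.Injective i) (X : Set (G × S))
    (hX : ∀ f z, z ∈ X → (i f * z.1, z.2) ∈ X) (e : G × S ↪ Z) (k : Z → S)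
    (hk : Function.Injective k) (hkX : ∀ z, (1, k z) ∈ X) :
    ∃ Φ : X ≃ F × Z, ∀ f (z : X), Φ ⟨(i f * z.1.1, z.1.2), hX f z.1 z.2⟩ =
      (f * (Φ z).1, (Φ z).2) := by
  obtain ⟨r, c, h1, h2, h3⟩ := exists_coset_reps i hi
  -- A set of representatives of the orbits of `F` on `X`; the action is free, hence `X` is `F × Q`.
  let Q : Type _ := {z : G × S // z ∈ X ∧ r z.1 = z.1}
  have hr : ∀ g, r (r g) = r g := fun g => by
    conv_rhs => rw [← h1 g]
    rw [h2]
  have hrX : ∀ z ∈ X, (r z.1, z.2) ∈ X := by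
    intro z hz
    have := hX (c z.1)⁻¹ z hz
    rw [map_inv] at this
    rwa [show (i (c z.1))⁻¹ * z.1 = r z.1 by rw [inv_mul_eq_iff_eq_mul, h1]] at this
  let Ψ : X ≃ F × Q :=
    { toFun := fun z => (c z.1.1, ⟨(r z.1.1, z.1.2), hrX _ z.2, hr _⟩)
      invFun := fun q => ⟨(i q.1 * q.2.1.1, q.2.1.2), hX _ _ q.2.2.1⟩
      left_inv := fun z => by simp [h1]
      right_inv := by
        rintro ⟨f, ⟨g, s⟩, hz, hg⟩
        have hc : c g = 1 := by
          have := h1 g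
          simp only at hg
          rw [hg] at this
          exact hi (by rw [map_one]; exact mul_eq_right.1 this)
        simp only at hg
        simp [h2, h3, hg, hc] }
  have e1 : Q ↪ Z := (Function.Embedding.subtype _).trans e
  have e2 : Z ↪ Q := ⟨fun z => ⟨(r 1, k z), hrX _ (hkX z), hr _⟩, fun z z' h =>
    hk (congrArg (fun q : Q => q.1.2) h)⟩
  -- Schröder-Bernstein: `Q` embeds in `Z` by `e`, and `Z` embeds in `Q` by `k`.
  obtain ⟨E⟩ := e1.antisymm e2
  refine ⟨Ψ.trans (Equiv.prodCongr (Equiv.refl F) E), fun f z => ?_⟩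
  simp [Ψ, h2, h3]

theorem equivariant_symm {F : Type u} {G : Type v} {S : Type w} {Z : Type y} [Group F]
    [Group G] {i : F →* G} {X : Set (G × S)} {hX : ∀ f z, z ∈ X → (i f * z.1, z.2) ∈ X}
    (Φ : X ≃ F × Z)
    (hΦ : ∀ f (z : X), Φ ⟨(i f * z.1.1, z.1.2), hX f z.1 z.2⟩ = (f * (Φ z).1, (Φ z).2)) (f : F)
    (q : F × Z) : (Φ.symm (f * q.1, q.2)).1 = (i f * (Φ.symm q).1.1, (Φ.symm q).1.2) := by
  have h := hΦ f (Φ.symm q)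
  rw [Φ.apply_symm_apply] at h
  rw [← h, Φ.symm_apply_apply]

/-- Equivariant bijection of `G₁ × S` to `G₂ × S` that exchanges `X₁` and `X₂` with the complements
of each other. -/
theorem exists_equivariant_swap {F : Type u} {G₁ G₂ : Type v} {S : Type w} {Z : Type y} [Group F]
    [Group G₁] [Group G₂] (i₁ : F →* G₁) (hi₁ : Function.Injective i₁) (i₂ : F →* G₂)
    (hi₂ : Function.Injective i₂) (X₁ : Set (G₁ × S)) (X₂ : Set (G₂ × S))
    (hX₁ : ∀ f z, (i₁ f * z.1, z.2) ∈ X₁ ↔ z ∈ X₁)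
    (hX₂ : ∀ f z, (i₂ f * z.1, z.2) ∈ X₂ ↔ z ∈ X₂) (e₁ : G₁ × S ↪ Z) (e₂ : G₂ × S ↪ Z)
    (k k₁ k₂ : Z → S) (hk : Function.Injective k) (hk₁ : Function.Injective k₁)
    (hk₂ : Function.Injective k₂) (h₁ : ∀ z, (1, k₁ z) ∈ X₁) (h₂ : ∀ z, (1, k₂ z) ∈ X₂)
    (h₁' : ∀ z, (1, k z) ∉ X₁) (h₂' : ∀ z, (1, k z) ∉ X₂) :
    ∃ σ : G₁ × S ≃ G₂ × S, (∀ z, σ z ∈ X₂ ↔ z ∉ X₁) ∧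
      ∀ f z, σ (i₁ f * z.1, z.2) = (i₂ f * (σ z).1, (σ z).2) := by
  classical
  obtain ⟨Φ₁, a₁⟩ := exists_equivariant_model i₁ hi₁ X₁ (fun f z h => (hX₁ f z).2 h) e₁ k₁ hk₁ h₁
  obtain ⟨Φ₂, a₂⟩ := exists_equivariant_model i₂ hi₂ X₂ (fun f z h => (hX₂ f z).2 h) e₂ k₂ hk₂ h₂
  obtain ⟨Ψ₁, b₁⟩ := exists_equivariant_model i₁ hi₁ X₁ᶜ
    (fun f z h h' => h ((hX₁ f z).1 h')) e₁ k hk h₁'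
  obtain ⟨Ψ₂, b₂⟩ := exists_equivariant_model i₂ hi₂ X₂ᶜ
    (fun f z h h' => h ((hX₂ f z).1 h')) e₂ k hk h₂'
  -- All four pieces are equivariantly `F × Z`, so `X₁` can be sent to the complement of `X₂` and
  -- the complement of `X₁` to `X₂`.
  let σ : G₁ × S ≃ G₂ × S := (Equiv.Set.sumCompl X₁).symm.trans ((Equiv.sumComm _ _).trans
    ((Equiv.sumCongr (Ψ₁.trans Φ₂.symm) (Φ₁.trans Ψ₂.symm)).trans (Equiv.Set.sumCompl X₂)))
  have s1 : ∀ z (h : z ∈ X₁), σ z = Ψ₂.symm (Φ₁ ⟨z, h⟩) := by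
    intro z h
    simp [σ, Equiv.Set.sumCompl_symm_apply_of_mem h]
  have s2 : ∀ z (h : z ∉ X₁), σ z = Φ₂.symm (Ψ₁ ⟨z, h⟩) := by
    intro z h
    simp [σ, Equiv.Set.sumCompl_symm_apply_of_notMem h]
  refine ⟨σ, fun z => ?_, fun f z => ?_⟩
  · by_cases h : z ∈ X₁
    · rw [s1 z h]
      have := (Ψ₂.symm (Φ₁ ⟨z, h⟩)).2
      exact ⟨fun h' => absurd h' this, fun h' => absurd h h'⟩
    · rw [s2 z h]
      simp [h]
  · by_cases h : z ∈ X₁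
    · rw [s1 z h, s1 _ ((hX₁ f z).2 h), a₁ f ⟨z, h⟩]
      exact equivariant_symm (i := i₂) (X := X₂ᶜ)
        (hX := fun f z h h' => h ((hX₂ f z).1 h')) Ψ₂ b₂ f _
    · rw [s2 z h, s2 _ (fun h' => h ((hX₁ f z).1 h')), b₁ f ⟨z, h⟩]
      exact equivariant_symm (i := i₂) (X := X₂) (hX := fun f z h => (hX₂ f z).2 h) Φ₂ a₂ f _

end EquivariantEquiv

/-! ### The fundamental group, and a ping-pong action that yields its half-spaces. -/

namespace GraphOfGroups

variable {V : Type u} {D : Type v} (𝒴 : GraphOfGroups.{u, v, w, x} V D) (T : Set D)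

theorem stable_mul_stable_rev (E : D × Bool) : 𝒴.stable T E * 𝒴.stable T (rev E) = 1 := by
  rw [stable, stable, ← map_mul]
  exact (QuotientGroup.eq_one_iff _).2 (Subgroup.subset_normalClosure (Or.inl ⟨E, rfl⟩))

theorem stable_eq_one {E : D × Bool} (h : E.1 ∈ T) : 𝒴.stable T E = 1 :=
  (QuotientGroup.eq_one_iff _).2 (Subgroup.subset_normalClosure (Or.inr (Or.inl ⟨E, h, rfl⟩)))

theorem vert_mul_stable (E : D × Bool) (f : 𝒴.F E.1) :
    𝒴.vert T _ (𝒴.bdry₀ E f) * 𝒴.stable T E = 𝒴.stable T E * 𝒴.vert T _ (𝒴.bdry₁ E f) := by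
  have h : (QuotientGroup.mk' (Subgroup.normalClosure (𝒴.relators T)))
      (𝒴.preVert _ (𝒴.bdry₀ E f) * 𝒴.preEdge E * (𝒴.preVert _ (𝒴.bdry₁ E f))⁻¹ *
        (𝒴.preEdge E)⁻¹) = 1 :=
    (QuotientGroup.eq_one_iff _).2 (Subgroup.subset_normalClosure (Or.inr (Or.inr ⟨E, f, rfl⟩)))
  rw [map_mul, map_mul, map_mul, map_inv, map_inv, mul_inv_eq_one, mul_inv_eq_iff_eq_mul] at h
  exact h

theorem pi1_induction {P : 𝒴.Pi1 T → Prop} (one : P 1) (mul : ∀ x y, P x → P y → P (x * y))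
    (vert : ∀ a g, P (𝒴.vert T a g)) (stable : ∀ E, P (𝒴.stable T E)) (x : 𝒴.Pi1 T) : P x := by
  obtain ⟨y, rfl⟩ := QuotientGroup.mk'_surjective _ x
  induction y using Monoid.Coprod.induction_on with
  | inl m =>
    induction m using Monoid.CoprodI.induction_on with
    | one => rw [map_one, map_one]; exact one
    | of a g => exact vert a g
    | mul x y hx hy => rw [map_mul, map_mul]; exact mul _ _ hx hy
  | inr n =>
    induction n using FreeGroup.induction_on with
    | C1 => rw [map_one, map_one]; exact one
    | of E => exact stable E
    | inv_of E _ =>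
      have h : (𝒴.stable T E)⁻¹ = 𝒴.stable T (rev E) :=
        inv_eq_of_mul_eq_one_right (𝒴.stable_mul_stable_rev T E)
      rw [map_inv, map_inv]
      change P (𝒴.stable T E)⁻¹
      rw [h]
      exact stable _
    | mul x y hx hy => rw [map_mul, map_mul]; exact mul _ _ hx hy
  | mul x y hx hy => rw [map_mul]; exact mul _ _ hx hy

/-- A homomorphism from the fundamental group, given by its values on the generators. -/
def pi1Lift {K : Type*} [Group K] (φ : ∀ a, 𝒴.G a →* K) (τ : D × Bool → K)
    (h1 : ∀ E, τ E * τ (rev E) = 1) (h2 : ∀ E, E.1 ∈ T → τ E = 1)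
    (h3 : ∀ (E : D × Bool) (f : 𝒴.F E.1), φ _ (𝒴.bdry₀ E f) * τ E = τ E * φ _ (𝒴.bdry₁ E f)) :
    𝒴.Pi1 T →* K :=
  QuotientGroup.lift _ (Monoid.Coprod.lift (Monoid.CoprodI.lift φ) (FreeGroup.lift τ)) (by
    refine Subgroup.normalClosure_le_normal ?_
    rintro r (⟨E, rfl⟩ | ⟨E, hE, rfl⟩ | ⟨E, f, rfl⟩)
    · simpa [preEdge, MonoidHom.mem_ker] using h1 E
    · simpa [preEdge, MonoidHom.mem_ker] using h2 E hE
    · have := h3 E f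
      simp only [SetLike.mem_coe, MonoidHom.mem_ker, preEdge, preVert, map_mul, map_inv,
        MonoidHom.comp_apply, Monoid.Coprod.lift_apply_inl, Monoid.Coprod.lift_apply_inr,
        Monoid.CoprodI.lift_of, FreeGroup.lift_apply_of]
      rw [mul_inv_eq_one, mul_inv_eq_iff_eq_mul, this])

theorem pi1Lift_vert {K : Type*} [Group K] {φ : ∀ a, 𝒴.G a →* K} {τ : D × Bool → K} (h1 h2 h3)
    (a : V) (g : 𝒴.G a) : 𝒴.pi1Lift T φ τ h1 h2 h3 (𝒴.vert T a g) = φ a g := by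
  simp [pi1Lift, vert, preVert]

theorem pi1Lift_stable {K : Type*} [Group K] {φ : ∀ a, 𝒴.G a →* K} {τ : D × Bool → K} (h1 h2 h3)
    (E : D × Bool) : 𝒴.pi1Lift T φ τ h1 h2 h3 (𝒴.stable T E) = τ E := by
  simp [pi1Lift, stable, preEdge]

/-- The second component of the sets on which the vertex groups act. -/
abbrev PingPongFiber : Type (max u v w) :=
  Option (D × Bool) × List ((Σ a, 𝒴.G a) ⊕ Option (D × Bool))

/-- The set on which the vertex group at `a` acts. -/
abbrev PingPongSet (a : V) : Type (max u v w) := 𝒴.G a × 𝒴.PingPongFiber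

/-- The part of the vertex set at `a` that belongs to the edge `E`. -/
def pingPong (E : D × Bool) (a : V) : Set (𝒴.PingPongSet a) :=
  {z | z.2.1 = some E ∧ ∃ f, (⟨𝒴.src E, 𝒴.bdry₀ E f⟩ : Σ a, 𝒴.G a) = ⟨a, z.1⟩}

theorem mem_pingPong {E : D × Bool} {z : 𝒴.PingPongSet (𝒴.src E)} :
    z ∈ 𝒴.pingPong E (𝒴.src E) ↔ z.2.1 = some E ∧ ∃ f, 𝒴.bdry₀ E f = z.1 := by
  simp [pingPong]

/-- Each list gives a point of each ping-pong set by the tag `some E`, and a point outside by the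
tag `none`. Conversely the lists can encode all points, so all pieces have as many orbits as there
are lists. -/
theorem exists_edge_equiv (d : D) :
    ∃ σ : 𝒴.PingPongSet (𝒴.endpt d true) ≃ 𝒴.PingPongSet (𝒴.endpt d false),
      (∀ z, σ z ∈ 𝒴.pingPong (d, false) (𝒴.endpt d false) ↔
        z ∉ 𝒴.pingPong (d, true) (𝒴.endpt d true)) ∧
      ∀ f z, σ (𝒴.emb d true f * z.1, z.2) = (𝒴.emb d false f * (σ z).1, (σ z).2) := by
  have emb : ∀ a, ∃ e : 𝒴.PingPongSet a → List ((Σ a, 𝒴.G a) ⊕ Option (D × Bool)),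
      Function.Injective e := by
    intro a
    refine ⟨fun z => Sum.inl ⟨a, z.1⟩ :: Sum.inr z.2.1 :: z.2.2, ?_⟩
    rintro ⟨g, o, l⟩ ⟨g', o', l'⟩ h
    simpa using h
  obtain ⟨e₁, he₁⟩ := emb (𝒴.endpt d true)
  obtain ⟨e₂, he₂⟩ := emb (𝒴.endpt d false)
  have inv : ∀ (b : Bool) (f : 𝒴.F d) (z : 𝒴.PingPongSet (𝒴.endpt d b)),
      (𝒴.emb d b f * z.1, z.2) ∈ 𝒴.pingPong (d, b) (𝒴.endpt d b) ↔
        z ∈ 𝒴.pingPong (d, b) (𝒴.endpt d b) := by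
    intro b f z
    have k1 := 𝒴.mem_pingPong (E := (d, b)) (z := z)
    have k2 := 𝒴.mem_pingPong (E := (d, b)) (z := (𝒴.emb d b f * z.1, z.2))
    refine k2.trans (Iff.trans ?_ k1.symm)
    refine and_congr_right fun _ => ⟨?_, ?_⟩
    · rintro ⟨f', h⟩
      refine ⟨f⁻¹ * f', ?_⟩
      rw [map_mul, h, map_inv]
      exact inv_mul_cancel_left _ _
    · rintro ⟨f', h⟩
      refine ⟨f * f', ?_⟩
      rw [map_mul, h]
      rfl
  exact exists_equivariant_swap (𝒴.emb d true) (𝒴.emb_injective d true) (𝒴.emb d false)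
    (𝒴.emb_injective d false) (𝒴.pingPong (d, true) _) (𝒴.pingPong (d, false) _) (inv true)
    (inv false) ⟨e₁, he₁⟩ ⟨e₂, he₂⟩ (fun l => (none, l)) (fun l => (some (d, true), l))
    (fun l => (some (d, false), l)) (fun l l' h => (Prod.mk.inj h).2)
    (fun l l' h => (Prod.mk.inj h).2) (fun l l' h => (Prod.mk.inj h).2)
    (fun l => ⟨rfl, 1, by rw [map_one]; rfl⟩) (fun l => ⟨rfl, 1, by rw [map_one]; rfl⟩)
    (fun l h => by simp [pingPong] at h) (fun l h => by simp [pingPong] at h)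

/-- The bijection associated with an oriented edge. -/
noncomputable def edgeEquiv : ∀ E : D × Bool,
    𝒴.PingPongSet (𝒴.tgt E) ≃ 𝒴.PingPongSet (𝒴.src E)
  | (d, false) => (𝒴.exists_edge_equiv d).choose
  | (d, true) => (𝒴.exists_edge_equiv d).choose.symm

theorem edgeEquiv_mem (E : D × Bool) (z : 𝒴.PingPongSet (𝒴.tgt E)) :
    𝒴.edgeEquiv E z ∈ 𝒴.pingPong E (𝒴.src E) ↔ z ∉ 𝒴.pingPong (rev E) (𝒴.tgt E) := by
  obtain ⟨d, _ | _⟩ := E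
  · exact (𝒴.exists_edge_equiv d).choose_spec.1 z
  · revert z
    intro (z : 𝒴.PingPongSet (𝒴.endpt d false))
    have h := (𝒴.exists_edge_equiv d).choose_spec.1
      ((𝒴.exists_edge_equiv d).choose.symm z)
    rw [Equiv.apply_symm_apply] at h
    exact (not_iff_comm.1 h.symm).symm

theorem edgeEquiv_smul (E : D × Bool) (f : 𝒴.F E.1) (z : 𝒴.PingPongSet (𝒴.tgt E)) :
    𝒴.edgeEquiv E (𝒴.bdry₁ E f * z.1, z.2) =
      (𝒴.bdry₀ E f * (𝒴.edgeEquiv E z).1, (𝒴.edgeEquiv E z).2) := by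
  obtain ⟨d, _ | _⟩ := E
  · exact (𝒴.exists_edge_equiv d).choose_spec.2 f z
  · revert z
    intro (z : 𝒴.PingPongSet (𝒴.endpt d false))
    have h := (𝒴.exists_edge_equiv d).choose_spec.2 f
      ((𝒴.exists_edge_equiv d).choose.symm z)
    rw [Equiv.apply_symm_apply] at h
    exact (Equiv.symm_apply_eq _).2 h.symm

/-- The bijection associated with an edge path. -/
noncomputable def transport : ∀ (p : List (D × Bool)) (a b : V), 𝒴.IsPath a b p →
    (𝒴.PingPongSet b ≃ 𝒴.PingPongSet a)
  | [], _, _, h => Equiv.cast (congrArg 𝒴.PingPongSet (Eq.symm h))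
  | E :: p, _, b, h => (transport p (𝒴.tgt E) b h.2).trans
      ((𝒴.edgeEquiv E).trans (Equiv.cast (congrArg 𝒴.PingPongSet h.1)))

theorem transport_congr {p q : List (D × Bool)} (e : p = q) {a b : V} (h : 𝒴.IsPath a b p)
    (h' : 𝒴.IsPath a b q) : 𝒴.transport p a b h = 𝒴.transport q a b h' := by
  subst e
  rfl

variable {𝒴 T}

/-- Transport along tree paths is compatible with each tree edge `E`. Either `E` followed by the
path from its end is again without backtracking, or that path begins with `rev E`, which cancels;
uniqueness of tree paths identifies the rest. -/
theorem exists_base_equiv (hT : 𝒴.IsMaximalTree T) (V₀ : V) :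
    ∃ κ : ∀ a, 𝒴.PingPongSet V₀ ≃ 𝒴.PingPongSet a, ∀ E : D × Bool, E.1 ∈ T → ∀ z,
      κ (𝒴.src E) z = 𝒴.edgeEquiv E (κ (𝒴.tgt E) z) := by
  choose path hp hu using fun a => hT a V₀
  refine ⟨fun a => 𝒴.transport (path a) a V₀ (hp a).1, fun E hE z => ?_⟩
  have single : ∀ a q (h : 𝒴.IsPath a V₀ q), (∀ E ∈ q, E.1 ∈ T) →
      q.IsChain (fun E E' => E' ≠ rev E) → 𝒴.transport (path a) a V₀ (hp a).1 =
        𝒴.transport q a V₀ h := fun a q h h1 h2 =>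
    𝒴.transport_congr (hu a q ⟨h, h1, h2⟩).symm _ _
  have hpt := hp (𝒴.tgt E)
  by_cases hc : (E :: path (𝒴.tgt E)).IsChain (fun E E' => E' ≠ rev E)
  · dsimp only
    rw [single (𝒴.src E) (E :: path (𝒴.tgt E)) ⟨rfl, hpt.1⟩ (by
      intro E' h
      rcases List.mem_cons.1 h with rfl | h
      · exact hE
      · exact hpt.2.1 _ h) hc]
    rfl
  · rcases hq : path (𝒴.tgt E) with _ | ⟨E', q⟩
    · rw [hq] at hc
      exact absurd (List.isChain_singleton _) hc
    · rw [hq] at hc hpt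
      have hE' : E' = rev E := by
        by_contra h
        exact hc (List.isChain_cons_cons.2 ⟨h, hpt.2.2⟩)
      subst hE'
      have h1 := single (𝒴.tgt E) (rev E :: q) hpt.1 hpt.2.1 hpt.2.2
      dsimp only
      rw [h1]
      -- The bijections of `E` and `rev E` are inverse to each other by definition once the
      -- orientation is explicit.
      obtain ⟨d, _ | _⟩ := E
      · rw [single (𝒴.src (d, false)) q hpt.1.2 (fun E h => hpt.2.1 E (List.mem_cons_of_mem _ h))
          hpt.2.2.tail]
        exact (Equiv.apply_symm_apply (𝒴.edgeEquiv (d, false)) _).symm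
      · rw [single (𝒴.src (d, true)) q hpt.1.2 (fun E h => hpt.2.1 E (List.mem_cons_of_mem _ h))
          hpt.2.2.tail]
        exact (Equiv.symm_apply_apply (𝒴.edgeEquiv (d, false)) _).symm

/-- Left multiplication by an element of a vertex group. -/
def vertPerm (a : V) : 𝒴.G a →* Equiv.Perm (𝒴.PingPongSet a) where
  toFun g := (Equiv.mulLeft g).prodCongr (Equiv.refl _)
  map_one' := by ext z <;> simp
  map_mul' g h := by ext z <;> simp [mul_assoc]

/-- The action of the fundamental group on the ping-pong sets. -/
theorem exists_action (hT : 𝒴.IsMaximalTree T) (V₀ : V) :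
    ∃ (R : 𝒴.Pi1 T →* Equiv.Perm (𝒴.PingPongSet V₀))
      (κ : ∀ a, 𝒴.PingPongSet V₀ ≃ 𝒴.PingPongSet a),
      (∀ a g z, κ a (R (𝒴.vert T a g) z) = (g * (κ a z).1, (κ a z).2)) ∧
      ∀ E z, κ (𝒴.src E) (R (𝒴.stable T E) z) = 𝒴.edgeEquiv E (κ (𝒴.tgt E) z) := by
  obtain ⟨κ, hκ⟩ := exists_base_equiv hT V₀
  let φ : ∀ a, 𝒴.G a →* Equiv.Perm (𝒴.PingPongSet V₀) := fun a =>
    ((κ a).symm.permCongrHom.toMonoidHom).comp (vertPerm a)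
  let τ : D × Bool → Equiv.Perm (𝒴.PingPongSet V₀) := fun E =>
    (κ (𝒴.tgt E)).trans ((𝒴.edgeEquiv E).trans (κ (𝒴.src E)).symm)
  have hφ : ∀ a g z, κ a (φ a g z) = (g * (κ a z).1, (κ a z).2) := by
    intro a g z
    simp [φ, vertPerm, Equiv.permCongrHom, Prod.map]
  have hτ : ∀ E z, κ (𝒴.src E) (τ E z) = 𝒴.edgeEquiv E (κ (𝒴.tgt E) z) := by
    intro E z
    simp [τ]
  refine ⟨𝒴.pi1Lift T φ τ ?_ ?_ ?_, κ, fun a g z => ?_, fun E z => ?_⟩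
  · intro E
    ext1 z
    apply (κ (𝒴.src E)).injective
    rw [Equiv.Perm.mul_apply, hτ]
    obtain ⟨d, _ | _⟩ := E
    · exact (congrArg _ (hτ (d, true) z)).trans
        (Equiv.apply_symm_apply (𝒴.edgeEquiv (d, false)) _)
    · exact (congrArg _ (hτ (d, false) z)).trans
        (Equiv.symm_apply_apply (𝒴.edgeEquiv (d, false)) _)
  · intro E hE
    ext1 z
    apply (κ (𝒴.src E)).injective
    rw [hτ, ← hκ E hE]
    rfl
  · intro E f
    ext1 z
    apply (κ (𝒴.src E)).injective
    rw [Equiv.Perm.mul_apply, Equiv.Perm.mul_apply, hφ, hτ, hτ, hφ]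
    exact (𝒴.edgeEquiv_smul E f _).symm
  · rw [pi1Lift_vert, hφ]
  · rw [pi1Lift_stable, hτ]

/-- The vertex group acts freely, by left multiplication, on its own ping-pong set. -/
theorem vert_injective (hT : 𝒴.IsMaximalTree T) (a : V) : Function.Injective (𝒴.vert T a) := by
  obtain ⟨R, κ, h, -⟩ := exists_action hT a
  rw [injective_iff_map_eq_one]
  intro g hg
  have h1 := h a g ((κ a).symm (1, none, []))
  rw [hg, map_one] at h1
  have h2 := congrArg Prod.fst h1
  simpa using h2.symm

/-- Half-spaces are read off from the action, without constructing the tree: `x` is beyond `E` if it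
moves the base point `(1, none, [])` at `b` into the ping-pong set of `E`. That base point lies in
no ping-pong set. Disjointness holds because a point carries a single tag and a single coset, and
the rule for `t E` is `edgeEquiv_mem`. -/
theorem exists_splitting (hF : ∀ d, Finite (𝒴.F d)) (hT : 𝒴.IsMaximalTree T) (V₀ : V) :
    ∃ S : Splitting (𝒴.Pi1 T) V (D × Bool), S.src = 𝒴.src ∧ S.tgt = 𝒴.tgt ∧ S.rev = rev ∧
      (S.VG = fun a => (𝒴.vert T a).range) ∧
      (S.EG = fun E => ((𝒴.vert T (𝒴.src E)).comp (𝒴.bdry₀ E)).range) ∧ S.t = 𝒴.stable T := by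
  obtain ⟨R, κ, hv, he⟩ := exists_action hT V₀
  let Hs : D × Bool → V → Set (𝒴.Pi1 T) := fun E b =>
    {x | κ (𝒴.src E) (R x ((κ b).symm (1, none, []))) ∈ 𝒴.pingPong E (𝒴.src E)}
  have hrev : ∀ E : D × Bool, rev (rev E) = E := fun E => by simp [rev]
  have hinv : ∀ E, 𝒴.stable T (rev E) = (𝒴.stable T E)⁻¹ := fun E =>
    (inv_eq_of_mul_eq_one_right (𝒴.stable_mul_stable_rev T E)).symm
  refine ⟨{
    src := 𝒴.src
    tgt := 𝒴.tgt
    rev := rev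
    src_rev := fun E => rfl
    tgt_rev := fun E => by simp [tgt, src, rev]
    rev_rev := hrev
    VG := fun a => (𝒴.vert T a).range
    EG := fun E => ((𝒴.vert T (𝒴.src E)).comp (𝒴.bdry₀ E)).range
    EG_le := ?_
    EG_finite := ?_
    t := 𝒴.stable T
    t_rev := hinv
    conj_mem := ?_
    H := Hs
    H_disjoint := ?_
    mul_mem_H := ?_
    t_mul_mem_H := ?_
    notMem_H := ?_
    connected := ?_ }, rfl, rfl, rfl, rfl, rfl, rfl⟩
  · rintro E _ ⟨f, rfl⟩
    exact ⟨_, rfl⟩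
  · intro E
    have := hF E.1
    exact Set.finite_range _
  · rintro E _ ⟨f, rfl⟩
    refine ⟨f, ?_⟩
    rw [mul_assoc, MonoidHom.comp_apply, vert_mul_stable, inv_mul_cancel_left]
    rfl
  · rintro E E' b _ x hsrc ⟨g, rfl⟩ h1 h2
    have gen : ∀ a, 𝒴.src E' = a → κ a (R ((𝒴.vert T (𝒴.src E) g)⁻¹ * x)
        ((κ b).symm (1, none, []))) ∈ 𝒴.pingPong E' a := by
      rintro a rfl
      exact h2
    have h3 := gen _ hsrc
    rw [← map_inv, map_mul, Equiv.Perm.mul_apply, hv] at h3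
    obtain ⟨a1, f, a2⟩ := 𝒴.mem_pingPong.1 h1
    obtain ⟨b1, f', b2⟩ := h3
    have e : E' = E := Option.some_injective _ (b1.symm.trans a1)
    subst e
    have b2 : 𝒴.bdry₀ E' f' = _ := eq_of_heq (Sigma.mk.inj b2).2
    refine ⟨rfl, f * f'⁻¹, ?_⟩
    rw [MonoidHom.comp_apply, map_mul, map_inv, a2, b2]
    congr 1
    group
  · rintro E b _ x ⟨f, rfl⟩ hx
    obtain ⟨a1, f', a2⟩ := 𝒴.mem_pingPong.1 hx
    refine 𝒴.mem_pingPong.2 ?_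
    rw [map_mul, Equiv.Perm.mul_apply, MonoidHom.comp_apply, hv]
    exact ⟨a1, f * f', by rw [map_mul, a2]⟩
  · intro E b x
    change κ (𝒴.src E) (R (𝒴.stable T E * x) _) ∈ 𝒴.pingPong E (𝒴.src E) ↔ _
    rw [map_mul, Equiv.Perm.mul_apply, he, edgeEquiv_mem]
    rfl
  · rintro E a _ rfl ⟨g, rfl⟩ h
    have h := 𝒴.mem_pingPong.1 h
    rw [hv, Equiv.apply_symm_apply] at h
    simp at h
  · intro P h1 h2 h3
    -- As `t E = 1` for tree edges, the end vertex can be moved freely without changing the value.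
    have tree : ∀ (p : List (D × Bool)) a x b c, 𝒴.IsPath b c p → (∀ E ∈ p, E.1 ∈ T) →
        P a x b → P a x c := by
      intro p
      induction p with
      | nil =>
        intro a x b c h _ hP
        have h : b = c := h
        exact h ▸ hP
      | cons E p ih =>
        rintro a x b c ⟨rfl, h⟩ hT' hP
        refine ih a x _ c h (fun E hE => hT' E (List.mem_cons_of_mem _ hE)) ?_
        have := h3 a x E hP
        rwa [stable_eq_one _ _ (hT' E List.mem_cons_self), mul_one] at this
    have move : ∀ a x b c, P a x b → P a x c := by
      intro a x b c hP
      obtain ⟨p, ⟨hp1, hp2, -⟩, -⟩ := hT b c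
      exact tree p a x b c hp1 hp2 hP
    have key : ∀ y : 𝒴.Pi1 T, ∀ a x b c, P a x b → P a (x * y) c := by
      intro y
      induction y using pi1_induction with
      | one => intro a x b c hP; rw [mul_one]; exact move a x b c hP
      | mul y z hy hz => intro a x b c hP; rw [← mul_assoc]; exact hz _ _ b _ (hy _ _ _ b hP)
      | vert d g =>
        intro a x b c hP
        exact move _ _ _ _ (h2 a x d _ (move _ _ _ _ hP) ⟨g, rfl⟩)
      | stable E =>
        intro a x b c hP
        exact move _ _ _ _ (h3 a x E (move _ _ _ _ hP))
    intro a x b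
    have := key x a 1 a b (h1 a)
    rwa [one_mul] at this

end GraphOfGroups

/-! ### Restriction of a structure to a vertex group. -/

section Restriction

open Pointwise

variable {Γ : Type u} [Group Γ] {V : Type v} {𝓔 : Type w}

/-- Applied to half-spaces, this cuts a path at a letter that crosses a given edge. -/
theorem exists_last_of_prod (P : Γ → Prop) (p : List Γ) : ∀ z, P z → ¬ P (z * p.prod) →
    ∃ p₁ s p₂, p = p₁ ++ s :: p₂ ∧ P (z * p₁.prod) ∧ ¬ P (z * p₁.prod * s) := by
  induction p with
  | nil => intro z h h'; simp at h'; contradiction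
  | cons s p ih =>
    intro z h h'
    by_cases hs : P (z * s)
    · obtain ⟨p₁, s', p₂, rfl, h1, h2⟩ := ih (z * s) hs (by simpa [mul_assoc] using h')
      exact ⟨s :: p₁, s', p₂, rfl, by simpa [mul_assoc] using h1, by simpa [mul_assoc] using h2⟩
    · exact ⟨[], s, p, rfl, by simpa using h, by simpa using hs⟩

/-- A word of the language whose value lies in a vertex group stays close to this group. -/
theorem Splitting.exists_quasiconvex [Finite 𝓔] (S : Splitting Γ V 𝓔) (a : V) {α : Type x}
    [Finite α] {ev : α → Γ} {L : Language α} (hL : L.IsRegular) (hf : FinToOne ev L) :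
    ∃ Q : Set Γ, Q.Finite ∧ ∀ x y, x ++ y ∈ L → ((x ++ y).map ev).prod ∈ S.VG a →
      ∃ q ∈ Q, (x.map ev).prod * q ∈ S.VG a := by
  -- The points from which a single letter crosses one of the edges `E`, in either direction.
  let C : Set Γ := ⋃ i : 𝓔 × α, ({x | x ∈ S.H i.1 a ∧ x * ev i.2 ∉ S.H i.1 a} ∪
    {x | x ∉ S.H i.1 a ∧ x * ev i.2 ∈ S.H i.1 a})
  have hC : C.Finite := Set.finite_iUnion fun i =>
    (S.finite_crossing a (ev i.2) a i.1).1.union (S.finite_crossing a (ev i.2) a i.1).2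
  obtain ⟨N, hN⟩ := exists_bounded_return hL hf (hC.inv.mul hC)
  refine ⟨insert 1 (prodBall (Set.range ev) N * C⁻¹),
    ((prodBall_finite (Set.finite_range ev) N).mul hC.inv).insert 1, fun x y hxy hval => ?_⟩
  have hr := S.red_all a (x.map ev).prod a
  generalize hX : (x.map ev).prod = X at hr
  rw [List.map_append, List.prod_append, hX] at hval
  cases hr with
  | last _ hg => exact ⟨1, Or.inl rfl, by rwa [mul_one]⟩
  | @step _ _ _ E g z h hg _ hz =>
    subst h
    have hmem : g⁻¹ * (g * S.t E * z) ∈ S.H E (S.src E) := by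
      simpa [mul_assoc] using hz.mem_H
    have hout : ∀ k ∈ S.VG (S.src E), g⁻¹ * k ∉ S.H E (S.src E) := fun k hk =>
      S.notMem_H rfl (mul_mem (inv_mem hg) hk)
    -- The value of `x` lies beyond the edge `g E`, while 1 and the value of the whole word do not.
    -- So the path crosses `g E` outwards within `x` and inwards within `y`.
    obtain ⟨p₁, s, p₂, e1, h1, h2⟩ := exists_last_of_prod (fun k => g⁻¹ * k ∉ S.H E (S.src E))
      (x.map ev) 1 (hout 1 (one_mem _)) (by rw [one_mul, hX, not_not]; exact hmem)
    obtain ⟨q₁, r, q₂, e2, k1, k2⟩ := exists_last_of_prod (fun k => g⁻¹ * k ∈ S.H E (S.src E))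
      (y.map ev) _ hmem (hout _ hval)
    obtain ⟨x₁, x₂', rfl, rfl, e3⟩ := List.map_eq_append_iff.1 e1
    obtain ⟨s', x₂, rfl, rfl, rfl⟩ := List.map_eq_cons_iff.1 e3
    obtain ⟨y₁, y₂', rfl, rfl, e4⟩ := List.map_eq_append_iff.1 e2
    obtain ⟨r', y₂, rfl, rfl, rfl⟩ := List.map_eq_cons_iff.1 e4
    have c1 : g⁻¹ * (x₁.map ev).prod ∈ C :=
      Set.mem_iUnion.2 ⟨(E, s'), Or.inr ⟨by simpa using h1, by simpa [mul_assoc] using h2⟩⟩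
    have c2 : g⁻¹ * (g * S.t E * z * (y₁.map ev).prod) ∈ C :=
      Set.mem_iUnion.2 ⟨(E, r'), Or.inl ⟨k1, by simpa [mul_assoc] using k2⟩⟩
    have hlen := hN x₁ (s' :: x₂ ++ y₁) (r' :: y₂) (by simpa using hxy)
      ⟨_, Set.inv_mem_inv.2 c1, _, c2, by
        rw [← hX]
        simp only [List.map_append, List.prod_append, List.map_cons, List.prod_cons]
        group⟩
    -- Follow `y` to the crossing point, a bounded number of letters, then use that this point is
    -- `g` times an element of `C`; the result is `g`, in the vertex group.
    refine ⟨(y₁.map ev).prod * (g⁻¹ * (g * S.t E * z * (y₁.map ev).prod))⁻¹, Or.inr ?_, ?_⟩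
    · refine Set.mul_mem_mul ⟨y₁.map ev, ?_, ?_, rfl⟩ (Set.inv_mem_inv.2 c2)
      · simp only [List.length_append, List.length_cons] at hlen
        rw [List.length_map]
        omega
      · intro b hb
        obtain ⟨c, -, rfl⟩ := List.mem_map.1 hb
        exact ⟨c, rfl⟩
    · convert hg using 1
      group

variable {H : Type x} [Group H]

/-- The letters that describe steps of paths close to the image of `i`. -/
structure StepLetter (i : H →* Γ) (A : Alphabet Γ) {n : ℕ} (q : Fin n → Γ) : Type where
  fst : Fin n
  base : A.Letter
  snd : Fin n
  mem : (q fst)⁻¹ * A.ev base * q snd ∈ i.range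

variable {i : H →* Γ} {A : Alphabet Γ} {n : ℕ} {q : Fin n → Γ}

namespace StepLetter

instance : Finite (StepLetter i A q) :=
  Finite.of_injective (fun τ => (τ.fst, τ.base, τ.snd)) (by
    rintro ⟨a, b, c, h⟩ ⟨a', b', c', h'⟩ e
    simp only [Prod.mk.injEq] at e
    obtain ⟨rfl, rfl, rfl⟩ := e
    rfl)

/-- The value of a step. -/
noncomputable def ev (τ : StepLetter i A q) : H := τ.mem.choose

theorem map_ev (τ : StepLetter i A q) :
    i τ.ev = (q τ.fst)⁻¹ * A.ev τ.base * q τ.snd := τ.mem.choose_spec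

/-- Compatibility of consecutive steps. -/
def Rel (j : Fin n) (τ : StepLetter i A q) (k : Fin n) : Prop := τ.fst = j ∧ τ.snd = k

end StepLetter

open StepLetter

theorem step_value {j k : Fin n} {W : List (StepLetter i A q)} (h : Run Rel j W k) :
    (W.map (i ∘ StepLetter.ev)).prod = (q j)⁻¹ * (W.map (A.ev ∘ base)).prod * q k := by
  induction W generalizing j with
  | nil => cases h; simp
  | cons τ W ih =>
    obtain ⟨j', ⟨rfl, rfl⟩, h⟩ := h
    rw [List.map_cons, List.prod_cons, ih h, List.map_cons, List.prod_cons, Function.comp_apply,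
      map_ev, Function.comp_apply]
    group

theorem step_travel {j k : Fin n} {W : List (StepLetter i A q)} (h : Run Rel j W k) :
    STrav (Set.range q) (q j)⁻¹ (W.map (A.ev ∘ base)) 1 (W.map (i ∘ StepLetter.ev)) := by
  intro t
  rw [← List.take_append_drop t W, run_append] at h
  obtain ⟨r, h, -⟩ := h
  rw [← List.map_take, ← List.map_take, step_value h]
  exact ⟨r, by group⟩

/-- A letter of the new alphabet is a letter of `L` together with corrections from the finite set of
`Splitting.exists_quasiconvex` that place both its ends in the vertex group. Values telescope, and a
word stays within the finite set of corrections of its underlying word in `L`. Travel in the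
subgroup therefore follows from travel in the whole group. -/
theorem exists_restriction [Finite 𝓔] (S : Splitting Γ V 𝓔) (a : V)
    (hi : Function.Injective i) (hr : i.range = S.VG a) {s : Bool} (L : AsyncAutStruct Γ)
    (hb : L.IsBi s) : ∃ M : AsyncAutStruct H, M.IsBi s ∧
      EqTr L.alph.ev L.lang (i ∘ M.alph.ev) M.lang := by
  obtain ⟨Q, hQ, hq⟩ := S.exists_quasiconvex a L.isRegular L.isFiniteToOne
  have : Finite ↑(insert 1 Q) := (hQ.insert 1).to_subtype
  obtain ⟨n, ⟨e⟩⟩ := Finite.exists_equiv_fin ↑(insert 1 Q)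
  let q : Fin n → Γ := fun j => (e.symm j).1
  have hq1 : ∃ j, q j = 1 := ⟨e ⟨1, Or.inl rfl⟩, by simp [q]⟩
  obtain ⟨j₀, hj₀⟩ := hq1
  have hqQ : ∀ z ∈ Q, ∃ j, q j = z := fun z hz => ⟨e ⟨z, Or.inr hz⟩, by simp [q]⟩
  -- Both outer corrections are 1, so that a word and its underlying word have the same value.
  let M₀ : Language (StepLetter i L.alph q) :=
    {W | W.map base ∈ L.lang ∧ Run Rel j₀ W j₀}
  -- Corrections are chosen letter by letter; the prefix `x` already read and its correction `j`
  -- determine where the next letter starts.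
  have lift : ∀ (y x : List L.alph.Letter) (j : Fin n), x ++ y ∈ L.lang →
      ((x ++ y).map L.alph.ev).prod ∈ S.VG a → (x.map L.alph.ev).prod * q j ∈ S.VG a →
      (y = [] → j = j₀) →
      ∃ W : List (StepLetter i L.alph q), W.map base = y ∧ Run Rel j W j₀ := by
    intro y
    induction y with
    | nil => intro x j _ _ _ h; exact ⟨[], rfl, h rfl⟩
    | cons b y ih =>
      intro x j hxy hv hj _
      have hk : ∃ k, ((x ++ [b]).map L.alph.ev).prod * q k ∈ S.VG a ∧ (y = [] → k = j₀) := by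
        by_cases hy : y = []
        · subst hy
          exact ⟨j₀, by rwa [hj₀, mul_one], fun _ => rfl⟩
        · obtain ⟨z, hz, h⟩ := hq (x ++ [b]) y (by simpa using hxy) (by simpa using hv)
          obtain ⟨k, rfl⟩ := hqQ z hz
          exact ⟨k, h, fun h => absurd h hy⟩
      obtain ⟨k, hk, hk'⟩ := hk
      obtain ⟨W, hW, hrun⟩ := ih (x ++ [b]) k (by simpa using hxy) (by simpa using hv) hk hk'
      have hmem : (q j)⁻¹ * L.alph.ev b * q k ∈ i.range := by
        rw [hr]
        convert mul_mem (inv_mem hj) hk using 1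
        simp only [List.map_append, List.prod_append, List.map_cons, List.map_nil,
          List.prod_singleton]
        group
      exact ⟨⟨j, b, k, hmem⟩ :: W, by rw [List.map_cons, hW], k, ⟨rfl, rfl⟩, hrun⟩
  have val : ∀ W ∈ M₀, i (W.map StepLetter.ev).prod = ((W.map base).map L.alph.ev).prod := by
    rintro W ⟨-, hW⟩
    have := step_value hW
    rw [hj₀] at this
    rw [map_list_prod, List.map_map, List.map_map, this]
    simp
  have trav : ∀ W ∈ M₀, STrav (Set.range q) 1 ((W.map base).map L.alph.ev) 1
      ((W.map StepLetter.ev).map i) := by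
    rintro W ⟨-, hW⟩
    have := step_travel hW
    rw [hj₀, inv_one] at this
    rwa [List.map_map, List.map_map]
  have onto : ∀ g : H, ∃ W ∈ M₀, (W.map StepLetter.ev).prod = g := by
    intro g
    obtain ⟨l, hl, hv⟩ := L.isNormalForm (i g)
    obtain ⟨W, hW, hrun⟩ := lift l [] j₀ hl (by
      rw [← hr]
      exact ⟨g, hv.symm⟩) (by simp [hj₀]) (fun _ => rfl)
    have hWM : W ∈ M₀ := ⟨by rwa [hW], hrun⟩
    refine ⟨W, hWM, hi ?_⟩
    rw [val W hWM, hW]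
    exact hv
  let A : Alphabet H :=
    { Letter := StepLetter i L.alph q
      finite_letter := inferInstance
      inv := fun τ => ⟨τ.snd, L.alph.inv τ.base, τ.fst, by
        convert inv_mem τ.mem using 1
        rw [L.alph.ev_inv]
        group⟩
      inv_inv := fun τ => by simp [L.alph.inv_inv]
      ev := StepLetter.ev
      ev_inv := fun τ => hi (by
        rw [map_inv, map_ev, map_ev]
        simp only [L.alph.ev_inv]
        group)
      onto := fun g => by
        obtain ⟨W, -, h⟩ := onto g
        exact ⟨W, h⟩ }
  have hreg : M₀.IsRegular := by
    refine ((L.isRegular.comap base).inf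
      (isRegular_setOf_run Rel {j₀} {j₀})).of_iff fun W => ?_
    constructor
    · rintro ⟨h1, h2⟩
      exact ⟨h1, _, rfl, _, rfl, h2⟩
    · rintro ⟨h1, _, rfl, _, rfl, h2⟩
      exact ⟨h1, h2⟩
  have hfto : A.IsFiniteToOne M₀ := by
    intro g
    obtain ⟨N, hN⟩ := ((L.isFiniteToOne (i g)).image List.length).bddAbove
    refine (List.finite_length_le (StepLetter i L.alph q) N).subset ?_
    rintro W ⟨hW, rfl⟩
    have := hN ⟨W.map base, ⟨hW.1, (val W hW).symm⟩, rfl⟩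
    simpa using this
  have hbi : BiTr s A.ev M₀ A.ev M₀ := by
    intro g h
    obtain ⟨B, hB, hT⟩ := hb (i g) (i h)
    have hq := Set.finite_range q
    refine ⟨i ⁻¹' ((Set.range q)⁻¹ * B * Set.range q),
      ((hq.inv.mul hB).mul hq).preimage hi.injOn, fun W hW W' hW' e => Tr.of_map i ?_⟩
    have t1 := (Tr.of_strav (s := s) (trav W hW)).symm.translate (i g)
    have t2 := hT _ hW.1 _ hW'.1 (by
      rw [← val W hW, ← val W' hW', ← map_mul, ← map_mul]
      exact congrArg i e)
    have t3 := Tr.of_strav (s := s) (trav W' hW')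
    rw [mul_one] at t1
    rw [map_one]
    exact (t1.trans t2).trans t3
  refine ⟨AsyncAutStruct.ofBiTr A M₀ hreg onto hfto hbi, hbi,
    show EqTr L.alph.ev L.lang (i ∘ StepLetter.ev) M₀ from ?_⟩
  obtain ⟨B, hB, hT⟩ := hb.eqTr
  refine ⟨B * Set.range q, hB.mul (Set.finite_range q), fun l hl W hW e => ?_⟩
  have e' : (l.map L.alph.ev).prod = ((W.map base).map L.alph.ev).prod := by
    rw [← val W hW, map_list_prod, List.map_map]
    exact e
  have t := (hT l hl _ hW.1 e').trans (trav W hW).atrav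
  rwa [List.map_map] at t

end Restriction

/-! ### Travel of a two-sided structure with concatenations along reduced paths. -/

section PathWords

open Pointwise

variable {Γ : Type u} [Group Γ] {V : Type v} {𝓔 : Type w}

/-- Concatenations of syllables from the sets `M o a o'` along reduced paths, where `a` is the
vertex and `o` and `o'` are the incoming and the outgoing edge. -/
inductive Splitting.SyllableWord (S : Splitting Γ V 𝓔)
    (M : Option 𝓔 → V → Option 𝓔 → Set (List Γ)) (e : 𝓔 → List Γ) :
    Option 𝓔 → V → V → List Γ → Prop
  | last (o : Option 𝓔) {a : V} {u : List Γ} (hu : u ∈ M o a none) : SyllableWord S M e o a a u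
  | step (o : Option 𝓔) {a b : V} {E : 𝓔} {u l : List Γ} (h : S.src E = a)
      (hu : u ∈ M o a (some E)) (hred : o = some (S.rev E) → u.prod ∉ S.EG E)
      (hl : SyllableWord S M e (some E) (S.tgt E) b l) :
      SyllableWord S M e o a b (u ++ e E ++ l)

variable {S : Splitting Γ V 𝓔} {M : Option 𝓔 → V → Option 𝓔 → Set (List Γ)} {e : 𝓔 → List Γ}

theorem Splitting.SyllableWord.red (he : ∀ E, (e E).prod = S.t E)
    (hM : ∀ o a o', ∀ u ∈ M o a o', u.prod ∈ S.VG a) {o : Option 𝓔} {a b : V}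
    {l : List Γ} (h : S.SyllableWord M e o a b l) : S.Red o a b l.prod := by
  induction h with
  | last o hu => exact .last _ (hM _ _ _ _ hu)
  | step o h hu hred _ ih =>
    rw [List.prod_append, List.prod_append, he]
    exact .step _ h (hM _ _ _ _ hu) hred ih

/-- If the words of a two-sided fellow travelling language travel with all syllables, then they
travel with the words that are composed of such syllables along reduced paths. -/
theorem Splitting.exists_syllableWord_travel [Finite V] [Finite 𝓔] {α : Type x} [Finite α]
    {ev : α → Γ} {L : Language α} (hL : L.IsRegular) (hb : BiTr false ev L ev L)
    (onto : ∀ g, ∃ l ∈ L, (l.map ev).prod = g) (he : ∀ E, (e E).prod = S.t E)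
    (hM : ∀ o a o', ∀ u ∈ M o a o', u.prod ∈ S.VG a)
    (hT : ∃ B : Set Γ, B.Finite ∧ ∀ o a o', ∀ u ∈ M o a o', ∀ l ∈ L,
      (l.map ev).prod = u.prod → ATrav B 1 (l.map ev) 1 u) (V₀ : V) :
    ∃ B : Set Γ, B.Finite ∧ ∀ b l, S.SyllableWord M e none V₀ b l → ∀ m ∈ L,
      (m.map ev).prod = l.prod → ATrav B 1 (m.map ev) 1 l := by
  -- The second union covers a word that ends before it crosses an edge: the reduced path ends at a
  -- translate of `b`, but the word is followed by means of translates of `V₀`.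
  let C : Set Γ := (⋃ i : 𝓔 × α, {x | x ∉ S.H i.1 V₀ ∧ x * ev i.2 ∈ S.H i.1 V₀}) ∪
    ⋃ i : 𝓔 × V, {x | x ∉ S.H i.1 V₀ ∧ x * 1 ∈ S.H i.1 i.2}
  have hC : C.Finite := (Set.finite_iUnion fun i : 𝓔 × α =>
    (S.finite_crossing V₀ (ev i.2) V₀ i.1).2).union
    (Set.finite_iUnion fun i : 𝓔 × V => (S.finite_crossing V₀ 1 i.2 i.1).2)
  let B₀ : Set Γ := insert 1 ((Set.range S.t)⁻¹ * C)
  have hB₀ : B₀.Finite := ((Set.finite_range S.t).inv.mul hC).insert 1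
  obtain ⟨B₁, hB₁, h₁⟩ := exists_subword_travel hL hb hB₀.inv (hC.insert 1)
  obtain ⟨B₂, hB₂, h₂⟩ := hT
  have hR : (insert [] (Set.range e) : Set (List Γ)).Finite :=
    (Set.finite_range _).insert _
  have hB₃ := hB₂.inv.mul hB₁
  obtain ⟨B₄, hB₄, h₄⟩ := exists_tr_append_tails false hB₃ hR
  -- One syllable `u` against the piece `y` of a word of `L`: insert a word `m` of `L` with the
  -- value of `u`, which travels with `u` by assumption and with `y` as a subword.
  have segment : ∀ x y z, x ++ y ++ z ∈ L → ∀ o a o', ∀ u ∈ M o a o', ∀ g h : Γ,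
      g⁻¹ * (x.map ev).prod ∈ B₀ → (g * u.prod)⁻¹ * ((x ++ y).map ev).prod = h → h ∈ insert 1 C →
      ATrav (B₂⁻¹ * B₁) g u (x.map ev).prod (y.map ev) := by
    intro x y z hxyz o a o' u hu g h hg hh hhC
    obtain ⟨m, hm, hv⟩ := onto u.prod
    have t1 := (h₂ o a o' u hu m hm hv).symm
    have t2 := h₁ x y z hxyz m hm ((x.map ev).prod⁻¹ * g) (by simpa using hg) h hhC (by
      rw [hv, ← hh, List.map_append, List.prod_append]
      group)
    have t3 := ATrav.translate g t1
    have t4 := t2.translate (x.map ev).prod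
    rw [mul_one] at t3
    rw [mul_one, mul_inv_cancel_left] at t4
    exact ATrav.trans t3 t4
  -- Here `g` is the value of the syllables already treated and `x` the part of the word already
  -- used. The last hypothesis says that `x` is not yet beyond any edge by which the path may
  -- continue, so that the next crossing still lies ahead.
  have main : ∀ o a b l, S.SyllableWord M e o a b l → ∀ x y g, x ++ y ∈ L →
      g⁻¹ * (x.map ev).prod ∈ B₀ → g * l.prod = ((x ++ y).map ev).prod →
      (∀ E k, S.src E = a → k ∈ S.VG a → (o = some (S.rev E) → k ∉ S.EG E) →
        k⁻¹ * (g⁻¹ * (x.map ev).prod) ∉ S.H E V₀) →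
      ATrav (B₂⁻¹ * B₁ ∪ B₄) g l (x.map ev).prod (y.map ev) := by
    intro o a b l hl
    induction hl with
    | @last o a u hu =>
      intro x y g hxy hg hv _
      exact (segment x y [] (by simpa using hxy) _ _ _ u hu g 1 hg (by rw [hv]; group)
        (Or.inl rfl)).mono Set.subset_union_left
    | @step o a b E u l h hu hred hl ih =>
      intro x y g hxy hg hv hinv
      have hin : (g * u.prod)⁻¹ * (x.map ev).prod ∉ S.H E V₀ := by
        have := hinv E u.prod h (hM _ _ _ _ hu) hred
        rwa [← mul_assoc, ← mul_inv_rev] at this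
      have hout : (g * u.prod)⁻¹ * ((x ++ y).map ev).prod ∈ S.H E b := by
        have e1 : (g * u.prod)⁻¹ * ((x ++ y).map ev).prod = S.t E * l.prod := by
          rw [← hv, List.prod_append, List.prod_append, he]
          group
        rw [e1]
        exact (hl.red he hM).mem_H
      obtain ⟨y₁, y₂, rfl, k1, k2⟩ : ∃ y₁ y₂, y = y₁ ++ y₂ ∧
          (g * u.prod)⁻¹ * ((x ++ y₁).map ev).prod ∉ S.H E V₀ ∧
          (g * u.prod)⁻¹ * ((x ++ y₁).map ev).prod ∈ C := by
        by_cases hc : (g * u.prod)⁻¹ * ((x ++ y).map ev).prod ∈ S.H E V₀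
        · obtain ⟨q₁, r, q₂, e2, k1, k2⟩ := exists_last_of_prod
            (fun k => (g * u.prod)⁻¹ * k ∉ S.H E V₀) (y.map ev) _ hin (by
              rw [not_not]
              rwa [List.map_append, List.prod_append] at hc)
          obtain ⟨y₁, y₂', rfl, rfl, e4⟩ := List.map_eq_append_iff.1 e2
          obtain ⟨r', y₂, rfl, rfl, rfl⟩ := List.map_eq_cons_iff.1 e4
          have e5 : ((x ++ y₁).map ev).prod = (x.map ev).prod * (y₁.map ev).prod := by simp
          refine ⟨y₁, r' :: y₂, rfl, by rwa [e5], Or.inl (Set.mem_iUnion.2 ⟨(E, r'), ?_, ?_⟩)⟩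
          · rwa [e5]
          · rw [e5, mul_assoc]
            exact not_not.1 k2
        · exact ⟨y, [], by simp, hc, Or.inr (Set.mem_iUnion.2 ⟨(E, b), hc, by rwa [mul_one]⟩)⟩
      have t1 := h₄ _ _ _ _ (segment x y₁ y₂ (by simpa using hxy) _ _ _ u hu g _ hg rfl
        (Or.inr k2)) (e E) (Or.inr ⟨E, rfl⟩) [] (Or.inl rfl)
      rw [List.append_nil] at t1
      have e6 : (g * (u.prod * S.t E))⁻¹ * ((x ++ y₁).map ev).prod =
          (S.t E)⁻¹ * ((g * u.prod)⁻¹ * ((x ++ y₁).map ev).prod) := by group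
      have t2 := ih (x ++ y₁) y₂ (g * (u.prod * S.t E)) (by simpa using hxy) (by
        rw [e6]
        exact Or.inr ⟨_, Set.inv_mem_inv.2 ⟨E, rfl⟩, _, k2, rfl⟩) (by
        rw [List.append_assoc, ← hv, List.prod_append, List.prod_append, he]
        group) (by
        intro E' k hE' hk hred' hmem
        rw [e6] at hmem
        -- The cut was made just before `E` is crossed, so the point is behind the edge, beyond `rev
        -- E` as seen from the next vertex. It is then beyond no other edge there, which restores
        -- the hypothesis on `x`.
        have h6 : (S.t E)⁻¹ * ((g * u.prod)⁻¹ * ((x ++ y₁).map ev).prod) ∈ S.H (S.rev E) V₀ := by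
          by_contra hc
          rw [← S.t_mul_mem_H, mul_inv_cancel_left] at hc
          exact k1 hc
        obtain ⟨rfl, h7⟩ := S.H_disjoint (by rw [hE', S.src_rev]) (by rwa [S.src_rev]) h6 hmem
        exact hred' (by rw [S.rev_rev]) h7)
      have t3 := (ATrav.mono Set.subset_union_right t1).append (B := B₂⁻¹ * B₁ ∪ B₄) (p' := l)
        (q' := y₂.map ev) (by
          rw [List.prod_append, he]
          rwa [List.map_append, List.prod_append] at t2)
      rw [List.map_append]
      exact t3
  refine ⟨(B₂⁻¹ * B₁ ∪ B₄)⁻¹, (hB₃.union hB₄).inv, fun b l hl m hm hv => ?_⟩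
  have := main none V₀ b l hl [] m 1 hm (by simp [B₀]) (by simpa using hv.symm) (by
    intro E k hE hk _
    simpa using S.notMem_H hE (inv_mem hk))
  simpa using this.symm

end PathWords

/-! ### Two-sided travel of words composed from syllables. -/

section Compose

open Pointwise

variable {Γ : Type u} [Group Γ] {V : Type v} {𝓔 : Type w}

/-- The subgroup that stabilizes the incoming edge. -/
def Splitting.inGroup (S : Splitting Γ V 𝓔) : Option 𝓔 → Subgroup Γ
  | none => ⊥
  | some E => S.EG (S.rev E)

/-- Sets of syllables with two-sided fellow travelling, for which the lengths of the syllables do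
not depend on the position of the syllable relative to the adjacent edge groups. -/
structure Splitting.Syllables (S : Splitting Γ V 𝓔) (s : Bool)
    (M : Option 𝓔 → V → Option 𝓔 → Set (List Γ)) (e : 𝓔 → List Γ) : Prop where
  prod_e : ∀ E, (e E).prod = S.t E
  mem_VG : ∀ o a o', ∀ u ∈ M o a o', u.prod ∈ S.VG a
  onto : ∀ o a o', ∀ g ∈ S.VG a, ∃ u ∈ M o a o', u.prod = g
  finite : ∀ o a o' g, {u | u ∈ M o a o' ∧ u.prod = g}.Finite
  travel : ∀ g h, ∃ B : Set Γ, B.Finite ∧ ∀ a o₁ o₁' o₂ o₂', ∀ u ∈ M o₁ a o₁', ∀ u' ∈ M o₂ a o₂',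
    g ∈ S.VG a → g * u.prod * h = u'.prod → Tr s B g u 1 u'
  diff : s = true → ∀ g h, ∃ c : ℕ, ∀ a o₁ o₁' o₂ o₂', ∀ u ∈ M o₁ a o₁', ∀ u' ∈ M o₂ a o₂',
    g ∈ S.VG a → g * u.prod * h = u'.prod → u.length ≤ u'.length + c ∧ u'.length ≤ u.length + c
  -- Exact equality is required here, while `diff` allows a constant: this comparison is repeated
  -- along the whole common part of two paths.
  len : s = true → ∀ o a E, ∀ u ∈ M o a (some E), ∀ u' ∈ M o a (some E), ∀ g ∈ S.inGroup o,
    g ∈ S.VG a → ∀ h ∈ S.EG E, g * u.prod * h = u'.prod → u.length = u'.length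
  letters : ∃ Λ : Set Γ, Λ.Finite ∧ ∀ o a o', ∀ u ∈ M o a o', ∀ x ∈ u, x ∈ Λ

variable {S : Splitting Γ V 𝓔} {s : Bool} {M : Option 𝓔 → V → Option 𝓔 → Set (List Γ)}
  {e : 𝓔 → List Γ}

/-- What follows the first syllable of a composed word. -/
def Splitting.Tail (S : Splitting Γ V 𝓔) (M : Option 𝓔 → V → Option 𝓔 → Set (List Γ))
    (e : 𝓔 → List Γ) (b a : V) : Option 𝓔 → List Γ → Prop
  | none, r => r = [] ∧ a = b
  | some E, r => S.src E = a ∧ ∃ l, r = e E ++ l ∧ S.SyllableWord M e (some E) (S.tgt E) b l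

theorem Splitting.SyllableWord.exists_tail {o : Option 𝓔} {a b : V} {l : List Γ}
    (h : S.SyllableWord M e o a b l) :
    ∃ u r o', l = u ++ r ∧ u ∈ M o a o' ∧ S.Tail M e b a o' r := by
  cases h with
  | last _ hu => exact ⟨l, [], none, by simp, hu, rfl, rfl⟩
  | @step _ _ _ E u l h hu _ hl => exact ⟨u, e E ++ l, some E, by simp, hu, h, l, rfl, hl⟩

/-- The elements of all the edge groups, as a finite set. -/
theorem Splitting.exists_edge_elements [Finite 𝓔] (S : Splitting Γ V 𝓔) :
    ∃ Q : Set Γ, Q.Finite ∧ 1 ∈ Q ∧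
    (∀ E, ∀ g ∈ S.EG E, g ∈ Q) ∧ ∀ o, ∀ g ∈ S.inGroup o, g ∈ Q := by
  have h : ∀ E, ∀ g ∈ S.EG E, g ∈ insert 1 (⋃ E, (S.EG E : Set Γ)) :=
    fun E g hg => Or.inr (Set.mem_iUnion.2 ⟨E, hg⟩)
  refine ⟨_, (Set.finite_iUnion fun E => S.EG_finite E).insert 1, Or.inl rfl, h, ?_⟩
  rintro (_ | E) g hg
  · exact Or.inl (Subgroup.mem_bot.1 hg)
  · exact h _ g hg

namespace Splitting.Syllables

variable (hS : S.Syllables s M e)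
include hS

theorem red {o : Option 𝓔} {a b : V} {l : List Γ} (h : S.SyllableWord M e o a b l) :
    S.Red o a b l.prod := h.red hS.prod_e hS.mem_VG

theorem tail_mem_H {a b : V} {E : 𝓔} {r : List Γ} (h : S.Tail M e b a (some E) r) :
    r.prod ∈ S.H E b := by
  obtain ⟨-, l, rfl, hl⟩ := h
  rw [List.prod_append, hS.prod_e]
  exact (hS.red hl).mem_H

/-- The half-space in which a value lies determines the next edge of a word, up to the edge group.
This is how two words are compared edge by edge. -/
theorem eq_of_tail {a b : V} {o : Option 𝓔} {r : List Γ} (h : S.Tail M e b a o r) {E : 𝓔} {k : Γ}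
    (hE : S.src E = a) (hk : k ∈ S.VG a) (hr : k * r.prod ∈ S.H E b) : o = some E ∧ k ∈ S.EG E := by
  cases o with
  | none =>
    obtain ⟨rfl, rfl⟩ := h
    exact absurd (by simpa using hr) (S.notMem_H hE hk)
  | some E' =>
    obtain ⟨rfl, h2⟩ := S.H_disjoint (E' := E') (h.1.trans hE.symm) (hE ▸ hk) hr
      (by simpa using hS.tail_mem_H h)
    exact ⟨rfl, h2⟩

theorem exists_word {o : Option 𝓔} {a b : V} {x : Γ} (h : S.Red o a b x) :
    ∃ l, S.SyllableWord M e o a b l ∧ l.prod = x := by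
  induction h with
  | last o hg =>
    obtain ⟨u, hu, rfl⟩ := hS.onto o _ none _ hg
    exact ⟨u, .last _ hu, rfl⟩
  | @step o a b E g x h hg hred hx ih =>
    obtain ⟨u, hu, rfl⟩ := hS.onto o _ (some E) _ hg
    obtain ⟨l, hl, rfl⟩ := ih
    exact ⟨_, .step _ h hu hred hl, by simp [hS.prod_e, mul_assoc]⟩

/-- By induction along one word of the given value: any other word has the same next edge and a
first syllable that differs by an element `k` of the edge group. There are finitely many `k`, and
each transfers to the rest of the word as a left factor. -/
theorem finite_translates [Finite 𝓔] {o : Option 𝓔} {a b : V} {l : List Γ}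
    (h : S.SyllableWord M e o a b l) : ∀ g ∈ S.VG a,
      {l' | ∃ o', S.SyllableWord M e o' a b l' ∧ l'.prod = g * l.prod}.Finite := by
  have fin : ∀ a (Q : Set Γ), Q.Finite → {u | ∃ o o', u ∈ M o a o' ∧ u.prod ∈ Q}.Finite := by
    intro a Q hQ
    refine (Set.finite_iUnion fun o : Option 𝓔 => Set.finite_iUnion fun o' : Option 𝓔 =>
      hQ.biUnion fun g _ => hS.finite o a o' g).subset ?_
    rintro u ⟨o, o', hu, hq⟩
    exact Set.mem_iUnion.2 ⟨o, Set.mem_iUnion.2 ⟨o', Set.mem_biUnion hq ⟨hu, rfl⟩⟩⟩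
  induction h with
  | @last o a u hu =>
    intro g hg
    refine (fin a {g * u.prod} (Set.finite_singleton _)).subset ?_
    rintro l' ⟨o', hl', e'⟩
    obtain ⟨u', r, o'', rfl, hu', hr⟩ := hl'.exists_tail
    rcases o'' with _ | E'
    · obtain ⟨rfl, -⟩ := hr
      exact ⟨o', none, by simpa using hu', by simpa using e'⟩
    · have h1 := hS.tail_mem_H hr
      refine absurd h1 (S.notMem_H hr.1 ?_)
      have : r.prod = (u'.prod)⁻¹ * (g * u.prod) := by
        rw [← e', List.prod_append]; group
      rw [this]
      exact mul_mem (inv_mem (hS.mem_VG _ _ _ _ hu')) (mul_mem hg (hS.mem_VG _ _ _ _ hu))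
  | @step o a b E u l h hu hred hl ih =>
    intro g hg
    have tl : S.Tail M e b a (some E) (e E ++ l) := ⟨h, l, rfl, hl⟩
    have f1 := fin a ((fun k => g * u.prod * k) '' (S.EG E : Set Γ)) ((S.EG_finite E).image _)
    have f2 := (S.EG_finite E).biUnion fun k hk => ih ((S.t E)⁻¹ * k⁻¹ * S.t E) (by
      rw [← S.src_rev]
      exact S.EG_le _ (S.conj_mem E _ (inv_mem hk)))
    refine (f1.image2 (fun u l => u ++ e E ++ l) f2).subset ?_
    rintro l' ⟨o', hl', e'⟩
    obtain ⟨u', r, o'', rfl, hu', hr⟩ := hl'.exists_tail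
    have hk : (u.prod)⁻¹ * g⁻¹ * u'.prod ∈ S.VG a :=
      mul_mem (mul_mem (inv_mem (hS.mem_VG _ _ _ _ hu)) (inv_mem hg)) (hS.mem_VG _ _ _ _ hu')
    have er : (u.prod)⁻¹ * g⁻¹ * u'.prod * r.prod = (e E ++ l).prod := by
      rw [mul_assoc _ u'.prod, ← List.prod_append, e', List.append_assoc, List.prod_append]
      group
    obtain ⟨rfl, hkE⟩ := hS.eq_of_tail hr h hk (by rw [er]; exact hS.tail_mem_H tl)
    obtain ⟨-, l₁, rfl, hl₁⟩ := hr
    refine ⟨u', ⟨o', _, hu', _, hkE, by group⟩, l₁, Set.mem_biUnion hkE ⟨_, hl₁, ?_⟩, by simp⟩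
    simp only [List.prod_append, hS.prod_e] at er
    rw [← mul_assoc] at er
    have : l.prod = (S.t E)⁻¹ * ((u.prod)⁻¹ * g⁻¹ * u'.prod * S.t E * l₁.prod) := by
      rw [er]; group
    rw [this]
    group

theorem finite_words [Finite 𝓔] [Finite V] (b : V) {Q : Set Γ} (hQ : Q.Finite) :
    {l | ∃ o a, S.SyllableWord M e o a b l ∧ l.prod ∈ Q}.Finite := by
  have : ∀ (a : V) (x : Γ), {l | ∃ o, S.SyllableWord M e o a b l ∧ l.prod = x}.Finite := by
    intro a x
    obtain ⟨l, hl, rfl⟩ := hS.exists_word (S.red_all a x b)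
    simpa using hS.finite_translates hl 1 (one_mem _)
  refine (Set.finite_iUnion fun a => hQ.biUnion fun x _ => this a x).subset ?_
  rintro l ⟨o, a, hl, hq⟩
  exact Set.mem_iUnion.2 ⟨a, Set.mem_biUnion hq ⟨o, hl, rfl⟩⟩

theorem travel_finite {Q Q' : Set Γ} (hQ : Q.Finite) (hQ' : Q'.Finite) :
    ∃ B : Set Γ, B.Finite ∧ ∀ g ∈ Q, ∀ h ∈ Q', ∀ a o₁ o₁' o₂ o₂', ∀ u ∈ M o₁ a o₁',
      ∀ u' ∈ M o₂ a o₂', g ∈ S.VG a → g * u.prod * h = u'.prod → Tr s B g u 1 u' := by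
  obtain ⟨B, hB, h⟩ := exists_finite_of_forall (hQ.prod hQ') (P := fun i B =>
    ∀ a o₁ o₁' o₂ o₂', ∀ u ∈ M o₁ a o₁', ∀ u' ∈ M o₂ a o₂', i.1 ∈ S.VG a →
      i.1 * u.prod * i.2 = u'.prod → Tr s B i.1 u 1 u')
    (fun i B B' hBB h a o₁ o₁' o₂ o₂' u hu u' hu' hg e =>
      (h a o₁ o₁' o₂ o₂' u hu u' hu' hg e).mono hBB) fun i _ => hS.travel i.1 i.2
  exact ⟨B, hB, fun g hg k hk => h (g, k) ⟨hg, hk⟩⟩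

theorem diff_finite {Q Q' : Set Γ} (hQ : Q.Finite) (hQ' : Q'.Finite) :
    ∃ c : ℕ, s = true → ∀ g ∈ Q, ∀ h ∈ Q', ∀ a o₁ o₁' o₂ o₂', ∀ u ∈ M o₁ a o₁',
      ∀ u' ∈ M o₂ a o₂', g ∈ S.VG a → g * u.prod * h = u'.prod →
        u.length ≤ u'.length + c ∧ u'.length ≤ u.length + c := by
  by_cases hs : s = true
  · choose c hc using hS.diff hs
    obtain ⟨N, hN⟩ := ((hQ.prod hQ').image fun i => c i.1 i.2).bddAbove
    refine ⟨N, fun _ g hg h hh a o₁ o₁' o₂ o₂' u hu u' hu' hga e => ?_⟩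
    have h1 := hc g h a o₁ o₁' o₂ o₂' u hu u' hu' hga e
    have h2 : c g h ≤ N := hN ⟨(g, h), ⟨hg, hh⟩, rfl⟩
    omega
  · exact ⟨0, fun h => absurd h hs⟩

theorem letters_word [Finite 𝓔] : ∃ Λ : Set Γ, Λ.Finite ∧
    (∀ o a o', ∀ u ∈ M o a o', ∀ x ∈ u, x ∈ Λ) ∧
    (∀ E, ∀ x ∈ e E, x ∈ Λ) ∧ ∀ o a b l, S.SyllableWord M e o a b l → ∀ x ∈ l, x ∈ Λ := by
  obtain ⟨Λ, hΛ, h⟩ := hS.letters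
  have h1 : ∀ o a o', ∀ u ∈ M o a o', ∀ x ∈ u, x ∈ Λ ∪ ⋃ E, {x | x ∈ e E} :=
    fun o a o' u hu x hx => Or.inl (h o a o' u hu x hx)
  have h2 : ∀ E, ∀ x ∈ e E, x ∈ Λ ∪ ⋃ E, {x | x ∈ e E} :=
    fun E x hx => Or.inr (Set.mem_iUnion.2 ⟨E, hx⟩)
  refine ⟨_, hΛ.union (Set.finite_iUnion fun E => List.finite_toSet (e E)), h1, h2, ?_⟩
  intro o a b l hl
  induction hl with
  | last o hu => exact h1 _ _ _ _ hu
  | step o h hu hred hl ih =>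
    intro x hx
    rcases List.mem_append.1 hx with hx | hx
    · rcases List.mem_append.1 hx with hx | hx
      · exact h1 _ _ _ _ hu x hx
      · exact h2 _ x hx
    · exact ih x hx

/-- Words that differ by right multiplication by `z`, up to an element of the incoming edge group,
fellow travel if they diverge after the first syllable. -/
theorem exists_travel_of_diverge [Finite 𝓔] [Finite V] (z : Γ) (b b' : V) :
    ∃ B : Set Γ, B.Finite ∧ ∀ o o' a o₁ o₁' u u' r r' γ, γ ∈ S.inGroup o → γ ∈ S.VG a →
      u ∈ M o a o₁ → u' ∈ M o' a o₁' → S.Tail M e b a o₁ r → S.Tail M e b' a o₁' r' →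
      γ * (u ++ r).prod * z = (u' ++ r').prod →
      (∀ E, o₁ = some E → o₁' = some E → u.prod⁻¹ * γ⁻¹ * u'.prod ∉ S.EG E) →
      Tr s B γ (u ++ r) 1 (u' ++ r') := by
  obtain ⟨Q, hQ, -, -, hQ2⟩ := S.exists_edge_elements
  -- When the paths diverge, `r.prod` is beyond `E` but `r.prod * z` is not. By `finite_crossing`
  -- this leaves finitely many values, hence finitely many words.
  have tails : ∀ (b b' : V) (z : Γ), ∃ R : Set (List Γ), R.Finite ∧ ∀ a o₁ o₁' r r' k,
      k ∈ S.VG a → S.Tail M e b a o₁ r → S.Tail M e b' a o₁' r' → r.prod * z = k * r'.prod →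
      (∀ E, o₁ = some E → o₁' = some E → k ∉ S.EG E) → r ∈ R := by
    intro b b' z
    have f1 : ∀ E, {l | ∃ o a, S.SyllableWord M e o a b l ∧ l.prod ∈ (fun x => (S.t E)⁻¹ * x) ''
        {x | x ∈ S.H E b ∧ x * z ∉ S.H E b'}}.Finite := fun E =>
      hS.finite_words b ((S.finite_crossing b z b' E).1.image _)
    refine ⟨insert [] (⋃ E, (fun l => e E ++ l) '' _), (Set.finite_iUnion fun E =>
      (f1 E).image _).insert _, ?_⟩
    intro a o₁ o₁' r r' k hk hr hr' he hne
    rcases o₁ with _ | E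
    · exact Or.inl hr.1
    · refine Or.inr (Set.mem_iUnion.2 ⟨E, ?_⟩)
      have h1 := hS.tail_mem_H hr
      have h2 : r.prod * z ∉ S.H E b' := by
        intro h2
        rw [he] at h2
        obtain ⟨rfl, h3⟩ := hS.eq_of_tail hr' hr.1 hk h2
        exact hne E rfl rfl h3
      obtain ⟨-, l, rfl, hl⟩ := hr
      refine ⟨l, ⟨_, _, hl, _, ⟨h1, h2⟩, ?_⟩, rfl⟩
      simp [hS.prod_e]
  obtain ⟨R, hR, h⟩ := tails b b' z
  obtain ⟨R', hR', h'⟩ := tails b' b z⁻¹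
  obtain ⟨B, hB, hT⟩ := hS.travel_finite hQ
    (((hR.image List.prod).mul (Set.finite_singleton z)).mul (hR'.image List.prod).inv)
  obtain ⟨C, hC, hC'⟩ := exists_tr_append_tails s hB (hR.union hR')
  refine ⟨C, hC, fun o o' a o₁ o₁' u u' r r' γ hγ hγa hu hu' hr hr' he hne => ?_⟩
  have hk : u.prod⁻¹ * γ⁻¹ * u'.prod ∈ S.VG a :=
    mul_mem (mul_mem (inv_mem (hS.mem_VG _ _ _ _ hu)) (inv_mem hγa)) (hS.mem_VG _ _ _ _ hu')
  rw [List.prod_append, List.prod_append] at he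
  have e1 : r.prod * z = u.prod⁻¹ * γ⁻¹ * u'.prod * r'.prod := by
    rw [mul_assoc _ u'.prod, ← he]; group
  have m1 := h a o₁ o₁' r r' _ hk hr hr' e1 hne
  have m2 := h' a o₁' o₁ r' r _ (inv_mem hk) hr' hr (by
    rw [← mul_inv_eq_iff_eq_mul] at e1
    rw [← mul_right_inj (u.prod⁻¹ * γ⁻¹ * u'.prod), ← mul_assoc, ← e1]; group) (by
    intro E h1 h2 h3
    exact hne E h2 h1 (by simpa using inv_mem h3))
  refine hC' _ _ _ _ (hT γ (hQ2 o γ hγ) (r.prod * z * r'.prod⁻¹) ?_ a o o₁ o' o₁'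
    u hu u' hu' hγa ?_)
    r (Or.inl m1) r' (Or.inr m2)
  · exact ⟨_, ⟨_, ⟨r, m1, rfl⟩, z, rfl, rfl⟩, _, Set.inv_mem_inv.2 ⟨r', m2, rfl⟩, rfl⟩
  · rw [← mul_inv_eq_iff_eq_mul] at he
    rw [← he]
    group

/-- As long as both words take the same edge with syllables that agree up to the edge groups, the
discrepancy passes to the next vertex as an element of the incoming edge group. By `len` no delay
arises, so one set `B` serves for all lengths. The first divergence is covered by
`exists_travel_of_diverge`. -/
theorem exists_travel_right [Finite 𝓔] [Finite V] (z : Γ) (b b' : V) :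
    ∃ B : Set Γ, B.Finite ∧ ∀ o a l l' γ, γ ∈ S.inGroup o → γ ∈ S.VG a →
      S.SyllableWord M e o a b l → S.SyllableWord M e o a b' l' →
      γ * l.prod * z = l'.prod → Tr s B γ l 1 l' := by
  obtain ⟨Q, hQ, -, hQ1, hQ2⟩ := S.exists_edge_elements
  obtain ⟨B₁, hB₁, h₁⟩ := hS.exists_travel_of_diverge z b b'
  obtain ⟨B₂, hB₂, h₂⟩ := hS.travel_finite hQ hQ
  obtain ⟨B₃, hB₃, h₃⟩ := exists_tr_append_tails s hB₂ (Set.finite_range e)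
  refine ⟨B₁ ∪ B₃, hB₁.union hB₃, fun o a l l' γ hγ hγa hl => ?_⟩
  induction hl generalizing l' γ with
  | @last o a u hu =>
    intro hl' he
    obtain ⟨u', r', o₁', rfl, hu', hr'⟩ := hl'.exists_tail
    have := h₁ o o a none o₁' u u' [] r' γ hγ hγa hu hu' ⟨rfl, rfl⟩ hr' (by simpa using he)
      (by simp)
    rw [List.append_nil] at this
    exact this.mono Set.subset_union_left
  | @step o a b E u l h hu hred hl ih =>
    intro hl' he
    obtain ⟨u', r', o₁', rfl, hu', hr'⟩ := hl'.exists_tail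
    have tl : S.Tail M e b a (some E) (e E ++ l) := ⟨h, l, rfl, hl⟩
    by_cases hc : o₁' = some E ∧ u.prod⁻¹ * γ⁻¹ * u'.prod ∈ S.EG E
    · obtain ⟨rfl, hk⟩ := hc
      obtain ⟨-, l₁, rfl, hl₁⟩ := hr'
      have ek : γ * u.prod * (u.prod⁻¹ * γ⁻¹ * u'.prod) = u'.prod := by group
      have t1 := h₃ _ _ _ _ (h₂ γ (hQ2 _ _ hγ) _ (hQ1 _ _ hk) a o _ o _ u hu u' hu' hγa ek)
        (e E) ⟨E, rfl⟩ (e E) ⟨E, rfl⟩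
      have hk' := S.conj_mem E _ (inv_mem hk)
      have t2 := ih h₁ l₁ _ hk' (by rw [← S.src_rev]; exact S.EG_le _ hk') hl₁ (by
        simp only [List.prod_append, hS.prod_e] at he
        have : l₁.prod = (S.t E)⁻¹ * (u'.prod⁻¹ * (u'.prod * (S.t E * l₁.prod))) := by group
        rw [this, ← he]
        group)
      have t3 := t2.translate (u'.prod * S.t E)
      rw [← List.append_assoc]
      refine (t1.mono Set.subset_union_right).append ?_ fun hs => ?_
      · simp only [List.prod_append, hS.prod_e]
        convert t3 using 1 <;> group
      -- The only use of `len`: both words reach the next vertex at the same time.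
      · rw [List.length_append, List.length_append,
          hS.len hs o a E u hu u' hu' γ hγ hγa _ hk ek]
    · have := h₁ o o a (some E) o₁' u u' _ r' γ hγ hγa hu hu' tl hr' (by
        rw [← he]; simp) (by
        rintro E' h1 h2 h3
        cases h1
        exact hc ⟨h2, h3⟩)
      rw [← List.append_assoc] at this
      exact this.mono Set.subset_union_left

/-- Only the first syllable is compared across `γ`; this may cause a bounded delay, once. The
remainders differ by an edge group element on the left, the case `z = 1` of `exists_travel_right`.
-/
theorem exists_travel_left_vert [Finite 𝓔] [Finite V] (a : V) {γ : Γ} (hγ : γ ∈ S.VG a) :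
    ∃ B : Set Γ, B.Finite ∧ ∀ b o o' l l', S.SyllableWord M e o a b l →
      S.SyllableWord M e o' a b l' → l'.prod = γ * l.prod → Tr s B γ l 1 l' := by
  obtain ⟨Q, hQ, one_Q, hQ1, -⟩ := S.exists_edge_elements
  obtain ⟨Λ, hΛ, hΛ1, hΛ2, hΛ3⟩ := hS.letters_word
  obtain ⟨B₁, hB₁, h₁⟩ := exists_finite_of_forall_finite (ι := V) (P := fun b B =>
    ∀ o a l l' γ, γ ∈ S.inGroup o → γ ∈ S.VG a → S.SyllableWord M e o a b l →
      S.SyllableWord M e o a b l' → γ * l.prod * 1 = l'.prod → Tr s B γ l 1 l')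
    (fun b B B' hBB h o a l l' γ h1 h2 h3 h4 h5 => (h o a l l' γ h1 h2 h3 h4 h5).mono hBB)
    fun b => hS.exists_travel_right 1 b b
  obtain ⟨B₂, hB₂, h₂⟩ := hS.travel_finite (Set.finite_singleton γ) hQ
  obtain ⟨B₃, hB₃, h₃⟩ := exists_tr_append_tails s hB₂ (Set.finite_range e)
  obtain ⟨c, hc⟩ := hS.diff_finite (Set.finite_singleton γ) hQ
  obtain ⟨B₄, hB₄, h₄⟩ := exists_tr_append s hB₃ hB₁ hΛ c
  refine ⟨B₂ ∪ B₄, hB₂.union hB₄, fun b o o' l l' hl hl' he => ?_⟩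
  obtain ⟨u, r, o₁, rfl, hu, hr⟩ := hl.exists_tail
  obtain ⟨u', r', o₁', rfl, hu', hr'⟩ := hl'.exists_tail
  have hk : u.prod⁻¹ * γ⁻¹ * u'.prod ∈ S.VG a :=
    mul_mem (mul_mem (inv_mem (hS.mem_VG _ _ _ _ hu)) (inv_mem hγ)) (hS.mem_VG _ _ _ _ hu')
  rw [List.prod_append, List.prod_append] at he
  have e1 : r.prod = u.prod⁻¹ * γ⁻¹ * u'.prod * r'.prod := by
    rw [mul_assoc _ u'.prod, he]; group
  rcases o₁ with _ | E
  · rcases o₁' with _ | E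
    · obtain ⟨rfl, -⟩ := hr
      obtain ⟨rfl, -⟩ := hr'
      rw [List.append_nil, List.append_nil]
      exact (h₂ γ rfl 1 one_Q a _ _ _ _ u hu u' hu' hγ (by simpa using he.symm)).mono
        Set.subset_union_left
    · have := (hS.eq_of_tail hr hr'.1 (inv_mem hk) (by
        rw [e1, inv_mul_cancel_left]
        exact hS.tail_mem_H hr')).1
      cases this
  · obtain ⟨rfl, hkE⟩ := hS.eq_of_tail hr' hr.1 hk (by
      rw [← e1]
      exact hS.tail_mem_H hr)
    obtain ⟨-, l, rfl, hl₀⟩ := hr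
    obtain ⟨-, l₁, rfl, hl₁⟩ := hr'
    have ek : γ * u.prod * (u.prod⁻¹ * γ⁻¹ * u'.prod) = u'.prod := by group
    have t1 := h₃ _ _ _ _ (h₂ γ rfl _ (hQ1 _ _ hkE) a _ _ _ _ u hu u' hu' hγ ek)
        (e E) ⟨E, rfl⟩ (e E) ⟨E, rfl⟩
    have hk' := S.conj_mem E _ (inv_mem hkE)
    have t2 := h₁ b _ _ l l₁ _ hk' (by rw [← S.src_rev]; exact S.EG_le _ hk') hl₀ hl₁ (by
      simp only [List.prod_append, hS.prod_e] at e1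
      have : l.prod = (S.t E)⁻¹ * (S.t E * l.prod) := by group
      rw [this, e1]
      group)
    have t3 := t2.translate (u'.prod * S.t E)
    rw [← List.append_assoc, ← List.append_assoc]
    refine (h₄ _ _ _ _ _ _ t1 ?_ (fun hs => ?_) (fun x hx => ?_) (fun x hx => ?_)).mono
      Set.subset_union_right
    · simp only [List.prod_append, hS.prod_e]
      convert t3 using 1 <;> group
    · have := hc hs γ rfl _ (hQ1 _ _ hkE) a _ _ _ _ u hu u' hu' hγ ek
      simp only [List.length_append]
      omega
    · rcases List.mem_append.1 hx with hx | hx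
      · rcases List.mem_append.1 hx with hx | hx
        · exact hΛ1 _ _ _ _ hu x hx
        · exact hΛ2 _ x hx
      · exact hΛ3 _ _ _ _ hl₀ x hx
    · rcases List.mem_append.1 hx with hx | hx
      · rcases List.mem_append.1 hx with hx | hx
        · exact hΛ1 _ _ _ _ hu' x hx
        · exact hΛ2 _ x hx
      · exact hΛ3 _ _ _ _ hl₁ x hx

/-- Here `l'` starts with a syllable from the edge group followed by `E`. This prefix is one of
finitely many words, and what follows it differs from `l` by an edge group element. -/
theorem exists_travel_left_t_of_mem [Finite 𝓔] [Finite V] (E : 𝓔) :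
    ∃ B : Set Γ, B.Finite ∧ ∀ b o o' l l', S.SyllableWord M e o (S.tgt E) b l →
      S.SyllableWord M e o' (S.src E) b l' → l'.prod = S.t E * l.prod → l'.prod ∈ S.H E b →
      Tr s B (S.t E) l 1 l' := by
  obtain ⟨Λ, hΛ, -, hΛ2, hΛ3⟩ := hS.letters_word
  obtain ⟨B₁, hB₁, h₁⟩ := exists_finite_of_forall (S.EG_finite (S.rev E)) (P := fun γ B =>
    ∀ b o o' l l', S.SyllableWord M e o (S.tgt E) b l → S.SyllableWord M e o' (S.tgt E) b l' →
      l'.prod = γ * l.prod → Tr s B γ l 1 l')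
    (fun γ B B' hBB h b o o' l l' h1 h2 h3 => (h b o o' l l' h1 h2 h3).mono hBB)
    fun γ hγ => hS.exists_travel_left_vert _ (by rw [← S.src_rev]; exact S.EG_le _ hγ)
  have hR : {u | ∃ o, u ∈ M o (S.src E) (some E) ∧ u.prod ∈ S.EG E}.Finite := by
    refine (Set.finite_iUnion fun o : Option 𝓔 => (S.EG_finite E).biUnion fun g _ =>
      hS.finite o (S.src E) (some E) g).subset ?_
    rintro u ⟨o, hu, hq⟩
    exact Set.mem_iUnion.2 ⟨o, Set.mem_biUnion hq ⟨hu, rfl⟩⟩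
  obtain ⟨B₂, hB₂, h₂⟩ := exists_tr_prefix s (hR.image (· ++ e E)) hΛ
  refine ⟨(B₂ * B₁)⁻¹, (hB₂.mul hB₁).inv, fun b o o' l l' hl hl' he hH => ?_⟩
  obtain ⟨u, r, o₁, rfl, hu, hr⟩ := hl'.exists_tail
  rw [List.prod_append] at he hH
  obtain ⟨rfl, hk⟩ := hS.eq_of_tail hr rfl (hS.mem_VG _ _ _ _ hu) hH
  obtain ⟨-, l₁, rfl, hl₁⟩ := hr
  have t1 := h₂ (u ++ e E) ⟨u, ⟨o', hu, hk⟩, rfl⟩ 1 l₁ (hΛ3 _ _ _ _ hl₁)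
  have t2 := (h₁ _ (S.conj_mem E _ hk) b _ _ l₁ l hl₁ hl (by
    rw [List.prod_append, hS.prod_e] at he
    have : l.prod = (S.t E)⁻¹ * (S.t E * l.prod) := by group
    rw [this, ← he]
    group)).translate (S.t E)
  rw [List.append_assoc, List.prod_append, hS.prod_e, one_mul] at t1
  rw [mul_one, show S.t E * ((S.t E)⁻¹ * u.prod * S.t E) = u.prod * S.t E by group] at t2
  exact (t1.trans t2).symm

/-- If `t E * l` is not beyond `E`, then `l` is beyond `rev E`, and the roles of the two words are
exchanged. -/
theorem exists_travel_left_t [Finite 𝓔] [Finite V] (E : 𝓔) :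
    ∃ B : Set Γ, B.Finite ∧ ∀ b o o' l l', S.SyllableWord M e o (S.tgt E) b l →
      S.SyllableWord M e o' (S.src E) b l' → l'.prod = S.t E * l.prod →
      Tr s B (S.t E) l 1 l' := by
  obtain ⟨B₁, hB₁, h₁⟩ := hS.exists_travel_left_t_of_mem E
  obtain ⟨B₂, hB₂, h₂⟩ := hS.exists_travel_left_t_of_mem (S.rev E)
  rw [S.src_rev, S.tgt_rev] at h₂
  refine ⟨B₁ ∪ B₂⁻¹, hB₁.union hB₂.inv, fun b o o' l l' hl hl' he => ?_⟩
  by_cases hH : l'.prod ∈ S.H E b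
  · exact (h₁ b o o' l l' hl hl' he hH).mono Set.subset_union_left
  · rw [he, S.t_mul_mem_H, not_not] at hH
    have := (h₂ b o' o l' l hl' hl (by rw [he, S.t_rev]; group) hH).symm.translate (S.t E)
    rw [S.t_rev, mul_one, mul_inv_cancel] at this
    exact this.mono Set.subset_union_right

theorem exists_travel_left [Finite 𝓔] [Finite V] (a' : V) (g : Γ) (a : V) :
    ∃ B : Set Γ, B.Finite ∧ ∀ b o o' l l', S.SyllableWord M e o a b l →
      S.SyllableWord M e o' a' b l' → l'.prod = g * l.prod → Tr s B g l 1 l' := by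
  have comp : ∀ a' x a g a₁, (∃ B : Set Γ, B.Finite ∧ ∀ b o o' l l', S.SyllableWord M e o a b l →
      S.SyllableWord M e o' a' b l' → l'.prod = x * l.prod → Tr s B x l 1 l') →
      (∃ B : Set Γ, B.Finite ∧ ∀ b o o' l l', S.SyllableWord M e o a₁ b l →
      S.SyllableWord M e o' a b l' → l'.prod = g * l.prod → Tr s B g l 1 l') →
      (∃ B : Set Γ, B.Finite ∧ ∀ b o o' l l', S.SyllableWord M e o a₁ b l →
      S.SyllableWord M e o' a' b l' → l'.prod = x * g * l.prod → Tr s B (x * g) l 1 l') := by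
    rintro a' x a g a₁ ⟨B, hB, h⟩ ⟨C, hC, h'⟩
    refine ⟨C * B, hC.mul hB, fun b o o' l l' hl hl' he => ?_⟩
    obtain ⟨m, hm, hv⟩ := hS.exists_word (S.red_all a (g * l.prod) b)
    have t1 := (h' b o none l m hl hm hv).translate x
    have t2 := h b none o' m l' hm hl' (by rw [he, hv, mul_assoc])
    rw [mul_one] at t1
    exact t1.trans t2
  refine S.connected (fun a' g a => ∃ B : Set Γ, B.Finite ∧ ∀ b o o' l l',
    S.SyllableWord M e o a b l → S.SyllableWord M e o' a' b l' → l'.prod = g * l.prod →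
      Tr s B g l 1 l') (fun a => ?_) (fun a' x a g h hg => ?_) (fun a' x E h => ?_) a' g a
  · exact hS.exists_travel_left_vert a (one_mem _)
  · exact comp _ _ _ _ _ h (hS.exists_travel_left_vert a hg)
  · exact comp _ _ _ _ _ h (hS.exists_travel_left_t E)

theorem exists_travel [Finite 𝓔] [Finite V] (V₀ : V) (g z : Γ) :
    ∃ B : Set Γ, B.Finite ∧ ∀ b b' l l', S.SyllableWord M e none V₀ b l →
      S.SyllableWord M e none V₀ b' l' → g * l.prod * z = l'.prod → Tr s B g l 1 l' := by
  obtain ⟨B₁, hB₁, h₁⟩ := exists_finite_of_forall_finite (ι := V × V) (P := fun i B =>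
    ∀ o a l l' γ, γ ∈ S.inGroup o → γ ∈ S.VG a → S.SyllableWord M e o a i.1 l →
      S.SyllableWord M e o a i.2 l' → γ * l.prod * z = l'.prod → Tr s B γ l 1 l')
    (fun b B B' hBB h o a l l' γ h1 h2 h3 h4 h5 => (h o a l l' γ h1 h2 h3 h4 h5).mono hBB)
    fun i => hS.exists_travel_right z i.1 i.2
  obtain ⟨B₂, hB₂, h₂⟩ := hS.exists_travel_left V₀ g V₀
  refine ⟨B₁ * B₂, hB₁.mul hB₂, fun b b' l l' hl hl' he => ?_⟩
  obtain ⟨m, hm, hv⟩ := hS.exists_word (S.red_all V₀ (l.prod * z) b')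
  have t1 := (h₁ (b, b') none V₀ l m 1 (one_mem _) (one_mem _) hl hm (by simp [hv])).translate g
  have t2 := h₂ b' none none m l' hm hl' (by rw [hv, ← he, mul_assoc])
  rw [mul_one] at t1
  exact t1.trans t2

/-- A single syllable is a composed word starting at `a`. Changing the start vertex to `V₀` without
changing the value is left travel with factor 1. -/
theorem exists_travel_syllable [Finite 𝓔] [Finite V] (V₀ a : V) :
    ∃ B : Set Γ, B.Finite ∧ ∀ b l u, S.SyllableWord M e none V₀ b l → u ∈ M none a none →
      l.prod = u.prod → Tr s B 1 l 1 u := by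
  obtain ⟨B₁, hB₁, h₁⟩ := hS.exists_travel V₀ 1 1
  obtain ⟨B₂, hB₂, h₂⟩ := hS.exists_travel_left V₀ 1 a
  refine ⟨B₁ * B₂⁻¹, hB₁.mul hB₂.inv, fun b l u hl hu he => ?_⟩
  obtain ⟨m, hm, hv⟩ := hS.exists_word (S.red_all V₀ u.prod a)
  have t1 := h₁ b a l m hl hm (by rw [hv, he]; group)
  exact t1.trans (h₂ a none none u m (.last _ hu) hm (by rw [hv, one_mul])).symm

end Splitting.Syllables

end Compose

/-! ### Padding words to a length that depends only on the double coset. -/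

section Padding

open Pointwise

variable {G : Type u} [Group G]

/-- An automaton reads `l`, guesses the letters of `m` in step with it and stores the difference of
the two paths. By synchronous travel this difference stays in a finite set, so that finitely many
states suffice. -/
theorem isRegular_longer {α : Type v} {ev : α → G} {M : Language α} (hM : M.IsRegular)
    {B : Set G} (hB : B.Finite) {g h : G} (hT : ∀ l ∈ M, ∀ m ∈ M,
      g * (l.map ev).prod * h = (m.map ev).prod → STrav B g (l.map ev) 1 (m.map ev)) (j : ℕ) :
    Language.IsRegular ({l | l ∈ M ∧ ∃ m ∈ M, g * (l.map ev).prod * h = (m.map ev).prod ∧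
      m.length = l.length + j} : Language α) := by
  obtain ⟨σ, _, A, hA⟩ := hM.exists_dfa
  -- The initial difference is `g⁻¹`; inserting it provides a start state even if no pair of words
  -- satisfies the relation.
  have := (hB.insert g⁻¹).to_subtype
  let R : σ × σ × ↑(insert g⁻¹ B) → α → σ × σ × ↑(insert g⁻¹ B) → Prop := fun p x q =>
    A.step p.1 x = q.1 ∧ ∃ y, A.step p.2.1 y = q.2.1 ∧ (q.2.2 : G) = (ev x)⁻¹ * p.2.2 * ev y
  have fwd : ∀ l p q, Run R p l q → A.evalFrom p.1 l = q.1 ∧ ∃ m : List α, m.length = l.length ∧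
      A.evalFrom p.2.1 m = q.2.1 ∧ (q.2.2 : G) = (l.map ev).prod⁻¹ * p.2.2 * (m.map ev).prod := by
    intro l
    induction l with
    | nil =>
      rintro p q rfl
      exact ⟨rfl, [], rfl, rfl, by simp⟩
    | cons a l ih =>
      rintro p q ⟨r, ⟨h1, y, h2, h3⟩, h4⟩
      obtain ⟨h5, m, h6, h7, h8⟩ := ih r q h4
      refine ⟨?_, y :: m, by simp [h6], ?_, ?_⟩
      · rw [DFA.evalFrom_cons, h1, h5]
      · rw [DFA.evalFrom_cons, h2, h7]
      · rw [h8, h3]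
        simp [mul_assoc]
  have bwd : ∀ (l m : List α) p, m.length = l.length →
      (∀ t, ((l.take t).map ev).prod⁻¹ * p.2.2 * ((m.take t).map ev).prod ∈ insert g⁻¹ B) →
      ∃ d : ↑(insert g⁻¹ B), (d : G) = (l.map ev).prod⁻¹ * p.2.2 * (m.map ev).prod ∧
        Run R p l (A.evalFrom p.1 l, A.evalFrom p.2.1 m, d) := by
    intro l
    induction l with
    | nil =>
      intro m p hm _
      obtain rfl : m = [] := by simpa using hm
      exact ⟨p.2.2, by simp, rfl⟩
    | cons a l ih =>
      intro m p hm ht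
      rcases m with _ | ⟨y, m⟩
      · simp at hm
      have h1 := ht 1
      obtain ⟨d, hd, hr⟩ := ih m (A.step p.1 a, A.step p.2.1 y, ⟨_, h1⟩) (by simpa using hm)
        fun t => by simpa [mul_assoc] using ht (t + 1)
      refine ⟨d, ?_, _, ⟨rfl, y, rfl, ?_⟩, hr⟩
      · simp [hd, mul_assoc]
      · simp
  refine (isRegular_setOf_run R {(A.start, A.start, ⟨g⁻¹, Or.inl rfl⟩)} {q | q.1 ∈ A.accept ∧
    ∃ v : List α, v.length = j ∧ A.evalFrom q.2.1 v ∈ A.accept ∧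
      (q.2.2 : G) * (v.map ev).prod = h}).of_iff fun l => ?_
  constructor
  · rintro ⟨hl, m, hm, he, hj⟩
    have hmt : m.take l.length ++ m.drop l.length = m := List.take_append_drop _ _
    obtain ⟨d, hd, hr⟩ := bwd l (m.take l.length) (A.start, A.start, ⟨g⁻¹, Or.inl rfl⟩)
      (by rw [List.length_take]; omega) fun t => by
        rcases le_total t l.length with ht | ht
        · have := hT l hl m hm he t
          rw [List.take_take, min_eq_left ht]
          right
          simpa [List.map_take, mul_assoc] using this
        · have := hT l hl m hm he l.length
          rw [List.take_take, min_eq_right ht, List.take_of_length_le ht]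
          right
          rw [List.take_of_length_le (by simp), ← List.map_take] at this
          simpa [mul_assoc] using this
    refine ⟨_, rfl, _, ⟨(hA l).1 hl, m.drop l.length, by rw [List.length_drop]; omega, ?_, ?_⟩, hr⟩
    · rw [← DFA.evalFrom_of_append, hmt]
      exact (hA m).1 hm
    · simp only [hd]
      rw [mul_assoc _ (List.prod _), ← List.prod_append, ← List.map_append, hmt, ← he]
      group
  · rintro ⟨_, rfl, q, ⟨h1, v, h2, h3, h4⟩, hr⟩
    obtain ⟨h5, m, h6, h7, h8⟩ := fwd l _ _ hr
    refine ⟨(hA l).2 (by rwa [← h5] at h1), m ++ v, (hA _).2 ?_, ?_, by simp [h6, h2]⟩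
    · rw [DFA.evalFrom_of_append]
      dsimp only at h7
      rwa [h7]
    · rw [← h4, h8, List.map_append, List.prod_append]
      group

/-- The words of a biautomatic structure can be padded so that the length of a word depends only
on its double coset with respect to two given finite subgroups. -/
theorem exists_padded {s : Bool} (M : AsyncAutStruct G) (hb : M.IsBi s) (F₁ F₂ : Subgroup G)
    (h₁ : (F₁ : Set G).Finite) (h₂ : (F₂ : Set G).Finite) :
    ∃ (N : Language (Option M.alph.Letter)) (c : ℕ), N.IsRegular ∧
      (∀ w ∈ N, ∃ l ∈ M.lang, ∃ j ≤ c, w = l.map some ++ List.replicate j none) ∧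
      (∀ l ∈ M.lang, ∃ j, l.map some ++ List.replicate j none ∈ N) ∧
      (s = true → ∀ l ∈ M.lang, ∀ l' ∈ M.lang, ∀ j j', l.map some ++ List.replicate j none ∈ N →
        l'.map some ++ List.replicate j' none ∈ N → ∀ g ∈ F₁, ∀ h ∈ F₂,
          g * M.alph.val l * h = M.alph.val l' → l.length + j = l'.length + j') := by
  classical
  cases s
  -- Asynchronous travel imposes no condition on lengths, so no padding is needed.
  · refine ⟨_, 0, M.isRegular.image_map some, ?_, fun l hl => ⟨0, l, hl, by simp⟩, by simp⟩
    rintro w ⟨l, hl, rfl⟩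
    exact ⟨l, hl, 0, le_rfl, by simp⟩
  obtain ⟨B, hB, hT⟩ := BiTr.finite hb h₁ h₂
  obtain ⟨c, hc⟩ := exists_length_le M.isRegular M.isFiniteToOne hB h₂
  let Rel : List M.alph.Letter → List M.alph.Letter → Prop := fun l m =>
    ∃ g ∈ F₁, ∃ h ∈ F₂, g * M.alph.val l * h = M.alph.val m
  have rel_refl : ∀ l, Rel l l := fun l => ⟨1, one_mem _, 1, one_mem _, by simp⟩
  have rel_symm : ∀ l m, Rel l m → Rel m l := by
    rintro l m ⟨g, hg, h, hh, e⟩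
    exact ⟨g⁻¹, inv_mem hg, h⁻¹, inv_mem hh, by rw [← e]; group⟩
  have rel_trans : ∀ l m n, Rel l m → Rel m n → Rel l n := by
    rintro l m n ⟨g, hg, h, hh, e⟩ ⟨g', hg', h', hh', e'⟩
    exact ⟨g' * g, mul_mem hg' hg, h * h', mul_mem hh hh', by rw [← e', ← e]; group⟩
  have rel_le : ∀ l ∈ M.lang, ∀ m ∈ M.lang, Rel l m → m.length ≤ l.length + c := by
    rintro l hl m hm ⟨g, hg, h, hh, e⟩
    exact hc g h l m hm hh e (hT g hg h hh l hl m hm e)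
  let U : ℕ → Language M.alph.Letter := fun j =>
    {l | l ∈ M.lang ∧ ∃ m ∈ M.lang, Rel l m ∧ m.length = l.length + j}
  have hU : ∀ j, (U j).IsRegular := by
    intro j
    have := h₁.to_subtype
    have := h₂.to_subtype
    refine (Language.isRegular_iUnion fun i : F₁ × F₂ => isRegular_longer M.isRegular hB
      (hT i.1 i.1.2 i.2 i.2.2) j).of_iff fun l => ?_
    constructor
    · rintro ⟨hl, m, hm, ⟨g, hg, h, hh, e⟩, hj⟩
      exact ⟨(⟨g, hg⟩, ⟨h, hh⟩), hl, m, hm, e, hj⟩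
    · rintro ⟨i, hl, m, hm, e, hj⟩
      exact ⟨hl, m, hm, ⟨i.1, i.1.2, i.2, i.2.2, e⟩, hj⟩
  have hUc : ∀ j l, l ∈ U j → j ≤ c := by
    rintro j l ⟨hl, m, hm, hr, hj⟩
    have := rel_le l hl m hm hr
    omega
  -- Words that fall short of the longest word in their double coset by exactly `j`. This `j` is the
  -- amount of padding; it is at most `c`, because related words travel synchronously.
  let D : ℕ → Language M.alph.Letter := fun j => {l | l ∈ U j ∧ ∀ i, j < i → l ∉ U i}
  have hD : ∀ j, (D j).IsRegular := by
    intro j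
    refine ((hU j).diff (Language.isRegular_iUnion fun i : Fin c => hU (j + 1 + i))).of_iff
      fun l => ?_
    constructor
    · rintro ⟨hl, h⟩
      refine ⟨hl, ?_⟩
      rintro ⟨i, hi⟩
      exact h _ (by omega) hi
    · rintro ⟨hl, h⟩
      refine ⟨hl, fun i hi hl' => h ⟨⟨i - (j + 1), ?_⟩, ?_⟩⟩
      · have := hUc i l hl'
        omega
      · rwa [show j + 1 + (i - (j + 1)) = i by omega]
  have hP : ∀ j k, Language.IsRegular ({w | ∃ l ∈ D j, l.map some ++ List.replicate k none = w} :
      Language (Option M.alph.Letter)) := by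
    intro j k
    induction k with
    | zero => simpa using (hD j).image_map some
    | succ k ih =>
      refine (ih.concat none).of_iff fun w => ?_
      constructor
      · rintro ⟨l, hl, rfl⟩
        exact ⟨_, ⟨l, hl, rfl⟩, by simp [List.replicate_succ']⟩
      · rintro ⟨_, ⟨l, hl, rfl⟩, rfl⟩
        exact ⟨l, hl, by simp [List.replicate_succ']⟩
  have key : ∀ (l l' : List M.alph.Letter) (j j' : ℕ),
      l.map some ++ List.replicate j none = l'.map some ++ List.replicate j' none →
      l = l' ∧ j = j' := by
    intro l l' j j' h
    have h1 : l = l' := by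
      simpa [List.filterMap_append, List.filterMap_map] using congrArg (List.filterMap id) h
    subst h1
    exact ⟨rfl, by simpa using congrArg List.length h⟩
  refine ⟨{w | ∃ j : Fin (c + 1), w ∈ ({w | ∃ l ∈ D j, l.map some ++ List.replicate j none = w} :
    Set (List (Option M.alph.Letter)))}, c,
    Language.isRegular_iUnion fun j : Fin (c + 1) => hP j j, ?_, ?_, ?_⟩
  · rintro w ⟨j, l, hl, rfl⟩
    exact ⟨l, hl.1.1, j, by omega, rfl⟩
  · intro l hl
    have h0 : l ∈ U 0 := ⟨hl, l, hl, rel_refl l, rfl⟩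
    have h1 : l ∈ U (Nat.findGreatest (fun j => l ∈ U j) c) :=
      Nat.findGreatest_spec (P := fun j => l ∈ U j) (Nat.zero_le c) h0
    refine ⟨_, ⟨Nat.findGreatest (fun j => l ∈ U j) c, Nat.lt_succ_of_le (hUc _ _ h1)⟩, l,
      ⟨h1, fun i hi hl' => ?_⟩, rfl⟩
    exact absurd (Nat.le_findGreatest (P := fun j => l ∈ U j) (hUc _ _ hl') hl') (not_le.2 hi)
  · rintro - l hl l' hl' j j' ⟨k, l₁, hl₁, e⟩ ⟨k', l₁', hl₁', e'⟩ g hg h hh he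
    obtain ⟨rfl, rfl⟩ := key _ _ _ _ e
    obtain ⟨rfl, rfl⟩ := key _ _ _ _ e'
    -- A longest word of the double coset of `l` also competes for `l'`, so the two padded lengths
    -- agree.
    have le : ∀ l l' j j', l ∈ D j → l' ∈ D j' → Rel l l' → l.length + j ≤ l'.length + j' := by
      rintro l l' j j' hl hl' hr
      obtain ⟨⟨h1, m, hm, h2, h3⟩, -⟩ := hl
      by_contra hlt
      have h4 : l' ∈ U (m.length - l'.length) :=
        ⟨hl'.1.1, m, hm, rel_trans _ _ _ (rel_symm _ _ hr) h2, by omega⟩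
      exact hl'.2 _ (by omega) h4
    have hr : Rel l₁ l₁' := ⟨g, hg, h, hh, he⟩
    exact le_antisymm (le _ _ _ _ hl₁ hl₁' hr) (le _ _ _ _ hl₁' hl₁ (rel_symm _ _ hr))

end Padding

/-! ### Combination of structures on the vertex groups. -/

section Composite

open Pointwise

variable {Γ : Type u} [Group Γ] {V : Type v} {𝓔 : Type w}

/-- Concatenations of words from the languages `N o a o'` along paths that end at `b`. -/
inductive Splitting.Composite (S : Splitting Γ V 𝓔) {α : Type x}
    (N : Option 𝓔 → V → Option 𝓔 → Language α) (sep : 𝓔 → α) (b : V) :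
    Option 𝓔 → V → List α → Prop
  | last {o : Option 𝓔} {u : List α} (hu : u ∈ N o b none) : Composite S N sep b o b u
  | step {o : Option 𝓔} {a : V} {E : 𝓔} {u l : List α} (h : S.src E = a) (hu : u ∈ N o a (some E))
      (hl : Composite S N sep b (some E) (S.tgt E) l) : Composite S N sep b o a (u ++ sep E :: l)

/-- A state consists of the incoming edge, the vertex, a guess of the outgoing edge and a state of
the automaton for this syllable. A separator confirms the guess and starts the next syllable with a
new guess. -/
theorem Splitting.isRegular_composite [Finite V] [Finite 𝓔] (S : Splitting Γ V 𝓔) {α : Type x}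
    {N : Option 𝓔 → V → Option 𝓔 → Language α} (sep : 𝓔 → α)
    (hN : ∀ o a o', (N o a o').IsRegular) (b : V) (o : Option 𝓔) (a : V) :
    Language.IsRegular ({w | S.Composite N sep b o a w} : Language α) := by
  choose σ fσ A hA using fun o a o' => (hN o a o').exists_dfa
  let Q := Σ i : Option 𝓔 × V × Option 𝓔, σ i.1 i.2.1 i.2.2
  let R : Q → α → Q → Prop := fun p x q =>
    (∃ i q', p = ⟨i, q'⟩ ∧ q = ⟨i, (A i.1 i.2.1 i.2.2).step q' x⟩) ∨
    ∃ o a E q' o'', S.src E = a ∧ q' ∈ (A o a (some E)).accept ∧ x = sep E ∧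
      p = ⟨(o, a, some E), q'⟩ ∧ q = ⟨(some E, S.tgt E, o''), (A _ _ _).start⟩
  have inner : ∀ (u : List α) i q, Run R ⟨i, q⟩ u ⟨i, (A i.1 i.2.1 i.2.2).evalFrom q u⟩ := by
    intro u
    induction u with
    | nil => intro i q; rfl
    | cons x u ih => exact fun i q => ⟨_, Or.inl ⟨i, q, rfl, rfl⟩, ih _ _⟩
  let F : Set Q := {t | ∃ o, ∃ q ∈ (A o b none).accept, t = ⟨(o, b, none), q⟩}
  have fwd : ∀ o a w, S.Composite N sep b o a w →
      ∃ o', ∃ t ∈ F, Run R ⟨(o, a, o'), (A o a o').start⟩ w t := by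
    intro o a w h
    induction h with
    | @last o u hu =>
      exact ⟨none, _, ⟨o, _, (hA _ _ _ u).1 hu, rfl⟩, inner u (o, b, none) _⟩
    | @step o a E u l h hu hl ih =>
      obtain ⟨o'', t, ht, hr⟩ := ih
      exact ⟨some E, t, ht, run_append.2 ⟨_, inner u (o, a, some E) _, _,
        Or.inr ⟨o, a, E, _, o'', h, (hA _ _ _ u).1 hu, rfl, rfl, rfl⟩, hr⟩⟩
  have bwd : ∀ (w : List α) o a o' (q : σ o a o') t, t ∈ F → Run R ⟨(o, a, o'), q⟩ w t →
      (o' = none ∧ a = b ∧ (A o a o').evalFrom q w ∈ (A o a o').accept) ∨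
      ∃ E u l, o' = some E ∧ S.src E = a ∧ w = u ++ sep E :: l ∧
        (A o a o').evalFrom q u ∈ (A o a o').accept ∧
        S.Composite N sep b (some E) (S.tgt E) l := by
    intro w
    induction w with
    | nil =>
      rintro o a o' q t ⟨o₁, q₁, hq, rfl⟩ h
      cases h
      exact Or.inl ⟨rfl, rfl, hq⟩
    | cons x w ih =>
      rintro o a o' q t ht ⟨r, hr | hr, h⟩
      · obtain ⟨i, q', e, rfl⟩ := hr
        cases e
        rcases ih o a o' _ t ht h with h | ⟨E, u, l, h1, h2, rfl, h3, h4⟩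
        · exact Or.inl h
        · exact Or.inr ⟨E, x :: u, l, h1, h2, rfl, h3, h4⟩
      · obtain ⟨o₁, a₁, E, q', o'', h1, h2, rfl, e, rfl⟩ := hr
        cases e
        refine Or.inr ⟨E, [], w, rfl, h1, rfl, h2, ?_⟩
        rcases ih _ _ _ _ t ht h with ⟨rfl, rfl, h3⟩ | ⟨E', u, l, rfl, h3, rfl, h4, h5⟩
        · exact .last ((hA _ _ _ w).2 h3)
        · exact .step h3 ((hA _ _ _ u).2 h4) h5
  refine (isRegular_setOf_run R {p | ∃ o', p = ⟨(o, a, o'), (A o a o').start⟩} F).of_iff fun w => ?_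
  constructor
  · intro h
    obtain ⟨o', t, ht, hr⟩ := fwd o a w h
    exact ⟨_, ⟨o', rfl⟩, t, ht, hr⟩
  · rintro ⟨_, ⟨o', rfl⟩, t, ht, hr⟩
    rcases bwd w _ _ _ _ t ht hr with ⟨rfl, rfl, h3⟩ | ⟨E', u, l, rfl, h3, rfl, h4, h5⟩
    · exact Splitting.Composite.last ((hA _ _ _ w).2 h3)
    · exact Splitting.Composite.step h3 ((hA _ _ _ u).2 h4) h5

theorem finite_preimage_map {α : Type v} {β : Type w} [Finite α] (f : α → β) {F : Set (List β)}
    (hF : F.Finite) : {w : List α | w.map f ∈ F}.Finite := by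
  obtain ⟨N, hN⟩ := (hF.image List.length).bddAbove
  refine (List.finite_length_le α N).subset fun w hw => ?_
  have := hN ⟨_, hw, rfl⟩
  simpa using this

/-- A two-sided fellow travelling regular language over any finite set of letters gives a
structure with the same paths. -/
theorem exists_asyncAutStruct {s : Bool} {α : Type v} [Finite α] (ev : α → Γ) {L : Language α}
    (hL : L.IsRegular) (onto : ∀ g, ∃ l ∈ L, (l.map ev).prod = g) (hf : FinToOne ev L)
    (hb : BiTr s ev L ev L) :
    ∃ K : AsyncAutStruct Γ, K.IsBi s ∧ ∀ k ∈ K.lang, ∃ l ∈ L, k.map K.alph.ev = l.map ev := by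
  obtain ⟨n, ⟨φ⟩⟩ := Finite.exists_equiv_fin α
  -- The Boolean adjoins formal inverses, required of an alphabet; words of the language use only
  -- the letters marked `true`.
  let ev' : Fin n × Bool → Γ := fun x => if x.2 then ev (φ.symm x.1) else (ev (φ.symm x.1))⁻¹
  let j : α → Fin n × Bool := fun x => (φ x, true)
  have hj : ∀ l : List α, (l.map j).map ev' = l.map ev := fun l => by
    simp [j, ev', Function.comp_def]
  let L' : Language (Fin n × Bool) := {w | ∃ l ∈ L, l.map j = w}
  have onto' : ∀ g, ∃ l ∈ L', (l.map ev').prod = g := by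
    intro g
    obtain ⟨l, hl, rfl⟩ := onto g
    exact ⟨_, ⟨l, hl, rfl⟩, by rw [hj]⟩
  let A : Alphabet Γ :=
    { Letter := Fin n × Bool
      finite_letter := inferInstance
      inv := fun x => (x.1, !x.2)
      inv_inv := fun x => by simp
      ev := ev'
      ev_inv := fun x => by rcases x with ⟨x, _ | _⟩ <;> simp [ev']
      onto := fun g => by
        obtain ⟨l, -, h⟩ := onto' g
        exact ⟨l, h⟩ }
  have hb' : BiTr s A.ev L' A.ev L' := by
    intro g h
    obtain ⟨B, hB, hT⟩ := hb g h
    refine ⟨B, hB, ?_⟩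
    rintro _ ⟨l, hl, rfl⟩ _ ⟨m, hm, rfl⟩ e
    change g * (List.map ev' _).prod * h = (List.map ev' _).prod at e
    change Tr s B g (List.map ev' _) 1 (List.map ev' _)
    rw [hj, hj] at e ⊢
    exact hT l hl m hm e
  have hf' : A.IsFiniteToOne L' := by
    intro g
    refine ((hf g).image (List.map j)).subset ?_
    rintro _ ⟨⟨l, hl, rfl⟩, h⟩
    refine ⟨l, ⟨hl, ?_⟩, rfl⟩
    rw [← hj]
    exact h
  refine ⟨AsyncAutStruct.ofBiTr A L' (hL.image_map j) onto' hf' hb', hb', ?_⟩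
  rintro _ ⟨l, hl, rfl⟩
  exact ⟨l, hl, hj l⟩

/-- The subgroup that stabilizes the outgoing edge. -/
def Splitting.outGroup (S : Splitting Γ V 𝓔) : Option 𝓔 → Subgroup Γ
  | none => ⊥
  | some E => S.EG E

theorem Splitting.inGroup_finite (S : Splitting Γ V 𝓔) (o : Option 𝓔) :
    (S.inGroup o : Set Γ).Finite := by
  cases o with
  | none => simp [inGroup]
  | some E => exact S.EG_finite _

theorem Splitting.outGroup_finite (S : Splitting Γ V 𝓔) (o : Option 𝓔) :
    (S.outGroup o : Set Γ).Finite := by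
  cases o with
  | none => simp [outGroup]
  | some E => exact S.EG_finite _

theorem exists_forall_le_of_finite {ι : Type v} [Finite ι] (f : ι → ℕ) : ∃ c, ∀ i, f i ≤ c := by
  obtain ⟨c, hc⟩ := (Set.finite_range f).bddAbove
  exact ⟨c, fun i => hc ⟨i, rfl⟩⟩

variable {H : V → Type y} [∀ a, Group (H a)]

/-- The value of a possibly empty letter of a vertex group. -/
def padEv (i : ∀ a, H a →* Γ) (M : ∀ a, AsyncAutStruct (H a)) (a : V) :
    Option (M a).alph.Letter → Γ
  | none => 1
  | some x => i a ((M a).alph.ev x)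

/-- The words of each vertex group are padded separately for every pair of incoming and outgoing
edges, with respect to the edge groups at this pair. As there are finitely many pairs, the padding
is uniformly bounded and disturbs travel between different pairs only boundedly. -/
theorem exists_syllables [Finite V] [Finite 𝓔] (S : Splitting Γ V 𝓔) {s : Bool}
    {i : ∀ a, H a →* Γ} (hi : ∀ a, Function.Injective (i a)) (hr : ∀ a, (i a).range = S.VG a)
    (M : ∀ a, AsyncAutStruct (H a)) (hb : ∀ a, (M a).IsBi s) :
    ∃ N : ∀ (_ : Option 𝓔) (a : V) (_ : Option 𝓔), Language (Option (M a).alph.Letter),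
      (∀ o a o', (N o a o').IsRegular) ∧
      (∃ c : ℕ, ∀ o a o', ∀ l ∈ (M a).lang, ∃ j ≤ c,
        l.map some ++ List.replicate j none ∈ N o a o') ∧
      S.Syllables s (fun o a o' => {l | ∃ w ∈ N o a o', w.map (padEv i M a) = l})
        (fun E => [S.t E]) := by
  choose N c hreg hform honto hlen using fun (o : Option 𝓔) (a : V) (o' : Option 𝓔) =>
    exists_padded (M a) (hb a) ((S.inGroup o).comap (i a)) ((S.outGroup o').comap (i a))
      (Set.Finite.preimage (f := i a) (hi a).injOn (S.inGroup_finite o))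
      (Set.Finite.preimage (f := i a) (hi a).injOn (S.outGroup_finite o'))
  obtain ⟨C, hC⟩ := exists_forall_le_of_finite fun p : Option 𝓔 × V × Option 𝓔 => c p.1 p.2.1 p.2.2
  have hmap : ∀ a (l : List (M a).alph.Letter) j,
      (l.map some ++ List.replicate j none).map (padEv i M a) =
        (l.map (M a).alph.ev).map (i a) ++ List.replicate j 1 := by
    intro a l j
    simp [padEv]
  have hprod : ∀ a (l : List (M a).alph.Letter) j,
      ((l.map (M a).alph.ev).map (i a) ++ List.replicate j 1).prod = i a ((M a).alph.val l) := by
    intro a l j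
    simp [Alphabet.val_eq, map_list_prod]
  have form : ∀ o a o' u, (∃ w ∈ N o a o', w.map (padEv i M a) = u) → ∃ l ∈ (M a).lang, ∃ j ≤ C,
      u = (l.map (M a).alph.ev).map (i a) ++ List.replicate j 1 ∧
      l.map some ++ List.replicate j none ∈ N o a o' := by
    rintro o a o' u ⟨w, hw, rfl⟩
    obtain ⟨l, hl, j, hj, rfl⟩ := hform _ _ _ _ hw
    exact ⟨l, hl, j, hj.trans (hC (o, a, o')), hmap a l j, hw⟩
  have hR : ((fun j => List.replicate j (1 : Γ)) '' {j | j ≤ C}).Finite :=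
    (Set.finite_le_nat C).image _
  have mem : ∀ a g h (l l' : List (M a).alph.Letter), g ∈ S.VG a →
      g * i a ((M a).alph.val l) * h = i a ((M a).alph.val l') →
      ∃ g' h', i a g' = g ∧ i a h' = h ∧ g' * (M a).alph.val l * h' = (M a).alph.val l' := by
    intro a g h l l' hg he
    rw [← hr] at hg
    obtain ⟨g', rfl⟩ := hg
    refine ⟨g', (g' * (M a).alph.val l)⁻¹ * (M a).alph.val l', rfl, ?_, by group⟩
    rw [map_mul, ← he]
    simp
    group
  refine ⟨N, hreg, ⟨C, fun o a o' l hl => ?_⟩, ?_, ?_, ?_, ?_, ?_, ?_, ?_, ?_⟩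
  · obtain ⟨j, hj⟩ := honto o a o' l hl
    obtain ⟨l', hl', j', hj', e⟩ := hform _ _ _ _ hj
    have e1 : l = l' := by
      simpa [List.filterMap_append, List.filterMap_map] using congrArg (List.filterMap id) e
    subst e1
    have e2 : j = j' := by simpa using congrArg List.length e
    subst e2
    exact ⟨j, hj'.trans (hC (o, a, o')), hj⟩
  · simp
  · intro o a o' u hu
    obtain ⟨l, hl, j, -, rfl, -⟩ := form o a o' u hu
    rw [hprod, ← hr]
    exact ⟨_, rfl⟩
  · intro o a o' g hg
    rw [← hr] at hg
    obtain ⟨g, rfl⟩ := hg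
    obtain ⟨l, hl, rfl⟩ := (M a).isNormalForm g
    obtain ⟨j, hj⟩ := honto o a o' l hl
    exact ⟨_, ⟨_, hj, rfl⟩, by rw [hmap, hprod]⟩
  · intro o a o' g
    have hf : {l | l ∈ (M a).lang ∧ i a ((M a).alph.val l) = g}.Finite := by
      by_cases hg : g ∈ (i a).range
      · obtain ⟨g, rfl⟩ := hg
        refine ((M a).isFiniteToOne g).subset ?_
        rintro l ⟨hl, h⟩
        exact ⟨hl, hi a h⟩
      · refine Set.finite_empty.subset ?_
        rintro l ⟨hl, rfl⟩
        exact hg ⟨_, rfl⟩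
    refine (hf.image2 (fun (l : List (M a).alph.Letter) j => (l.map (M a).alph.ev).map (i a) ++
      List.replicate j (1 : Γ)) (Set.finite_le_nat C)).subset ?_
    rintro u ⟨hu, hp⟩
    obtain ⟨l, hl, j, hj, rfl, -⟩ := form o a o' u hu
    rw [hprod] at hp
    exact ⟨l, ⟨hl, hp⟩, j, hj, rfl⟩
  · intro g h
    have key : ∀ a, ∃ B : Set Γ, B.Finite ∧ ∀ o₁ o₁' o₂ o₂', ∀ u,
        (∃ w ∈ N o₁ a o₁', w.map (padEv i M a) = u) → ∀ u',
        (∃ w ∈ N o₂ a o₂', w.map (padEv i M a) = u') → g ∈ S.VG a →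
        g * u.prod * h = u'.prod → Tr s B g u 1 u' := by
      intro a
      -- If `g` and `h` do not both come from the vertex group at `a`, no pair of syllables
      -- satisfies the relation and the empty set works.
      by_cases hgh : ∃ g' h', i a g' = g ∧ i a h' = h
      · obtain ⟨g', h', rfl, rfl⟩ := hgh
        obtain ⟨B, hB, hT⟩ := hb a g' h'
        obtain ⟨B', hB', hT'⟩ := exists_tr_append_tails s (hB.image (i a)) hR
        refine ⟨B', hB', fun o₁ o₁' o₂ o₂' u hu u' hu' hg e => ?_⟩
        obtain ⟨l, hl, j, hj, rfl, -⟩ := form _ a _ u hu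
        obtain ⟨l', hl', j', hj', rfl, -⟩ := form _ a _ u' hu'
        rw [hprod, hprod, ← map_mul, ← map_mul] at e
        have := (hT l hl l' hl' (hi a e)).map (i a)
        rw [map_one] at this
        exact hT' _ _ _ _ this _ ⟨j, hj, rfl⟩ _ ⟨j', hj', rfl⟩
      · refine ⟨∅, Set.finite_empty, fun o₁ o₁' o₂ o₂' u hu u' hu' hg e => ?_⟩
        obtain ⟨l, hl, j, hj, rfl, -⟩ := form _ a _ u hu
        obtain ⟨l', hl', j', hj', rfl, -⟩ := form _ a _ u' hu'
        rw [hprod, hprod] at e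
        obtain ⟨g', h', e1, e2, -⟩ := mem a g h l l' hg e
        exact absurd ⟨g', h', e1, e2⟩ hgh
    obtain ⟨B, hB, hT⟩ := exists_finite_of_forall_finite (ι := V) (P := fun a B =>
      ∀ o₁ o₁' o₂ o₂', ∀ u, (∃ w ∈ N o₁ a o₁', w.map (padEv i M a) = u) → ∀ u',
        (∃ w ∈ N o₂ a o₂', w.map (padEv i M a) = u') → g ∈ S.VG a →
        g * u.prod * h = u'.prod → Tr s B g u 1 u')
      (fun a B B' hBB h o₁ o₁' o₂ o₂' u hu u' hu' hg e =>
        (h o₁ o₁' o₂ o₂' u hu u' hu' hg e).mono hBB) key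
    exact ⟨B, hB, hT⟩
  · rintro rfl g h
    have key : ∀ a, ∃ c : ℕ, ∀ l ∈ (M a).lang, ∀ l' ∈ (M a).lang, g ∈ S.VG a →
        g * i a ((M a).alph.val l) * h = i a ((M a).alph.val l') →
        l.length ≤ l'.length + c ∧ l'.length ≤ l.length + c := by
      intro a
      by_cases hgh : ∃ g' h', i a g' = g ∧ i a h' = h
      · obtain ⟨g', h', rfl, rfl⟩ := hgh
        have one : ∀ g' h', ∃ c : ℕ, ∀ l ∈ (M a).lang, ∀ l' ∈ (M a).lang,
            g' * (M a).alph.val l * h' = (M a).alph.val l' → l'.length ≤ l.length + c := by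
          intro g' h'
          obtain ⟨B, hB, hT⟩ := hb a g' h'
          obtain ⟨c, hc⟩ := exists_length_le (M a).isRegular (M a).isFiniteToOne hB
            (Set.finite_singleton h') (α := (M a).alph.Letter) (ev := (M a).alph.ev)
          exact ⟨c, fun l hl l' hl' e => hc g' h' l l' hl' rfl e (hT l hl l' hl' e)⟩
        obtain ⟨c₁, hc₁⟩ := one g' h'
        obtain ⟨c₂, hc₂⟩ := one g'⁻¹ h'⁻¹
        refine ⟨c₁ + c₂, fun l hl l' hl' hg e => ?_⟩
        rw [← map_mul, ← map_mul] at e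
        have e := hi a e
        have h1 := hc₁ l hl l' hl' e
        have h2 := hc₂ l' hl' l hl (by rw [← e]; group)
        omega
      · refine ⟨0, fun l hl l' hl' hg e => ?_⟩
        obtain ⟨g', h', e1, e2, -⟩ := mem a g h l l' hg e
        exact absurd ⟨g', h', e1, e2⟩ hgh
    choose c hc using key
    obtain ⟨c', hc'⟩ := exists_forall_le_of_finite c
    refine ⟨c' + C, fun a o₁ o₁' o₂ o₂' u hu u' hu' hg e => ?_⟩
    obtain ⟨l, hl, j, hj, rfl, -⟩ := form _ a _ u hu
    obtain ⟨l', hl', j', hj', rfl, -⟩ := form _ a _ u' hu'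
    rw [hprod, hprod] at e
    have h1 := hc a l hl l' hl' hg e
    have h2 := hc' a
    simp only [List.length_append, List.length_map, List.length_replicate]
    omega
  · rintro hs o a E u hu u' hu' g hg hga h hh e
    obtain ⟨l, hl, j, hj, rfl, hw⟩ := form _ a _ u hu
    obtain ⟨l', hl', j', hj', rfl, hw'⟩ := form _ a _ u' hu'
    rw [hprod, hprod] at e
    obtain ⟨g', h', rfl, rfl, e'⟩ := mem a g h l l' hga e
    have := hlen o a (some E) hs l hl l' hl' j j' hw hw' g' hg h' hh e'
    simpa using this
  · refine ⟨insert 1 (⋃ a, Set.range (i a ∘ (M a).alph.ev)),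
      (Set.finite_iUnion fun a => Set.finite_range _).insert 1, ?_⟩
    rintro o a o' _ ⟨w, hw, rfl⟩ x hx
    obtain ⟨z, -, rfl⟩ := List.mem_map.1 hx
    rcases z with _ | z
    · exact Or.inl rfl
    · exact Or.inr (Set.mem_iUnion.2 ⟨a, z, rfl⟩)

/-- Structures on the vertex groups are induced by a structure on the whole group. -/
theorem exists_combination [Finite V] [Finite 𝓔] (S : Splitting Γ V 𝓔) {s : Bool}
    {i : ∀ a, H a →* Γ} (hi : ∀ a, Function.Injective (i a)) (hr : ∀ a, (i a).range = S.VG a)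
    (M : ∀ a, AsyncAutStruct (H a)) (hb : ∀ a, (M a).IsBi s) (V₀ : V) :
    ∃ K : AsyncAutStruct Γ, K.IsBi s ∧
      ∀ a, EqTr K.alph.ev K.lang (i a ∘ (M a).alph.ev) (M a).lang := by
  obtain ⟨N, hreg, ⟨C, hC⟩, hS⟩ := exists_syllables S hi hr M hb
  -- Every edge gets its own separator, even if its value is 1. So the automaton always sees where a
  -- syllable ends.
  let α := (Σ a, Option (M a).alph.Letter) ⊕ 𝓔
  let ev : α → Γ := Sum.elim (fun p => padEv i M p.1 p.2) S.t
  let j : ∀ a, Option (M a).alph.Letter → α := fun a x => Sum.inl ⟨a, x⟩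
  have hj : ∀ a (w : List (Option (M a).alph.Letter)), (w.map (j a)).map ev = w.map (padEv i M a) :=
    fun a w => by rw [List.map_map]; rfl
  let N₁ : Option 𝓔 → V → Option 𝓔 → Language α := fun o a o' =>
    {w | ∃ l ∈ N o a o', l.map (j a) = w}
  -- The syllables that would make a path backtrack. Their values lie in finite edge groups, so they
  -- are finitely many and removing them preserves regularity.
  let X : Option 𝓔 → V → Option 𝓔 → Language α := fun o a o' =>
    {w | w ∈ N₁ o a o' ∧ ∃ E, o' = some E ∧ o = some (S.rev E) ∧ (w.map ev).prod ∈ S.EG E}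
  have hX : ∀ o a o', (X o a o').IsRegular := by
    intro o a o'
    refine Language.isRegular_of_finite ?_
    refine (finite_preimage_map ev (Set.finite_iUnion fun E => (S.EG_finite E).biUnion fun g _ =>
      hS.finite o a o' g)).subset ?_
    rintro _ ⟨⟨l, hl, rfl⟩, E, -, -, h⟩
    exact Set.mem_iUnion.2 ⟨E, Set.mem_biUnion h ⟨⟨l, hl, (hj a l).symm⟩, rfl⟩⟩
  let N₂ : Option 𝓔 → V → Option 𝓔 → Language α := fun o a o' => {w | w ∈ N₁ o a o' ∧ w ∉ X o a o'}
  let sep : 𝓔 → α := Sum.inr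
  let L : Language α := {w | S.Composite N₂ sep V₀ none V₀ w}
  have hL : L.IsRegular := S.isRegular_composite sep
    (fun o a o' => ((hreg o a o').image_map (j a)).diff (hX o a o')) V₀ none V₀
  have fwd : ∀ o a w, S.Composite N₂ sep V₀ o a w → S.SyllableWord
      (fun o a o' => {l | ∃ w ∈ N o a o', w.map (padEv i M a) = l}) (fun E => [S.t E]) o a V₀
      (w.map ev) := by
    intro o a w h
    induction h with
    | last hu =>
      obtain ⟨⟨l, hl, rfl⟩, -⟩ := hu
      rw [hj]
      exact .last _ ⟨l, hl, rfl⟩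
    | @step o a E u w h hu hw ih =>
      have hu0 := hu
      obtain ⟨⟨l, hl, rfl⟩, hx⟩ := hu
      have := Splitting.SyllableWord.step (e := fun E => [S.t E]) o h
        (⟨l, hl, rfl⟩ : _ ∈ {l | ∃ w ∈ N o a (some E), w.map (padEv i M a) = l}) (fun ho hE =>
          hx ⟨hu0.1, E, rfl, ho, by rwa [hj]⟩) ih
      rw [List.map_append, hj]
      simpa [ev, sep] using this
  have bwd : ∀ o a b l, S.SyllableWord
      (fun o a o' => {l | ∃ w ∈ N o a o', w.map (padEv i M a) = l}) (fun E => [S.t E]) o a b l →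
      b = V₀ → ∃ w, S.Composite N₂ sep V₀ o a w ∧ w.map ev = l := by
    intro o a b l h
    induction h with
    | @last o a u hu =>
      rintro rfl
      obtain ⟨l, hl, rfl⟩ := hu
      refine ⟨l.map (j a), .last ⟨⟨l, hl, rfl⟩, ?_⟩, hj a l⟩
      rintro ⟨-, E, h, -⟩
      cases h
    | @step o a b E u l h hu hred hl ih =>
      intro hb
      obtain ⟨m, hm, rfl⟩ := hu
      obtain ⟨w, hw, rfl⟩ := ih hb
      refine ⟨_, .step h (u := m.map (j a)) ⟨⟨m, hm, rfl⟩, ?_⟩ hw, ?_⟩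
      · rintro ⟨-, E', h1, h2, h3⟩
        cases h1
        exact hred h2 (by rwa [hj] at h3)
      · rw [List.map_append, hj]
        simp [ev, sep]
  obtain ⟨K, hK, hKL⟩ := exists_asyncAutStruct (s := s) ev hL (fun g => by
    obtain ⟨l, hl, rfl⟩ := hS.exists_word (S.red_all V₀ g V₀)
    obtain ⟨w, hw, rfl⟩ := bwd _ _ _ _ hl rfl
    exact ⟨w, hw, rfl⟩) (fun g => (finite_preimage_map ev (hS.finite_words V₀
      (Set.finite_singleton g))).subset (by
        rintro w ⟨hw, h⟩
        exact ⟨_, _, fwd _ _ _ hw, h⟩)) (fun g z => by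
    obtain ⟨B, hB, hT⟩ := hS.exists_travel V₀ g z
    exact ⟨B, hB, fun l hl m hm e => hT _ _ _ _ (fwd _ _ _ hl) (fwd _ _ _ hm) e⟩)
  refine ⟨K, hK, fun a => ?_⟩
  obtain ⟨B, hB, hT⟩ := hS.exists_travel_syllable V₀ a
  obtain ⟨B', hB', hT'⟩ := exists_tr_append_tails false (Set.finite_singleton (1 : Γ))
    (R := (fun j => List.replicate j (1 : Γ)) '' {j | j ≤ C}) ((Set.finite_le_nat C).image _)
  refine ⟨B * B', hB.mul hB', fun k hk l hl e => ?_⟩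
  obtain ⟨w, hw, hkw⟩ := hKL k hk
  obtain ⟨q, hq, hlq⟩ := hC none a none l hl
  have em : (l.map some ++ List.replicate q none).map (padEv i M a) =
      l.map (i a ∘ (M a).alph.ev) ++ List.replicate q 1 := by
    simp only [List.map_append, List.map_map, List.map_replicate]
    rfl
  -- A word of `K` with value in the vertex group travels with a padded syllable of the same value;
  -- the padding is then dropped.
  have t1 := (hT _ _ _ (fwd _ _ _ hw) ⟨_, hlq, rfl⟩ (by rw [← hkw, e, em]; simp)).atrav
  have t2 := hT' _ _ _ _ (Tr.refl 1 (l.map (i a ∘ (M a).alph.ev))) (List.replicate q 1)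
    ⟨q, hq, rfl⟩ (List.replicate 0 1) ⟨0, Nat.zero_le _, rfl⟩
  rw [List.replicate_zero, List.append_nil] at t2
  rw [em] at t1
  rw [hkw]
  exact ATrav.trans t1 t2

end Composite

/-! ### The language of a graph over `𝒴`. -/

namespace GraphOfGroups

variable {V : Type u} {D : Type v} {𝒴 : GraphOfGroups.{u, v, w, x} V D} {T : Set D} {V₀ : V}

theorem ConvenientAlphabet.prod_stableWord (A : 𝒴.ConvenientAlphabet T) (E : D × Bool) :
    ((A.stableWord E).map A.ev).prod = 𝒴.stable T E := by
  unfold stableWord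
  split_ifs with h
  · simp [𝒴.stable_eq_one T h]
  · simp [A.ev_stableLetter]

theorem ConvenientAlphabet.map_incl (A : 𝒴.ConvenientAlphabet T) (a : V)
    (m : List (A.vertAlph a).Letter) :
    (m.map (A.incl a)).map A.ev = m.map (𝒴.vert T a ∘ (A.vertAlph a).ev) := by
  simp [A.ev_incl]

theorem ConvenientAlphabet.prod_map_incl (A : 𝒴.ConvenientAlphabet T) (a : V)
    (m : List (A.vertAlph a).Letter) :
    ((m.map (A.incl a)).map A.ev).prod = 𝒴.vert T a ((A.vertAlph a).val m) := by
  rw [A.map_incl, Alphabet.val_eq, map_list_prod, List.map_map]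

namespace YGraph

/-- The syllables of the language of a `𝒴`-graph. -/
def syllables (X : 𝒴.YGraph V₀) {A : 𝒴.ConvenientAlphabet T} (C : X.Choice A)
    (_ : Option (D × Bool)) (a : V) (_ : Option (D × Bool)) : Set (List (𝒴.Pi1 T)) :=
  {u | ∃ p : X.Vert a, ∃ m ∈ C.lang p, (m.map (A.incl a)).map A.ev = u}

variable (X : 𝒴.YGraph V₀) {A : 𝒴.ConvenientAlphabet T} (C : X.Choice A)
  {S : Splitting (𝒴.Pi1 T) V (D × Bool)}

/-- The vertices of `X` and the sets on its edges only restrict which words occur. What remains is a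
reduced path, as injectivity of the vertex groups turns the non-backtracking condition into one on
subgroups. -/
theorem IsPathWord.exists_syllableWord {X : 𝒴.YGraph V₀} {C : X.Choice A}
    (hi : ∀ a, Function.Injective (𝒴.vert T a))
    (hs : S.src = 𝒴.src) (ht : S.tgt = 𝒴.tgt) (hr : S.rev = rev)
    (hE : S.EG = fun E => ((𝒴.vert T (𝒴.src E)).comp (𝒴.bdry₀ E)).range)
    {o : Option (D × Bool)} {a : V} {p : X.Vert a} {l : List A.Letter}
    (h : X.IsPathWord C o p l) :
    ∃ b, S.SyllableWord (X.syllables C) (fun E => (A.stableWord E).map A.ev) o a b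
      (l.map A.ev) := by
  induction h with
  | @last o a p m hm => exact ⟨a, .last _ ⟨p, m, hm, rfl⟩⟩
  | @step o E p e m hm hS hred l hl ih =>
    obtain ⟨b, hb⟩ := ih
    refine ⟨b, ?_⟩
    rw [List.map_append, List.map_append]
    refine .step (E := E) _ (by rw [hs]) ⟨p, m, hm, rfl⟩ (fun ho hmem => ?_) (by rwa [ht])
    rw [hr] at ho
    rw [A.prod_map_incl, hE] at hmem
    obtain ⟨f, hf⟩ := hmem
    exact hred ho ⟨f, hi _ hf⟩

/-- By `Splitting.exists_syllableWord_travel`; the assumption on labels provides travel with single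
syllables, uniformly since `X` has finitely many vertices. -/
theorem langEquiv_pathLang [Finite V] [Finite D] (hi : ∀ a, Function.Injective (𝒴.vert T a))
    (hs : S.src = 𝒴.src) (ht : S.tgt = 𝒴.tgt) (hr : S.rev = rev)
    (hV : S.VG = fun a => (𝒴.vert T a).range)
    (hE : S.EG = fun E => ((𝒴.vert T (𝒴.src E)).comp (𝒴.bdry₀ E)).range)
    (hst : S.t = 𝒴.stable T) {L : AsyncAutStruct (𝒴.Pi1 T)} (hL : L.IsBi false)
    (hX : ∀ (a : V) (p : X.Vert a), AsyncAut.Induces (𝒴.vert T a) L.cls (X.label p)) :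
    Alphabet.LangEquiv L.alph L.lang A.toAlphabet (X.pathLang C) := by
  have := X.finite_vert
  have key : ∀ q : Σ a, X.Vert a, ∃ B : Set (𝒴.Pi1 T), B.Finite ∧ ∀ m ∈ C.lang q.2, ∀ l ∈ L.lang,
      (l.map L.alph.ev).prod = ((m.map (A.incl q.1)).map A.ev).prod →
      ATrav B 1 (l.map L.alph.ev) 1 ((m.map (A.incl q.1)).map A.ev) := by
    rintro ⟨a, p⟩
    have h := hX a p
    rw [← C.cls_eq p, AsyncAut.induces_iff] at h
    obtain ⟨B, hB, hT⟩ := h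
    refine ⟨B, hB, fun m hm l hl e => ?_⟩
    rw [A.map_incl] at e ⊢
    exact hT l hl m hm e
  obtain ⟨B, hB, hT⟩ := exists_finite_of_forall_finite (P := fun (q : Σ a, X.Vert a) B =>
      ∀ m ∈ C.lang q.2, ∀ l ∈ L.lang,
      (l.map L.alph.ev).prod = ((m.map (A.incl q.1)).map A.ev).prod →
      ATrav B 1 (l.map L.alph.ev) 1 ((m.map (A.incl q.1)).map A.ev))
    (fun q B B' hBB h m hm l hl e => (h m hm l hl e).mono hBB) key
  obtain ⟨B', hB', hT'⟩ := S.exists_syllableWord_travel (M := X.syllables C)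
    (e := fun E => (A.stableWord E).map A.ev) L.isRegular hL L.isNormalForm
    (fun E => by rw [hst]; exact A.prod_stableWord E) (by
      rintro o a o' _ ⟨p, m, hm, rfl⟩
      rw [hV, A.prod_map_incl]
      exact ⟨_, rfl⟩) ⟨B, hB, by
      rintro o a o' _ ⟨p, m, hm, rfl⟩ l hl e
      exact hT ⟨a, p⟩ m hm l hl e⟩ V₀
  rw [Alphabet.langEquiv_iff]
  refine ⟨B', hB', fun l hl m hm e => ?_⟩
  obtain ⟨b, hb⟩ := IsPathWord.exists_syllableWord hi hs ht hr hE hm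
  exact hT' b _ hb l hl e

/-- A reduced path in the graph of groups is lifted to `X` step by step. The edge labels at each
vertex cover all values that a reduced path may have there. -/
theorem exists_isPathWord (hs : S.src = 𝒴.src) (ht : S.tgt = 𝒴.tgt) (hr : S.rev = rev)
    (hV : S.VG = fun a => (𝒴.vert T a).range)
    (hE : S.EG = fun E => ((𝒴.vert T (𝒴.src E)).comp (𝒴.bdry₀ E)).range)
    (hst : S.t = 𝒴.stable T) {o : Option (D × Bool)} {a b : V} {g : 𝒴.Pi1 T}
    (h : S.Red o a b g) : ∀ p : X.Vert a,
      (o = none → (⟨a, p⟩ : Σ a, X.Vert a) = ⟨V₀, X.start⟩) →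
      (∀ E, o = some E → ∃ (q : X.Vert (𝒴.src E)) (e : X.Edge E q),
        (⟨𝒴.tgt E, X.target e⟩ : Σ a, X.Vert a) = ⟨a, p⟩) →
      ∃ l, X.IsPathWord C o p l ∧ (l.map A.ev).prod = g := by
  induction h with
  | @last o a g hg =>
    intro p _ _
    rw [hV] at hg
    obtain ⟨g, rfl⟩ := hg
    obtain ⟨m, hm, rfl⟩ := C.isNormalForm p g
    exact ⟨_, .last o p m hm, A.prod_map_incl a m⟩
  | @step o a b E g x h hg hred hx ih =>
    rw [hs] at h
    subst h
    intro p hp hq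
    rw [hV] at hg
    obtain ⟨g, rfl⟩ := hg
    obtain ⟨m, hm, rfl⟩ := C.isNormalForm p g
    have hred' : o = some (rev E) → (A.vertAlph (𝒴.src E)).val m ∉ (𝒴.bdry₀ E).range := by
      rintro ho ⟨f, hf⟩
      refine hred (by rw [hr]; exact ho) ?_
      rw [hE]
      exact ⟨f, by rw [← hf]; rfl⟩
    have hmem : (A.vertAlph (𝒴.src E)).val m ∈ ⋃ e : X.Edge E p, X.set e := by
      by_cases hc : (⟨𝒴.src E, p⟩ : Σ a, X.Vert a) = ⟨V₀, X.start⟩ ∨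
        ∃ (E' : D × Bool) (q : X.Vert (𝒴.src E')) (e : X.Edge E' q),
          (⟨𝒴.tgt E', X.target e⟩ : Σ a, X.Vert a) = ⟨𝒴.src E, p⟩ ∧ E' ≠ rev E
      · rw [X.union_eq_univ E p hc]
        trivial
      · rw [X.union_eq_compl E p hc]
        -- The union omits the edge group only if the vertex is not the start and is entered only
        -- through `rev E`; then reducedness excludes the edge group as well.
        rcases o with _ | E'
        · exact absurd (Or.inl (hp rfl)) hc
        · by_cases hE' : E' = rev E
          · exact hred' (by rw [hE'])
          · obtain ⟨q, e, he⟩ := hq E' rfl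
            exact absurd (Or.inr ⟨E', q, e, he, hE'⟩) hc
    obtain ⟨e, he⟩ := Set.mem_iUnion.1 hmem
    rw [ht] at ih
    obtain ⟨l, hl, rfl⟩ := ih (X.target e) (by simp) (fun E' h => by
      cases h
      exact ⟨p, e, rfl⟩)
    refine ⟨_, .step o e m hm he hred' l hl, ?_⟩
    rw [List.map_append, List.map_append, List.prod_append, List.prod_append, A.prod_map_incl,
      A.prod_stableWord, hst]

theorem pathLang_onto (hs : S.src = 𝒴.src) (ht : S.tgt = 𝒴.tgt) (hr : S.rev = rev)
    (hV : S.VG = fun a => (𝒴.vert T a).range)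
    (hE : S.EG = fun E => ((𝒴.vert T (𝒴.src E)).comp (𝒴.bdry₀ E)).range)
    (hst : S.t = 𝒴.stable T) (g : 𝒴.Pi1 T) : ∃ l ∈ X.pathLang C, (l.map A.ev).prod = g :=
  X.exists_isPathWord C hs ht hr hV hE hst (S.red_all V₀ g V₀) X.start (fun _ => rfl) (by simp)

end YGraph

end GraphOfGroups

/-! ### The graph over `𝒴` with `π` an isomorphism. -/

theorem AsyncAut.isTranslate_self {G : Type u} [Group G] {c : AsyncAut G} (hc : c ∈ BiAut false G)
    (g : G) : AsyncAut.IsTranslate g c c := by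
  obtain ⟨L, hL, rfl⟩ := hc
  refine ⟨L, L, rfl, rfl, ?_⟩
  obtain ⟨B, hB, hT⟩ := hL g 1
  obtain ⟨K, hK⟩ := L.alph.exists_subset_ball hB
  refine ⟨K, fun l hl m hm e => (L.alph.asyncTravel_iff (x := g) (y := 1) (l := l.map L.alph.ev)
    (m := m.map L.alph.ev) (fun t => by simp [Alphabet.path_eq])
    (fun t => by simp [Alphabet.path_eq])).2 (ATrav.mono hK (hT l hl m hm ?_))⟩
  rw [mul_one]
  exact e

/-- The set is the whole group or the complement of a finite set, and finite sets are rational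
because structures are finite-to-one. -/
theorem AsyncAut.isRational_setOf_or_notMem {G : Type u} [Group G] (c : AsyncAut G) (p : Prop)
    {F : Set G} (hF : F.Finite) : c.IsRational {g | p ∨ g ∉ F} := by
  rintro L -
  by_cases hp : p
  · refine L.isRegular.of_iff fun l => ?_
    simp only [hp, true_or]
    exact ⟨fun h => h.1, fun h => ⟨h, trivial⟩⟩
  · refine (L.isRegular.diff (Language.isRegular_of_finite (L := {l | l ∈ L.lang ∧
      L.alph.val l ∈ F}) (FinToOne.finite L.isFiniteToOne hF))).of_iff fun l => ?_
    constructor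
    · rintro ⟨h1, h2⟩
      exact ⟨h1, fun h => (h2.resolve_left hp) h.2⟩
    · rintro ⟨h1, h2⟩
      exact ⟨h1, Or.inr fun h => h2 ⟨h1, h⟩⟩

namespace GraphOfGroups

variable {V : Type u} {D : Type v} {𝒴 : GraphOfGroups.{u, v, w, x} V D}

/-- The vertex at the beginning of `E` is the base vertex or the end of an edge other than the
inverse of `E`. -/
def Branching (𝒴 : GraphOfGroups.{u, v, w, x} V D) (V₀ : V) (E : D × Bool) : Prop :=
  𝒴.src E = V₀ ∨ ∃ E' : D × Bool, 𝒴.tgt E' = 𝒴.src E ∧ E' ≠ rev E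

/-- The label of the edge over `E` in a `𝒴`-graph that is isomorphic to the underlying graph. -/
def isoSet (𝒴 : GraphOfGroups.{u, v, w, x} V D) (V₀ : V) (E : D × Bool) : Set (𝒴.G (𝒴.src E)) :=
  {g | 𝒴.Branching V₀ E ∨ g ∉ (𝒴.bdry₀ E).range}

theorem isoSet_mul_right (V₀ : V) (E : D × Bool) (f : 𝒴.F E.1) :
    (fun g => g * (𝒴.bdry₀ E f)⁻¹) '' 𝒴.isoSet V₀ E = 𝒴.isoSet V₀ E := by
  have h : ∀ g, g * (𝒴.bdry₀ E f)⁻¹ ∈ (𝒴.bdry₀ E).range ↔ g ∈ (𝒴.bdry₀ E).range := fun g =>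
    Subgroup.mul_mem_cancel_right _ (inv_mem ⟨f, rfl⟩)
  ext g
  constructor
  · rintro ⟨g, hg, rfl⟩
    exact hg.imp id fun hg => by rwa [h]
  · intro hg
    refine ⟨g * 𝒴.bdry₀ E f, hg.imp id fun hg => ?_, by simp⟩
    rwa [← h, mul_inv_cancel_right]

theorem isoSet_mul_left (V₀ : V) (E E' : D × Bool) (f : 𝒴.F E.1) (h : 𝒴.tgt E = 𝒴.src E') :
    (fun g => MulEquiv.cast (M := 𝒴.G) h (𝒴.bdry₁ E f) * g) '' 𝒴.isoSet V₀ E' =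
      𝒴.isoSet V₀ E' := by
  by_cases hb : 𝒴.Branching V₀ E'
  · have e : 𝒴.isoSet V₀ E' = Set.univ := by
      ext g
      simp [isoSet, hb]
    rw [e, Set.image_univ]
    exact (Group.mulLeft_bijective _).2.range_eq
  -- Without branching, the only edge into this vertex is `rev E'`, so `F_E` acts on the label
  -- through the very subgroup that is omitted.
  · have hE : E = rev E' := by
      by_contra hE
      exact hb (Or.inr ⟨E, h, hE⟩)
    subst hE
    have hk : MulEquiv.cast (M := 𝒴.G) h (𝒴.bdry₁ (rev E') f) ∈ (𝒴.bdry₀ E').range := by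
      obtain ⟨d, b⟩ := E'
      cases b <;> exact ⟨f, rfl⟩
    generalize MulEquiv.cast (M := 𝒴.G) h (𝒴.bdry₁ (rev E') f) = k at hk
    have hk' : ∀ g, k * g ∈ (𝒴.bdry₀ E').range ↔ g ∈ (𝒴.bdry₀ E').range := fun g =>
      Subgroup.mul_mem_cancel_left _ hk
    ext g
    constructor
    · rintro ⟨g, hg, rfl⟩
      exact hg.imp id fun hg => by rwa [hk']
    · intro hg
      refine ⟨k⁻¹ * g, hg.imp id fun hg => ?_, by simp⟩
      rwa [← hk', mul_inv_cancel_left]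

/-- The `𝒴`-graph that is isomorphic to the underlying graph and has given labels. -/
noncomputable def isoGraph [Finite V] [Finite D] (hF : ∀ d, Finite (𝒴.F d)) {T : Set D}
    (hT : 𝒴.IsMaximalTree T) (V₀ : V) (c : ∀ a, AsyncAut (𝒴.G a))
    (hc : ∀ a, c a ∈ BiAut false (𝒴.G a)) : 𝒴.YGraph V₀ where
  Vert _ := Unit
  Edge _ _ := Unit
  target _ := ()
  finite_vert := inferInstance
  finite_edge := inferInstance
  start := ()
  reachable := by
    have key : ∀ (l : List (D × Bool)) (a b : V), 𝒴.IsPath a b l → Relation.ReflTransGen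
        (fun q₁ q₂ : Σ _ : V, Unit => ∃ (E : D × Bool) (_ _ : Unit),
          q₁ = ⟨𝒴.src E, ()⟩ ∧ q₂ = ⟨𝒴.tgt E, ()⟩) ⟨a, ()⟩ ⟨b, ()⟩ := by
      intro l
      induction l with
      | nil =>
        rintro a b rfl
        exact .refl
      | cons E l ih =>
        rintro a b ⟨rfl, h⟩
        exact .head ⟨E, (), (), rfl, rfl⟩ (ih _ _ h)
    rintro ⟨a, _⟩
    obtain ⟨l, ⟨hl, -⟩, -⟩ := hT V₀ a
    exact key l V₀ a hl
  label {a} _ := c a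
  set {E} _ _ := 𝒴.isoSet V₀ E
  isRational {E} _ _ := by
    have := hF E.1
    exact AsyncAut.isRational_setOf_or_notMem _ _ (Set.finite_range (𝒴.bdry₀ E))
  disjoint e e' h := absurd rfl h
  union_eq_univ E p h := by
    have hb : 𝒴.Branching V₀ E := by
      rcases h with h | ⟨E', q, e, h, hE⟩
      · exact Or.inl (congrArg Sigma.fst h)
      · exact Or.inr ⟨E', congrArg Sigma.fst h, hE⟩
    ext g
    simp [isoSet, hb]
  union_eq_compl E p h := by
    have hb : ¬ 𝒴.Branching V₀ E := by
      rintro (hb | ⟨E', hb, hE⟩)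
      · exact h (Or.inl (by rw [hb]))
      · exact h (Or.inr ⟨E', (), (), by rw [hb], hE⟩)
    ext g
    simp [isoSet, hb]
  -- Trivial actions are admissible: the edge labels are invariant under the edge groups, and the
  -- vertex labels are invariant under translation because they are two-sided.
  actVert _ _ _ := 1
  actEdge _ _ _ := 1
  act_source _ _ _ _ _ := rfl
  act_target _ _ _ _ _ := rfl
  act_fix _ _ _ _ _ _ := rfl
  act_label E _ f _ := AsyncAut.isTranslate_self (hc _) _
  act_set E _ f _ := (isoSet_mul_right V₀ E f).symm
  act_set_next E _ f _ E' _ _ h _ := (isoSet_mul_left V₀ E E' f h).symm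

theorem isoGraph_isIso [Finite V] [Finite D] (hF : ∀ d, Finite (𝒴.F d)) {T : Set D}
    (hT : 𝒴.IsMaximalTree T) (V₀ : V) (c : ∀ a, AsyncAut (𝒴.G a))
    (hc : ∀ a, c a ∈ BiAut false (𝒴.G a)) : (isoGraph hF hT V₀ c hc).IsIso := by
  constructor
  · constructor
    · rintro ⟨a, ⟨⟩⟩ ⟨b, ⟨⟩⟩ h
      cases h
      rfl
    · exact fun a => ⟨⟨a, ()⟩, rfl⟩
  · constructor
    · rintro ⟨E, ⟨⟩, ⟨⟩⟩ ⟨E', ⟨⟩, ⟨⟩⟩ h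
      cases h
      rfl
    · exact fun E => ⟨⟨E, (), ()⟩, rfl⟩

end GraphOfGroups

/-! ### Convenient alphabets. -/

namespace GraphOfGroups

variable {V : Type u} {D : Type v} {𝒴 : GraphOfGroups.{u, v, w, x} V D} {T : Set D}

/-- The exponent sum of the edge of `E` is a homomorphism to `ℤ` that kills all vertex groups. -/
theorem stable_ne_vert {E : D × Bool} (hE : E.1 ∉ T) (a : V) (g : 𝒴.G a) :
    𝒴.stable T E ≠ 𝒴.vert T a g := by
  classical
  intro h
  let τ : D × Bool → Multiplicative ℤ := fun E' =>
    if E'.1 = E.1 then Multiplicative.ofAdd (if E'.2 then 1 else -1) else 1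
  have h' := congrArg (𝒴.pi1Lift T (fun _ => 1) τ (fun E' => by
    rcases E' with ⟨d, _ | _⟩ <;> by_cases hd : d = E.1 <;> simp [τ, rev, hd])
    (fun E' hE' => if_neg fun e : E'.1 = E.1 => hE (e ▸ hE')) (fun E' f => by simp)) h
  rw [pi1Lift_vert, pi1Lift_stable] at h'
  rcases E with ⟨d, _ | _⟩ <;> simp [τ] at h'

/-- Given structures on the vertex groups, there is a convenient alphabet over which the vertex
groups have equivalent structures. -/
theorem exists_convenientAlphabet [Finite V] [Finite D] (hF : ∀ d, Finite (𝒴.F d))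
    (hi : ∀ a, Function.Injective (𝒴.vert T a)) (V₀ : V) (M : ∀ a, AsyncAutStruct (𝒴.G a))
    (hM : ∀ a, (M a).IsBi false) :
    ∃ A : 𝒴.ConvenientAlphabet T, ∀ a, ∃ (L : Language (A.vertAlph a).Letter)
      (h₁ : L.IsRegular) (h₂ : (A.vertAlph a).IsNormalForm L) (h₃ : (A.vertAlph a).IsFiniteToOne L)
      (h₄ : (A.vertAlph a).HasAsyncFTP L),
      (AsyncAutStruct.mk (A.vertAlph a) L h₁ h₂ h₃ h₄).cls = (M a).cls := by
  -- Letters are group elements: 1, the values of the letters of all `M a`, and the edge group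
  -- elements. Using the elements themselves makes each of them the value of exactly one letter, as
  -- required for edge groups.
  let W₀ : Set (𝒴.Pi1 T) := insert 1 ((⋃ a, Set.range fun x => 𝒴.vert T a ((M a).alph.ev x)) ∪
    ⋃ E : D × Bool, Set.range fun f => 𝒴.vert T (𝒴.tgt E) (𝒴.bdry₁ E f))
  have hW₀ : W₀.Finite := ((Set.finite_iUnion fun a => Set.finite_range _).union
    (Set.finite_iUnion fun E => Set.finite_range _)).insert 1
  let W : Set (𝒴.Pi1 T) := {z | z ∈ W₀ ∨ z⁻¹ ∈ W₀}
  have hW : W.Finite := by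
    refine (hW₀.union (hW₀.preimage (inv_injective (G := 𝒴.Pi1 T)).injOn)).subset ?_
    exact fun z hz => hz
  have hWv : ∀ z ∈ W, ∃ a, z ∈ (𝒴.vert T a).range := by
    have h0 : ∀ z ∈ W₀, ∃ a, z ∈ (𝒴.vert T a).range := by
      rintro z (rfl | hz | hz)
      · exact ⟨V₀, one_mem _⟩
      · obtain ⟨a, x, rfl⟩ := Set.mem_iUnion.1 hz
        exact ⟨a, _, rfl⟩
      · obtain ⟨E, f, rfl⟩ := Set.mem_iUnion.1 hz
        exact ⟨_, _, rfl⟩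
    rintro z (hz | hz)
    · exact h0 z hz
    · obtain ⟨a, ha⟩ := h0 _ hz
      exact ⟨a, by simpa using inv_mem ha⟩
  have := hW.to_subtype
  obtain ⟨n, ⟨φ⟩⟩ := Finite.exists_equiv_fin (W ⊕ {E : D × Bool // E.1 ∉ T})
  let ev₀ : W ⊕ {E : D × Bool // E.1 ∉ T} → 𝒴.Pi1 T :=
    Sum.elim (fun z => z.1) fun E => 𝒴.stable T E.1
  let inv₀ : W ⊕ {E : D × Bool // E.1 ∉ T} → W ⊕ {E : D × Bool // E.1 ∉ T} :=
    Sum.map (fun z => ⟨z.1⁻¹, by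
      rcases z.2 with h | h
      · exact Or.inr (by rwa [inv_inv])
      · exact Or.inl h⟩) fun E => ⟨rev E.1, E.2⟩
  have inv₀_inv₀ : ∀ z, inv₀ (inv₀ z) = z := by
    rintro (z | E) <;> simp [inv₀, rev]
  have ev₀_inv₀ : ∀ z, ev₀ (inv₀ z) = (ev₀ z)⁻¹ := by
    rintro (z | E)
    · rfl
    · exact eq_inv_of_mul_eq_one_right (𝒴.stable_mul_stable_rev T E.1)
  let ev : Fin n → 𝒴.Pi1 T := fun s => ev₀ (φ.symm s)
  let inv : Fin n → Fin n := fun s => φ (inv₀ (φ.symm s))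
  have inv_inv' : ∀ s, inv (inv s) = s := fun s => by simp [inv, inv₀_inv₀]
  have ev_inv : ∀ s, ev (inv s) = (ev s)⁻¹ := fun s => by simp [inv, ev, ev₀_inv₀]
  have hlet : ∀ z ∈ W, ∃ s, ev s = z := fun z hz => ⟨φ (Sum.inl ⟨z, hz⟩), by simp [ev, ev₀]⟩
  have huniq : ∀ z ∈ W, ∃! s, ev s = z := by
    intro z hz
    refine ⟨φ (Sum.inl ⟨z, hz⟩), by simp [ev, ev₀], fun s hs => ?_⟩
    obtain ⟨y, rfl⟩ := φ.surjective s
    simp only [ev, Equiv.symm_apply_apply] at hs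
    rcases y with y | E
    · congr 2
      exact Subtype.ext hs
    · obtain ⟨a, g, rfl⟩ := hWv z hz
      exact absurd hs (stable_ne_vert E.2 a g)
  have hlM : ∀ a x, ∃ s, ev s = 𝒴.vert T a ((M a).alph.ev x) := fun a x =>
    hlet _ (Or.inl (Or.inr (Or.inl (Set.mem_iUnion.2 ⟨a, x, rfl⟩))))
  choose lam hlam using hlM
  -- All letters with value in the vertex group belong to its alphabet, possibly also letters
  -- contributed by other vertices; the language uses only those of `M a`.
  let Lv : V → Type := fun a => {s : Fin n // ev s ∈ (𝒴.vert T a).range}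
  let evv : ∀ a, Lv a → 𝒴.G a := fun a s => s.2.choose
  have hevv : ∀ a (s : Lv a), 𝒴.vert T a (evv a s) = ev s.1 := fun a s => s.2.choose_spec
  let lamv : ∀ a, (M a).alph.Letter → Lv a := fun a x => ⟨lam a x, _, (hlam a x).symm⟩
  have hlamv : ∀ a (l : List (M a).alph.Letter), (l.map (lamv a)).map (evv a) =
      l.map (M a).alph.ev := by
    intro a l
    rw [List.map_map]
    refine List.map_congr_left fun x _ => hi a ?_
    rw [Function.comp_apply, hevv]
    exact hlam a x
  have onto_vert : ∀ a g, ∃ l ∈ (M a).lang, ((l.map (lamv a)).map (evv a)).prod = g := by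
    intro a g
    obtain ⟨l, hl, hg⟩ := (M a).isNormalForm g
    exact ⟨l, hl, by rw [hlamv]; exact hg⟩
  let B : ∀ a, Alphabet (𝒴.G a) := fun a =>
    { Letter := Lv a
      finite_letter := inferInstance
      inv := fun s => ⟨inv s.1, by rw [ev_inv]; exact inv_mem s.2⟩
      inv_inv := fun s => Subtype.ext (inv_inv' s.1)
      ev := evv a
      ev_inv := fun s => hi a (by rw [hevv, map_inv, hevv, ev_inv])
      onto := fun g => by
        obtain ⟨l, -, h⟩ := onto_vert a g
        exact ⟨_, h⟩ }
  have onto : ∀ g : 𝒴.Pi1 T, ∃ l : List (Fin n), (l.map ev).prod = g := by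
    intro g
    induction g using pi1_induction with
    | one => exact ⟨[], rfl⟩
    | mul x y hx hy =>
      obtain ⟨l, rfl⟩ := hx
      obtain ⟨m, rfl⟩ := hy
      exact ⟨l ++ m, by simp⟩
    | vert a g =>
      obtain ⟨l, -, rfl⟩ := onto_vert a g
      refine ⟨(l.map (lamv a)).map Subtype.val, ?_⟩
      rw [map_list_prod, List.map_map, List.map_map (f := evv a)]
      exact congrArg List.prod (List.map_congr_left fun s _ => (hevv a s).symm)
    | stable E =>
      by_cases h : E.1 ∈ T
      · exact ⟨[], by rw [𝒴.stable_eq_one T h]; rfl⟩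
      · exact ⟨[φ (Sum.inr ⟨E, h⟩)], by simp [ev, ev₀]⟩
  let A : 𝒴.ConvenientAlphabet T :=
    { Letter := Fin n
      finite_letter := inferInstance
      inv := inv
      inv_inv := inv_inv'
      ev := ev
      ev_inv := ev_inv
      onto := onto
      stableLetter := fun E h => φ (Sum.inr ⟨E, h⟩)
      ev_stableLetter := fun E h => by simp [ev, ev₀]
      inv_stableLetter := fun E h => by simp [inv, inv₀]
      vertAlph := B
      incl := fun a => Subtype.val
      incl_injective := fun a => Subtype.val_injective
      range_incl := fun a => Subtype.range_val
      ev_incl := fun a s => (hevv a s).symm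
      inv_incl := fun a s => rfl
      letter_cases := fun s => by
        obtain ⟨y, rfl⟩ := φ.surjective s
        rcases y with y | E
        · obtain ⟨a, ha⟩ := hWv y.1 y.2
          exact Or.inl ⟨a, ⟨φ (Sum.inl y), by simpa [ev, ev₀] using ha⟩, rfl⟩
        · exact Or.inr ⟨E.1, E.2, rfl⟩
      edge_letter := fun E f =>
        huniq _ (Or.inl (Or.inr (Or.inr (Set.mem_iUnion.2 ⟨E, f, rfl⟩))))
      one_letter := huniq _ (Or.inl (Or.inl rfl)) }
  refine ⟨A, fun a => ?_⟩
  let L : Language (B a).Letter := {m | ∃ l ∈ (M a).lang, l.map (lamv a) = m}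
  have travel : ∀ {s : Bool} {Q : Set (𝒴.G a)} {g : 𝒴.G a} {l m : List (M a).alph.Letter},
      Tr s Q g (l.map (M a).alph.ev) 1 (m.map (M a).alph.ev) →
      Tr s Q g ((l.map (lamv a)).map (B a).ev) 1 ((m.map (lamv a)).map (B a).ev) := by
    intro s Q g l m h
    rwa [show (l.map (lamv a)).map (B a).ev = _ from hlamv a l,
      show (m.map (lamv a)).map (B a).ev = _ from hlamv a m]
  have hval : ∀ l : List (M a).alph.Letter, ((l.map (lamv a)).map (B a).ev).prod =
      (l.map (M a).alph.ev).prod := fun l => congrArg List.prod (hlamv a l)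
  have h₁ : L.IsRegular := (M a).isRegular.image_map (lamv a)
  have h₂ : (B a).IsNormalForm L := by
    intro g
    obtain ⟨l, hl, h⟩ := onto_vert a g
    exact ⟨_, ⟨l, hl, rfl⟩, h⟩
  have h₃ : (B a).IsFiniteToOne L := by
    intro g
    refine (((M a).isFiniteToOne g).image (List.map (lamv a))).subset ?_
    rintro _ ⟨⟨l, hl, rfl⟩, h⟩
    exact ⟨l, ⟨hl, (hval l).symm.trans h⟩, rfl⟩
  have hb : BiTr false (B a).ev L (B a).ev L := by
    intro g h
    obtain ⟨Q, hQ, hT⟩ := hM a g h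
    refine ⟨Q, hQ, ?_⟩
    rintro _ ⟨l, hl, rfl⟩ _ ⟨m, hm, rfl⟩ e
    rw [hval, hval] at e
    exact travel (hT l hl m hm e)
  refine ⟨L, h₁, h₂, h₃, (AsyncAutStruct.ofBiTr (B a) L h₁ h₂ h₃ hb).hasAsyncFTP,
    AsyncAutStruct.cls_eq_iff.2 ?_⟩
  obtain ⟨Q, hQ, hT⟩ := (hM a).eqTr
  refine ⟨Q, hQ, ?_⟩
  rintro _ ⟨l, hl, rfl⟩ m hm e
  have e' : ((l.map (lamv a)).map (B a).ev).prod = (m.map (M a).alph.ev).prod := e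
  rw [hval] at e'
  have := hT l hl m hm e'
  rwa [← show (l.map (lamv a)).map (B a).ev = _ from hlamv a l] at this

end GraphOfGroups

/-! ### Induced classes and the proof of the theorem. -/

theorem AsyncAut.Induces.eq {G : Type u} [Group G] {H : Type v} [Group H] {i : H →* G}
    (hi : Function.Injective i) {c : AsyncAut G} {d d' : AsyncAut H}
    (h : AsyncAut.Induces i c d) (h' : AsyncAut.Induces i c d') : d = d' := by
  induction c using Quotient.inductionOn with | _ L
  induction d using Quotient.inductionOn with | _ M
  induction d' using Quotient.inductionOn with | _ M'
  have h := AsyncAut.induces_iff.1 h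
  have h' := AsyncAut.induces_iff.1 h'
  refine AsyncAutStruct.cls_eq_iff.2 ?_
  obtain ⟨B, hB, hT⟩ := h.symm.trans h' L.isNormalForm
  refine ⟨i ⁻¹' B, hB.preimage hi.injOn, fun l hl m hm e => ?_⟩
  have := hT l hl m hm (by
    rw [← List.map_map, ← List.map_map, ← map_list_prod, ← map_list_prod, e])
  rw [← List.map_map, ← List.map_map, ← map_one i] at this
  exact Tr.of_map (s := false) i this

namespace GraphOfGroups

variable {V : Type u} {D : Type v} {𝒴 : GraphOfGroups.{u, v, w, x} V D}
  {T : Set D} {s : Bool}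

theorem YGraph.exists_value (hF : ∀ d, Finite (𝒴.F d)) (hT : 𝒴.IsMaximalTree T) {V₀ : V}
    (X : 𝒴.YGraph V₀) {A : 𝒴.ConvenientAlphabet T} (C : X.Choice A) (g : 𝒴.Pi1 T) :
    ∃ l ∈ X.pathLang C, (l.map A.ev).prod = g := by
  obtain ⟨S, hs, ht, hr, hV, hE, hst⟩ := exists_splitting hF hT V₀
  exact X.pathLang_onto C hs ht hr hV hE hst g

variable [Finite D]

theorem exists_induced (hF : ∀ d, Finite (𝒴.F d)) (hT : 𝒴.IsMaximalTree T)
    {c : AsyncAut (𝒴.Pi1 T)} (hc : c ∈ BiAut s (𝒴.Pi1 T)) (a : V) :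
    ∃ d ∈ BiAut s (𝒴.G a), AsyncAut.Induces (𝒴.vert T a) c d := by
  obtain ⟨S, -, -, -, hV, -, -⟩ := exists_splitting hF hT a
  obtain ⟨L, hL, rfl⟩ := hc
  obtain ⟨M, hM, h⟩ := exists_restriction S a (vert_injective hT a) (by rw [hV]) L hL
  exact ⟨M.cls, ⟨M, hM, rfl⟩, AsyncAut.induces_iff.2 h⟩

variable [Finite V]

theorem exists_inducing (hF : ∀ d, Finite (𝒴.F d)) (hT : 𝒴.IsMaximalTree T) (V₀ : V)
    {d : ∀ a, AsyncAut (𝒴.G a)} (hd : ∀ a, d a ∈ BiAut s (𝒴.G a)) :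
    ∃ c ∈ BiAut s (𝒴.Pi1 T), ∀ a, AsyncAut.Induces (𝒴.vert T a) c (d a) := by
  obtain ⟨S, -, -, -, hV, -, -⟩ := exists_splitting hF hT V₀
  choose M hM hMd using hd
  obtain ⟨K, hK, h⟩ := exists_combination S (vert_injective hT) (fun a => by rw [hV]) M hM V₀
  exact ⟨K.cls, ⟨K, hK, rfl⟩, fun a => hMd a ▸ AsyncAut.induces_iff.2 (h a)⟩

/-- Any graph over `𝒴` whose labels are induced by `L` is a graph for `L`; existence and uniqueness
statements below all rest on this. -/
theorem YGraph.langEquiv_of_induces (hF : ∀ d, Finite (𝒴.F d)) (hT : 𝒴.IsMaximalTree T) {V₀ : V}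
    (X : 𝒴.YGraph V₀) {A : 𝒴.ConvenientAlphabet T} (C : X.Choice A)
    {L : AsyncAutStruct (𝒴.Pi1 T)} (hL : L.cls ∈ BiAut s (𝒴.Pi1 T))
    (hX : ∀ (a : V) (p : X.Vert a), AsyncAut.Induces (𝒴.vert T a) L.cls (X.label p)) :
    EqTr L.alph.ev L.lang A.ev (X.pathLang C) := by
  obtain ⟨S, hs, ht, hr, hV, hE, hst⟩ := exists_splitting hF hT V₀
  exact L.alph.langEquiv_iff.1 (X.langEquiv_pathLang C (vert_injective hT) hs ht hr hV hE hst
    (isBi_false_of_cls_mem (BiAut.async hL)) hX)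

theorem exists_isoGraph_choice (hF : ∀ d, Finite (𝒴.F d)) (hT : 𝒴.IsMaximalTree T) (V₀ : V)
    {d : ∀ a, AsyncAut (𝒴.G a)} (hd : ∀ a, d a ∈ BiAut false (𝒴.G a)) :
    ∃ A : 𝒴.ConvenientAlphabet T, Nonempty ((isoGraph hF hT V₀ d hd).Choice A) := by
  choose M hM hMd using id hd
  obtain ⟨A, hA⟩ := exists_convenientAlphabet (T := T) hF (vert_injective hT) V₀ M hM
  choose L h₁ h₂ h₃ h₄ h using hA
  exact ⟨A, ⟨⟨fun {a} _ => L a, fun {a} _ => h₁ a, fun {a} _ => h₂ a, fun {a} _ => h₃ a,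
    fun {a} _ => h₄ a, fun {a} _ => (h a).trans (hMd a)⟩⟩⟩

theorem exists_isGraphFor (hF : ∀ d, Finite (𝒴.F d)) (hT : 𝒴.IsMaximalTree T) (V₀ : V)
    {L : AsyncAutStruct (𝒴.Pi1 T)} (hL : L.cls ∈ BiAut s (𝒴.Pi1 T)) {d : ∀ a, AsyncAut (𝒴.G a)}
    (hd : ∀ a, d a ∈ BiAut s (𝒴.G a))
    (h : ∀ a, AsyncAut.Induces (𝒴.vert T a) L.cls (d a)) :
    ∃ X : 𝒴.YGraph V₀, X.IsIso ∧ (∀ (a : V) (p : X.Vert a), X.label p = d a) ∧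
      X.IsGraphFor L := by
  have hd' := fun a => BiAut.async (hd a)
  obtain ⟨A, ⟨C⟩⟩ := exists_isoGraph_choice hF hT V₀ hd'
  exact ⟨_, isoGraph_isIso hF hT V₀ d hd', fun _ _ => rfl, A, C, L.alph.langEquiv_iff.2
    (YGraph.langEquiv_of_induces hF hT _ C hL fun a _ => h a)⟩

/-- The labels are combined to a two-sided structure `K` that induces them. Both `L` and `K` are
then equivalent to the language of `X`, hence to each other, since that language maps onto the
group. -/
theorem YGraph.IsGraphFor.cls_mem (hF : ∀ d, Finite (𝒴.F d)) (hT : 𝒴.IsMaximalTree T) {V₀ : V}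
    {X : 𝒴.YGraph V₀} (hX : X.IsIso)
    (hl : ∀ (a : V) (p : X.Vert a), X.label p ∈ BiAut s (𝒴.G a)) {L : AsyncAutStruct (𝒴.Pi1 T)}
    (h : X.IsGraphFor L) : L.cls ∈ BiAut s (𝒴.Pi1 T) := by
  have hv : ∀ a, ∃ p : X.Vert a, ∀ q, q = p := by
    intro a
    obtain ⟨⟨a, p⟩, rfl⟩ := hX.1.2 a
    refine ⟨p, fun q => ?_⟩
    have := hX.1.1 (a₁ := ⟨a, q⟩) (a₂ := ⟨a, p⟩) rfl
    simpa using this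
  choose p hp using hv
  obtain ⟨c, hc, hci⟩ := exists_inducing hF hT V₀ fun a => hl a (p a)
  obtain ⟨A, C, h⟩ := h
  obtain ⟨K, hK, rfl⟩ := hc
  have h1 := X.langEquiv_of_induces hF hT C (s := s) ⟨K, hK, rfl⟩ fun a q => by
    rw [hp a q]
    exact hci a
  have h2 := (L.alph.langEquiv_iff.1 h).trans h1.symm (X.exists_value hF hT C)
  exact ⟨K, hK, (AsyncAutStruct.cls_eq_iff.2 h2).symm⟩

/-- Both classes are equivalent to the language of one and the same graph over `𝒴`, the isomorphic
one with labels `d`. -/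
theorem eq_of_induces (hF : ∀ d, Finite (𝒴.F d)) (hT : 𝒴.IsMaximalTree T) (V₀ : V)
    {c c' : AsyncAut (𝒴.Pi1 T)} (hc : c ∈ BiAut s (𝒴.Pi1 T)) (hc' : c' ∈ BiAut s (𝒴.Pi1 T))
    {d : ∀ a, AsyncAut (𝒴.G a)} (hd : ∀ a, d a ∈ BiAut s (𝒴.G a))
    (h : ∀ a, AsyncAut.Induces (𝒴.vert T a) c (d a))
    (h' : ∀ a, AsyncAut.Induces (𝒴.vert T a) c' (d a)) : c = c' := by
  obtain ⟨L, hL, rfl⟩ := hc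
  obtain ⟨L', hL', rfl⟩ := hc'
  have hd' := fun a => BiAut.async (hd a)
  obtain ⟨A, ⟨C⟩⟩ := exists_isoGraph_choice hF hT V₀ hd'
  have h1 := YGraph.langEquiv_of_induces hF hT _ C (s := s) ⟨L, hL, rfl⟩ fun a _ => h a
  have h2 := YGraph.langEquiv_of_induces hF hT _ C (s := s) ⟨L', hL', rfl⟩ fun a _ => h' a
  exact AsyncAutStruct.cls_eq_iff.2 (h1.trans h2.symm (YGraph.exists_value hF hT _ C))

theorem cls_mem_iff (hF : ∀ d, Finite (𝒴.F d)) (hT : 𝒴.IsMaximalTree T) (V₀ : V)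
    (L : AsyncAutStruct (𝒴.Pi1 T)) : L.cls ∈ BiAut s (𝒴.Pi1 T) ↔
      ∃ X : 𝒴.YGraph V₀, X.IsIso ∧ (∀ (a : V) (p : X.Vert a), X.label p ∈ BiAut s (𝒴.G a)) ∧
        X.IsGraphFor L := by
  constructor
  · intro hL
    choose d hd h using exists_induced hF hT hL
    obtain ⟨X, hX, hl, hXL⟩ := exists_isGraphFor hF hT V₀ hL hd h
    exact ⟨X, hX, fun a p => hl a p ▸ hd a, hXL⟩
  · rintro ⟨X, hX, hl, hXL⟩
    exact hXL.cls_mem hF hT hX hl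

theorem exists_bijective_labels (hF : ∀ d, Finite (𝒴.F d)) (hT : 𝒴.IsMaximalTree T) (V₀ : V)
    {P : Set (AsyncAut (𝒴.Pi1 T))} (hP : P = BiAut s (𝒴.Pi1 T)) {Q : ∀ a, Set (AsyncAut (𝒴.G a))}
    (hQ : ∀ a, Q a = BiAut s (𝒴.G a)) :
    ∃ Φ : P → ∀ a : V, Q a, Function.Bijective Φ ∧
      ∀ (L : AsyncAutStruct (𝒴.Pi1 T)) (hL : L.cls ∈ P),
        (∃ X : 𝒴.YGraph V₀, X.IsIso ∧
          (∀ (a : V) (p : X.Vert a), X.label p = (Φ ⟨L.cls, hL⟩ a : AsyncAut (𝒴.G a))) ∧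
          X.IsGraphFor L) ∧
        ∀ a : V, AsyncAut.Induces (𝒴.vert T a) L.cls (Φ ⟨L.cls, hL⟩ a) := by
  subst hP
  obtain rfl := funext hQ
  choose Φ hΦ h using fun c : BiAut s (𝒴.Pi1 T) => exists_induced hF hT c.2
  refine ⟨fun c a => ⟨Φ c a, hΦ c a⟩, ⟨fun c c' e => ?_, fun d => ?_⟩, fun L hL =>
    ⟨exists_isGraphFor hF hT V₀ hL (hΦ ⟨_, hL⟩) (h ⟨_, hL⟩), h ⟨_, hL⟩⟩⟩
  · have e' : ∀ a, Φ c a = Φ c' a := fun a => congrArg Subtype.val (congrFun e a)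
    exact Subtype.ext (eq_of_induces hF hT V₀ c.2 c'.2 (hΦ c) (h c) fun a => e' a ▸ h c' a)
  · obtain ⟨c, hc, hi⟩ := exists_inducing hF hT V₀ fun a => (d a).2
    exact ⟨⟨c, hc⟩, funext fun a => Subtype.ext
      ((h ⟨c, hc⟩ a).eq (vert_injective hT a) (hi a))⟩

end GraphOfGroups

theorem theorem4p2 {V : Type u} {D : Type v} [Finite V] [Finite D]
    (𝒴 : GraphOfGroups.{u, v, w, x} V D) (hF : ∀ d, Finite (𝒴.F d))
    (T : Set D) (hT : 𝒴.IsMaximalTree T) (V₀ : V) :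
    (∀ L : AsyncAutStruct (𝒴.Pi1 T),
      L.IsAsyncBiautomatic ↔
        ∃ X : 𝒴.YGraph V₀, X.IsIso ∧ (∀ (a : V) (p : X.Vert a), X.label p ∈ BiAsyncAut (𝒴.G a)) ∧
          X.IsGraphFor L) ∧
    (∀ L : AsyncAutStruct (𝒴.Pi1 T),
      L.cls ∈ BiSyncAut (𝒴.Pi1 T) ↔
        ∃ X : 𝒴.YGraph V₀, X.IsIso ∧ (∀ (a : V) (p : X.Vert a), X.label p ∈ BiSyncAut (𝒴.G a)) ∧
          X.IsGraphFor L) ∧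
    (∃ Φ : BiAsyncAut (𝒴.Pi1 T) → ∀ a : V, BiAsyncAut (𝒴.G a),
      Function.Bijective Φ ∧
      ∀ (L : AsyncAutStruct (𝒴.Pi1 T)) (hL : L.cls ∈ BiAsyncAut (𝒴.Pi1 T)),
        (∃ X : 𝒴.YGraph V₀, X.IsIso ∧
          (∀ (a : V) (p : X.Vert a), X.label p = (Φ ⟨L.cls, hL⟩ a : AsyncAut (𝒴.G a))) ∧
          X.IsGraphFor L) ∧
        ∀ a : V, AsyncAut.Induces (𝒴.vert T a) L.cls (Φ ⟨L.cls, hL⟩ a)) ∧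
    (∃ Ψ : BiSyncAut (𝒴.Pi1 T) → ∀ a : V, BiSyncAut (𝒴.G a),
      Function.Bijective Ψ ∧
      ∀ (L : AsyncAutStruct (𝒴.Pi1 T)) (hL : L.cls ∈ BiSyncAut (𝒴.Pi1 T)),
        (∃ X : 𝒴.YGraph V₀, X.IsIso ∧
          (∀ (a : V) (p : X.Vert a), X.label p = (Ψ ⟨L.cls, hL⟩ a : AsyncAut (𝒴.G a))) ∧
          X.IsGraphFor L) ∧
        ∀ a : V, AsyncAut.Induces (𝒴.vert T a) L.cls (Ψ ⟨L.cls, hL⟩ a)) := by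
  refine ⟨fun L => ?_, fun L => ?_, ?_, ?_⟩
  · rw [L.isAsyncBiautomatic_iff]
    simp only [biAsyncAut_eq]
    rw [← GraphOfGroups.cls_mem_iff hF hT V₀ L]
    -- Asynchronous biautomaticity depends only on the class, so here the claim holds for `L` itself
    -- and not only up to equivalence.
    exact ⟨fun h => ⟨L, h, rfl⟩, isBi_false_of_cls_mem⟩
  · simp only [biSyncAut_eq]
    exact GraphOfGroups.cls_mem_iff hF hT V₀ L
  · exact GraphOfGroups.exists_bijective_labels hF hT V₀ biAsyncAut_eq fun a => biAsyncAut_eq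
  · exact GraphOfGroups.exists_bijective_labels hF hT V₀ biSyncAut_eq fun a => biSyncAut_eq
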